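/- Let $N\ge 1$ and let $\omega_1,\dots,\omega_N>0$ be non-resonant: $\sum_i m_i\omega_i=0$ with $m_i\in\mathbb Z$ only if all $m_i=0$. Consider the control system $\dot x=Ax+Bu$, $|u|\le 1$, in $\mathbb R^{2N}\ni x=(x_1,y_1,\dots,x_N,y_N)$, where $A$ is block-diagonal with blocks $\begin{pmatrix}0&1\\-\omega_i^2&0\end{pmatrix}$ and $B=(0,1,\dots,0,1)^*$. For $p=(\xi_1,\eta_1,\dots,\xi_N,\eta_N)$ put $z_i=(\eta_i^2+\omega_i^{-2}\xi_i^2)^{1/2}$ and $$H(p)=\frac1{(2\pi)^N}\int_{[0,2\pi]^N}\Big|\sum_{i=1}^N z_i\cos\varphi_i\Big|\,d\varphi ,$$ let $\Omega$ be the convex body with support function $H$, and let $\rho$ be its Minkowski functional, so that $x=\rho(x)\phi$ with $\phi\in\partial\Omega$ for $x\neq0$. For $x\ne0$ let $p(x)$ be the vector with $\rho(x)^{-1}x=\frac{\partial H}{\partial p}(p(x))$ and $H(p(x))=1$. A motion under the feedback $$u(x)=-\operatorname{sign}(B,p(x))\qquad(\ast)$$ is an absolutely continuous solution of $\dot x=Ax+Bu$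 for almost all $t$, where $u=-\operatorname{sign}(B,p(x))$ if $(B,p(x))\neq0$ and $u\in[-1,1]$ is arbitrary if $(B,p(x))=0$ (Filippov solution). For $p$ with $H(p)=1$, $(p,B)=0$ put $\widetilde B=\frac{\partial^2\rho}{\partial x^2}(\phi)B$ with $\phi=\frac{\partial H}{\partial p}(p)$, and $f(p)=(p,AB)/(\widetilde B,B)$. Consider the trajectories $p(t)$, $t\in\mathbb R$, of $$\dot p=-A^*p+\widetilde B f(p),\qquad H(p)=1,\quad (p,B)=0,$$ that is, absolutely continuous solutions (for almost all $t$) that are the momenta of points $\phi(t)=\frac{\partial H}{\partial p}(p(t))\in\partial\Omega$ moving by $\dot\phi=A\phi+Bf(p)$. Let $\mu$ be the minimum, over these trajectories, of the (essential) maximum of $|f|$ on the trajectory. This minimum is attained, and $0<\mu<\infty$. For every $\epsilon>0$: 1. there are constants $c(\epsilon)>0$ and $T_0(\epsilon)>0$ such that for every motion under $(\ast)$ on a time interval $[a,b]$ of length $T=b-a\ge T_0(\epsilon)$ that stays in the domain $\rho\ge\mu^{-1}+\epsilon$ one has $\rho(x(a))-\rho(x(b))\ge c(\epsilon)T$; 2.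 there is an infinitely long motion under $(\ast)$, defined for all $t\in\mathbb R$, that stays in the domain $\mu^{-1}-\epsilon\le\rho\le\mu^{-1}$ and along which $\rho$ is constant. -/

import Mathlib

open MeasureTheory
open scoped InnerProductSpace

noncomputable section

namespace Oscillators

/-- The phase space `ℝ^{2N}` with its Euclidean structure. The index `(0, i)` is the position `x_i`
(or the dual variable `ξ_i`), the index `(1, i)` is the velocity `y_i` (or the dual variable `η_i`). -/
abbrev Phase (N : ℕ) := EuclideanSpace ℝ (Fin 2 × Fin N)

variable {N : ℕ}

/-- The block-diagonal matrix with blocks `(0, 1; -ω_i², 0)`, as an operator on the phase space. -/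
def opA (ω : Fin N → ℝ) : Phase N →L[ℝ] Phase N :=
  Matrix.toEuclideanCLM (n := Fin 2 × Fin N) (𝕜 := ℝ)
    (Matrix.blockDiagonal fun i => !![0, 1; -(ω i) ^ 2, 0])

/-- The vector `(0, 1, …, 0, 1)` through which the scalar control acts. -/
def vecB (N : ℕ) : Phase N := WithLp.toLp 2 fun k => if k.1 = 1 then 1 else 0

/-- No nontrivial integer relations between the eigenfrequencies. -/
def NonResonant (ω : Fin N → ℝ) : Prop :=
  ∀ m : Fin N → ℤ, ∑ i, (m i : ℝ) * ω i = 0 → m = 0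

/-- `z_i = (η_i² + ω_i⁻² ξ_i²)^{1/2}`. -/
def amplitude (ω : Fin N → ℝ) (p : Phase N) (i : Fin N) : ℝ :=
  √(p (1, i) ^ 2 + (ω i)⁻¹ ^ 2 * p (0, i) ^ 2)

/-- `𝔥(z) = (2π)^{-N} ∫_{[0,2π]^N} |∑ z_i cos φ_i| dφ`. -/
def averagedAbs (z : Fin N → ℝ) : ℝ :=
  ((2 * Real.pi) ^ N)⁻¹ *
    ∫ φ in Set.pi Set.univ (fun _ : Fin N => Set.Icc 0 (2 * Real.pi)),
      |∑ i, z i * Real.cos (φ i)|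

/-- The support function `H_Ω`. -/
def suppH (ω : Fin N → ℝ) (p : Phase N) : ℝ := averagedAbs (amplitude ω p)

/-- The convex body `Ω` with support function `H_Ω`. -/
def bodyOmega (ω : Fin N → ℝ) : Set (Phase N) := {x | ∀ p, ⟪x, p⟫_ℝ ≤ suppH ω p}

/-- The radial coordinate: `x = ρ φ` with `φ ∈ ∂Ω`; this is the Minkowski functional of `Ω`. -/
def rho (ω : Fin N → ℝ) (x : Phase N) : ℝ := gauge (bodyOmega ω) x

/-- `p` is the momentum `p(x)`: `ρ(x)⁻¹ x = ∂H_Ω/∂p (p)`, normalized by `H_Ω(p) = 1`.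
There is no momentum at `x = 0`. -/
def IsMomentum (ω : Fin N → ℝ) (x p : Phase N) : Prop :=
  suppH ω p = 1 ∧ HasGradientAt (suppH ω) ((rho ω x)⁻¹ • x) p

/-- The set-valued sign: `[-1, 1]` at `0`. -/
def signSet (s : ℝ) : Set ℝ := if s = 0 then Set.Icc (-1) 1 else {Real.sign s}

/-- On the interval `I` the curve `y` is locally absolutely continuous and `y' = v` almost
everywhere, in integrated form. -/
def SolvesOn (I : Set ℝ) (y v : ℝ → Phase N) : Prop :=
  ∀ s ∈ I, ∀ t ∈ I, IntervalIntegrable v volume s t ∧ y t - y s = ∫ τ in s..t, v τ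

/-- `x` is a motion on the interval `I` of `x' = A x + B u` under the feedback
`u(x) = -sign (B, p(x))`. The right-hand side is discontinuous; solutions are understood in the
sense of Filippov, so that `u` may take any value in `[-1, 1]` on the switching surface. -/
def IsMotion (ω : Fin N → ℝ) (I : Set ℝ) (x : ℝ → Phase N) : Prop :=
  ∃ u : ℝ → ℝ,
    SolvesOn I x (fun t => opA ω (x t) + u t • vecB N) ∧
    ∀ᵐ t ∂(volume.restrict I), ∃ p, IsMomentum ω (x t) p ∧ -u t ∈ signSet ⟪vecB N, p⟫_ℝ

/-- `B̃ = (∂²ρ/∂x²) B`, evaluated at the point `φ = ∂H_Ω/∂p (p)` of `∂Ω` with momentum `p`. -/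
def tildeB (ω : Fin N → ℝ) (p : Phase N) : Phase N :=
  fderiv ℝ (gradient (rho ω)) (gradient (suppH ω) p) (vecB N)

/-- The singular control `f(p) = (p, AB) / (B̃, B)`. -/
def singularControl (ω : Fin N → ℝ) (p : Phase N) : ℝ :=
  ⟪p, opA ω (vecB N)⟫_ℝ / ⟪tildeB ω p, vecB N⟫_ℝ

/-- Complete trajectories of the dual system `p' = -A* p + B̃ f(p)` on the sphere
`{H_Ω(p) = 1, (p, B) = 0}`. The system describes the motion of the momentum `p` of a point
`φ = ∂H_Ω/∂p (p)` which moves along `∂Ω` according to `φ' = A φ + B f(p)`. Where `H_Ω` is `C²` the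
equation for `φ` follows from the one for `p`; as `H_Ω` is not `C²` everywhere, both are required. -/
def IsSingularTrajectory (ω : Fin N → ℝ) (p : ℝ → Phase N) : Prop :=
  (∀ t, suppH ω (p t) = 1) ∧
  (∀ t, ⟪p t, vecB N⟫_ℝ = 0) ∧
  SolvesOn Set.univ p
    (fun t => -(ContinuousLinearMap.adjoint (opA ω) (p t))
      + singularControl ω (p t) • tildeB ω (p t)) ∧
  SolvesOn Set.univ (fun t => gradient (suppH ω) (p t))
    (fun t => opA ω (gradient (suppH ω) (p t)) + singularControl ω (p t) • vecB N)

/-- `K` is the maximum of `|f|` along `p`: the least bound of `|f(p(t))|` valid for almost all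
times. (At exceptional points where `(B̃, B) = 0` the quotient `f` is not defined.) -/
def IsMaxAlong (ω : Fin N → ℝ) (p : ℝ → Phase N) (K : ℝ) : Prop :=
  IsLeast {M : ℝ | ∀ᵐ t : ℝ, |singularControl ω (p t)| ≤ M} K

/-- The (finite) maxima of `|f|` along the trajectories of the dual system. -/
def singularMaxima (ω : Fin N → ℝ) : Set ℝ :=
  {K | ∃ p, IsSingularTrajectory ω p ∧ IsMaxAlong ω p K}

/-- The number `μ`: the minimum over trajectories of the maximum of `|f|`. -/
def mu (ω : Fin N → ℝ) : ℝ := sInf (singularMaxima ω)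

end Oscillators

end

/-! The support function is an average of absolute values of linear forms, `H(p) = E |⟪p, torusVec
φ⟫|` over the torus of angles, so `H` is a norm and `ρ` is the dual norm with gradient `p(x)`. The
free flow `exp (tA)` preserves `ρ`, hence along a motion under the feedback `ρ' = u (B, p) = -|(B,
p)|`. Everything turns on motions whose radius almost does not decrease.

Suppose the drop of `ρ` above the level `r = μ⁻¹ + ε` is not uniform. Then there are motions on
longer and longer intervals with drops tending to zero. Divided by their radius at time zero, these
motions converge along a subsequence (`exists_limit_motion`). The limit is a curve on `∂Ω` with `(p,
B) = 0`, driven by a control bounded by `r⁻¹ < μ`: a singular curve. Its momentum solves the dual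
system with `f` equal to the control, which contradicts the minimality of `μ`. Conversely, a
minimizing singular curve multiplied by `μ⁻¹` needs a control bounded by 1 and stays on the
switching surface, so it is a motion with constant `ρ = μ⁻¹`. The same compactness shows that `μ` is
attained. It is positive because a free motion cannot stay in `(p, B) = 0`, by Kalman's condition,
and the set of maxima is nonempty because of the equilibrium under a constant control.

The analytic work is to show that every singular curve is a trajectory of the dual system
(`IsSingularCurve.ae_hasDerivAt_momentum`), although `H` is not everywhere `C²`. Three facts carry
it.

The gradient of `H` is strongly monotone on the sphere `H = 1` (`strong_monotone`): a displacement
of size `δ` in a non-radial direction flips the sign of the linear form on a set of angles of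
measure at least `cδ`. Hence the momentum is a Lipschitz function on `∂Ω`.

`H` is twice differentiable where all amplitudes are positive and, for `N = 2`, distinct. For `N ≥
3` this follows from a Fourier formula with a product of Bessel functions, each decaying like
`t^(-1/2)`; the cases `N = 1, 2` are explicit.

A singular curve spends almost no time at the remaining momenta. There a symmetry of `H` forces
algebraic relations on `φ`; differentiating them at almost every time gives a vanishing control, or
`φ = 0`. A vanishing control makes the momentum move freely in the hyperplane, which Kalman's
condition allows only on a null set. The same argument shows `(B̃, B) ≠ 0` almost everywhere. -/

open MeasureTheory Filter Topology
open scoped InnerProductSpace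

noncomputable section

namespace Oscillators

variable {N : ℕ}

/-! ### The uniform measure on the torus of angles -/

/-- The uniform probability measure on one period of an angle. -/
def angleMeasure : Measure ℝ :=
  (ENNReal.ofReal (2 * Real.pi))⁻¹ • volume.restrict (Set.Ioc 0 (2 * Real.pi))

instance : IsProbabilityMeasure angleMeasure := by
  constructor
  simp only [angleMeasure, Measure.smul_apply, Measure.restrict_apply_univ, Real.volume_Ioc,
    sub_zero, smul_eq_mul]
  exact ENNReal.inv_mul_cancel (by simp [Real.pi_pos]) ENNReal.ofReal_ne_top

lemma integral_angleMeasure {E : Type*} [NormedAddCommGroup E] [NormedSpace ℝ E] (f : ℝ → E) :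
    ∫ θ, f θ ∂angleMeasure = (2 * Real.pi)⁻¹ • ∫ θ in (0 : ℝ)..(2 * Real.pi), f θ := by
  rw [angleMeasure, integral_smul_measure, intervalIntegral.integral_of_le Real.two_pi_pos.le,
    ENNReal.toReal_inv, ENNReal.toReal_ofReal Real.two_pi_pos.le]

lemma angleMeasure_absolutelyContinuous : angleMeasure ≪ volume :=
  (Measure.restrict_le_self.absolutelyContinuous).smul_left _

/-- The uniform probability measure on the torus of angles. -/
def torusMeasure (N : ℕ) : Measure (Fin N → ℝ) := Measure.pi fun _ => angleMeasure

instance : IsProbabilityMeasure (torusMeasure N) := by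
  unfold torusMeasure; infer_instance

lemma torusMeasure_eq : torusMeasure N = (ENNReal.ofReal ((2 * Real.pi) ^ N))⁻¹ •
    volume.restrict (Set.pi Set.univ fun _ : Fin N => Set.Icc 0 (2 * Real.pi)) := by
  have h0 : ENNReal.ofReal (2 * Real.pi) ≠ 0 := by simp [Real.pi_pos]
  refine Measure.pi_eq fun s hs => ?_
  rw [Measure.smul_apply, volume_pi, Measure.restrict_pi_pi, Measure.pi_pi,
    ENNReal.ofReal_pow Real.two_pi_pos.le]
  simp only [angleMeasure, Measure.smul_apply, smul_eq_mul, Finset.prod_mul_distrib,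
    Finset.prod_const, Finset.card_univ, Fintype.card_fin, ENNReal.inv_pow]
  congr 1
  refine Finset.prod_congr rfl fun i _ => ?_
  rw [Measure.restrict_congr_set Ioc_ae_eq_Icc]

lemma averagedAbs_eq_integral (z : Fin N → ℝ) :
    averagedAbs z = ∫ φ, |∑ i, z i * Real.cos (φ i)| ∂torusMeasure N := by
  rw [averagedAbs, torusMeasure_eq, integral_smul_measure, ENNReal.toReal_inv,
    ENNReal.toReal_ofReal (by positivity), smul_eq_mul]

/-- Rotations of the circle preserve the uniform measure. -/
lemma exists_rotation (α : ℝ) : ∃ τ : ℝ → ℝ, MeasurePreserving τ angleMeasure angleMeasure ∧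
    ∀ θ, Real.cos (τ θ) = Real.cos (θ + α) ∧ Real.sin (τ θ) = Real.sin (θ + α) := by
  have : Fact (0 < 2 * Real.pi) := ⟨Real.two_pi_pos⟩
  let T := 2 * Real.pi
  -- The rotation is a translation of the circle read in the chart `(0, 2π]`. It equals `θ + α` only
  -- modulo `2π`, which is why the conclusion speaks of cosine and sine.
  let g : AddCircle T → ℝ := fun x => (AddCircle.equivIoc T 0 x : ℝ)
  have hg : MeasurePreserving g volume (volume.restrict (Set.Ioc 0 (0 + T))) :=
    (measurePreserving_subtype_coe measurableSet_Ioc).comp (AddCircle.measurePreserving_equivIoc T)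
  have hmk := AddCircle.measurePreserving_mk T 0
  have hadd : MeasurePreserving (fun x : AddCircle T => x + (α : AddCircle T)) volume volume :=
    measurePreserving_add_right volume _
  have hcomp := (hg.comp (hadd.comp hmk)).smul_measure (ENNReal.ofReal T)⁻¹
  simp only [zero_add] at hcomp
  refine ⟨_, hcomp, fun θ => ?_⟩
  have h1 : ((g ((θ : AddCircle T) + (α : AddCircle T)) : ℝ) : AddCircle T)
      = ((θ + α : ℝ) : AddCircle T) := by
    have := (AddCircle.equivIoc T 0).symm_apply_apply ((θ : AddCircle T) + (α : AddCircle T))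
    rw [AddCircle.coe_add]
    exact this
  have h2 : ((g ((θ : AddCircle T) + (α : AddCircle T)) : ℝ) : Real.Angle)
      = ((θ + α : ℝ) : Real.Angle) := h1
  have hc := congrArg Real.Angle.cos h2
  have hs := congrArg Real.Angle.sin h2
  rw [Real.Angle.cos_coe, Real.Angle.cos_coe] at hc
  rw [Real.Angle.sin_coe, Real.Angle.sin_coe] at hs
  exact ⟨hc, hs⟩

/-! ### The support function as a mean of absolute values of linear forms -/

/-- The vector `(sin φ_i / ω_i, cos φ_i)_i`. -/
def torusVec (ω : Fin N → ℝ) (φ : Fin N → ℝ) : Phase N :=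
  WithLp.toLp 2 fun k => if k.1 = 1 then Real.cos (φ k.2) else (ω k.2)⁻¹ * Real.sin (φ k.2)

lemma inner_torusVec (ω : Fin N → ℝ) (p : Phase N) (φ : Fin N → ℝ) :
    ⟪p, torusVec ω φ⟫_ℝ =
      ∑ i, (p (1, i) * Real.cos (φ i) + (ω i)⁻¹ * p (0, i) * Real.sin (φ i)) := by
  rw [PiLp.inner_apply, Fintype.sum_prod_type]
  simp only [torusVec, Fin.sum_univ_two, RCLike.inner_apply, conj_trivial]
  rw [← Finset.sum_add_distrib]
  refine Finset.sum_congr rfl fun i _ => ?_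
  simp
  ring

lemma continuous_torusVec (ω : Fin N → ℝ) : Continuous (torusVec ω) := by
  unfold torusVec
  refine (PiLp.continuous_toLp 2 _).comp (continuous_pi fun k => ?_)
  split_ifs <;> fun_prop

/-- Polar form of a linear combination of cosine and sine. -/
lemma exists_angle (a b : ℝ) : ∃ α, ∀ θ, a * Real.cos θ + b * Real.sin θ =
    √(a ^ 2 + b ^ 2) * Real.cos (θ + α) := by
  refine ⟨-(Complex.arg ⟨a, b⟩), fun θ => ?_⟩
  have hn : ‖(⟨a, b⟩ : ℂ)‖ = √(a ^ 2 + b ^ 2) := by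
    rw [Complex.norm_def, Complex.normSq_mk]; congr 1; ring
  have hc := Complex.norm_mul_cos_arg ⟨a, b⟩
  have hs := Complex.norm_mul_sin_arg ⟨a, b⟩
  rw [hn] at hc hs
  rw [Real.cos_add, Real.cos_neg, Real.sin_neg]
  simp only at hc hs
  linear_combination (-Real.cos θ) * hc - Real.sin θ * hs

lemma amplitude_angle (ω : Fin N → ℝ) (p : Phase N) (i : Fin N) : ∃ α, ∀ θ,
    p (1, i) * Real.cos θ + (ω i)⁻¹ * p (0, i) * Real.sin θ =
      amplitude ω p i * Real.cos (θ + α) := by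
  obtain ⟨α, hα⟩ := exists_angle (p (1, i)) ((ω i)⁻¹ * p (0, i))
  refine ⟨α, fun θ => ?_⟩
  rw [hα, amplitude, mul_pow]

/-- A phase shift in each angle, harmless for the uniform measure, turns `z_i cos φ_i` into an
expression linear in `p`. Convexity, homogeneity and the gradient of `H` are all read off from this
form. -/
lemma suppH_eq_integral (ω : Fin N → ℝ) (p : Phase N) :
    suppH ω p = ∫ φ, |⟪p, torusVec ω φ⟫_ℝ| ∂torusMeasure N := by
  choose α hα using amplitude_angle ω p
  choose τ hτ hτc using fun i => exists_rotation (α i)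
  have hpres : MeasurePreserving (fun φ : Fin N → ℝ => fun i => τ i (φ i))
      (torusMeasure N) (torusMeasure N) := measurePreserving_pi _ _ hτ
  rw [suppH, averagedAbs_eq_integral]
  conv_lhs => rw [← hpres.map_eq]
  rw [integral_map hpres.measurable.aemeasurable
    (Continuous.aestronglyMeasurable (by fun_prop))]
  refine integral_congr_ae (.of_forall fun φ => ?_)
  simp only [inner_torusVec, (hτc _ _).1, hα]

/-- The integrand has to factor through `torusVec`, since rotations are known only through their
cosine and sine. -/
lemma integral_torusVec_add {E : Type*} [NormedAddCommGroup E] [NormedSpace ℝ E]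
    (ω : Fin N → ℝ) {k : Phase N → E} (hk : StronglyMeasurable k) (α : Fin N → ℝ) :
    ∫ φ, k (torusVec ω φ) ∂torusMeasure N = ∫ φ, k (torusVec ω (φ + α)) ∂torusMeasure N := by
  choose τ hτ hτc using fun i => exists_rotation (α i)
  have hpres : MeasurePreserving (fun φ : Fin N → ℝ => fun i => τ i (φ i))
      (torusMeasure N) (torusMeasure N) := measurePreserving_pi _ _ hτ
  conv_lhs => rw [← hpres.map_eq]
  rw [integral_map (f := fun φ => k (torusVec ω φ)) hpres.measurable.aemeasurable
    (hk.comp_measurable (continuous_torusVec ω).measurable).aestronglyMeasurable]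
  refine integral_congr_ae (.of_forall fun φ => ?_)
  simp only [torusVec, (hτc _ _).1, (hτc _ _).2, Pi.add_apply]

/-- Averaging over one coordinate first does not change the mean over the torus. -/
lemma measurePreserving_update (i : Fin N) :
    MeasurePreserving (fun x : (Fin N → ℝ) × ℝ => Function.update x.1 i x.2)
      ((torusMeasure N).prod angleMeasure) (torusMeasure N) := by
  have hm : Measurable fun x : (Fin N → ℝ) × ℝ => Function.update x.1 i x.2 := by
    refine measurable_pi_lambda _ fun j => ?_
    by_cases h : j = i
    · subst h; simpa using measurable_snd
    · simp only [Function.update_of_ne h]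
      exact (measurable_pi_apply j).comp measurable_fst
  refine ⟨hm, (Measure.pi_eq fun s hs => ?_).symm⟩
  rw [Measure.map_apply hm (MeasurableSet.univ_pi hs)]
  have : (fun x : (Fin N → ℝ) × ℝ => Function.update x.1 i x.2) ⁻¹' Set.pi Set.univ s =
      Set.pi Set.univ (Function.update s i Set.univ) ×ˢ s i := by
    ext ⟨φ, θ⟩
    simp only [Set.mem_preimage, Set.mem_pi, Set.mem_univ, true_implies, Set.mem_prod]
    constructor
    · intro h
      refine ⟨fun j => ?_, by simpa using h i⟩
      by_cases hj : j = i
      · subst hj; simp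
      · simpa [hj] using h j
    · rintro ⟨h1, h2⟩ j
      by_cases hj : j = i
      · subst hj; simpa using h2
      · simpa [hj] using h1 j
  rw [this, Measure.prod_prod, torusMeasure, Measure.pi_pi,
    ← Finset.mul_prod_erase Finset.univ _ (Finset.mem_univ i),
    ← Finset.mul_prod_erase Finset.univ (fun j => angleMeasure (s j)) (Finset.mem_univ i)]
  simp only [Function.update_self, measure_univ, one_mul]
  rw [mul_comm]
  congr 1
  refine Finset.prod_congr rfl fun j hj => ?_
  rw [Function.update_of_ne (Finset.ne_of_mem_erase hj)]

lemma countable_cos_eq (c : ℝ) : {θ : ℝ | Real.cos θ = c}.Countable := by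
  by_cases h : ∃ y, Real.cos y = c
  · obtain ⟨y, rfl⟩ := h
    refine (Set.Countable.union (Set.countable_range fun k : ℤ => 2 * k * Real.pi + y)
      (Set.countable_range fun k : ℤ => 2 * k * Real.pi - y)).mono fun θ hθ => ?_
    obtain ⟨k, hk | hk⟩ := Real.cos_eq_cos_iff.1 (Eq.symm hθ)
    · exact Or.inl ⟨k, hk.symm⟩
    · exact Or.inr ⟨k, hk.symm⟩
  · push Not at h
    convert Set.countable_empty
    ext θ; simpa using h θ

lemma amplitude_nonneg (ω : Fin N → ℝ) (p : Phase N) (i : Fin N) : 0 ≤ amplitude ω p i :=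
  Real.sqrt_nonneg _

lemma amplitude_sq (ω : Fin N → ℝ) (p : Phase N) (i : Fin N) :
    amplitude ω p i ^ 2 = p (1, i) ^ 2 + (ω i)⁻¹ ^ 2 * p (0, i) ^ 2 :=
  Real.sq_sqrt (by positivity)

lemma amplitude_eq_zero_iff {ω : Fin N → ℝ} (hpos : ∀ i, 0 < ω i) (p : Phase N) (i : Fin N) :
    amplitude ω p i = 0 ↔ p (0, i) = 0 ∧ p (1, i) = 0 := by
  have h := amplitude_sq ω p i
  have hi := hpos i
  constructor
  · intro h0
    rw [h0] at h
    have h1 : (ω i)⁻¹ ^ 2 * p (0, i) ^ 2 = 0 := by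
      nlinarith [sq_nonneg (p (1, i)), mul_nonneg (sq_nonneg ((ω i)⁻¹)) (sq_nonneg (p (0, i)))]
    have h2 : p (1, i) ^ 2 = 0 := by nlinarith
    refine ⟨?_, by simpa using h2⟩
    rcases mul_eq_zero.1 h1 with h3 | h3
    · have : (ω i)⁻¹ = 0 := by simpa using h3
      exact absurd this (by positivity)
    · simpa using h3
  · rintro ⟨h0, h1⟩
    rw [h0, h1] at h
    simpa using h

lemma exists_amplitude_ne_zero {ω : Fin N → ℝ} (hpos : ∀ i, 0 < ω i) {p : Phase N} (hp : p ≠ 0) :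
    ∃ i, amplitude ω p i ≠ 0 := by
  by_contra! h
  refine hp (PiLp.ext fun ⟨k, i⟩ => ?_)
  have := (amplitude_eq_zero_iff hpos p i).1 (h i)
  fin_cases k
  · exact this.1
  · exact this.2

lemma inner_torusVec_update (ω : Fin N → ℝ) (p : Phase N) (φ : Fin N → ℝ) (i : Fin N) (θ : ℝ) :
    ⟪p, torusVec ω (Function.update φ i θ)⟫_ℝ =
      (p (1, i) * Real.cos θ + (ω i)⁻¹ * p (0, i) * Real.sin θ) +
      ∑ j ∈ Finset.univ.erase i,
        (p (1, j) * Real.cos (φ j) + (ω j)⁻¹ * p (0, j) * Real.sin (φ j)) := by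
  rw [inner_torusVec, ← Finset.add_sum_erase _ _ (Finset.mem_univ i)]
  congr 1
  · simp
  · refine Finset.sum_congr rfl fun j hj => ?_
    rw [Function.update_of_ne (Finset.ne_of_mem_erase hj)]

/-- A nonzero momentum is orthogonal to `torusVec` only on a null set of angles. -/
lemma ae_inner_torusVec_ne_zero {ω : Fin N → ℝ} (hpos : ∀ i, 0 < ω i) {p : Phase N} (hp : p ≠ 0) :
    ∀ᵐ φ ∂torusMeasure N, ⟪p, torusVec ω φ⟫_ℝ ≠ 0 := by
  obtain ⟨i, hi⟩ := exists_amplitude_ne_zero hpos hp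
  have hpres := measurePreserving_update (N := N) i
  have hms : MeasurableSet {φ | ⟪p, torusVec ω φ⟫_ℝ ≠ 0} := by
    have : Continuous fun φ => ⟪p, torusVec ω φ⟫_ℝ :=
      continuous_const.inner (continuous_torusVec ω)
    exact (measurableSet_eq_fun this.measurable measurable_const).compl
  rw [← hpres.map_eq, ae_map_iff hpres.measurable.aemeasurable hms]
  -- By Fubini it suffices to vary the angle of an oscillator with nonzero amplitude. With the
  -- others frozen, the equation prescribes a value of `cos (θ + α)`, which has countably many
  -- solutions.
  refine (Measure.ae_prod_iff_ae_ae (hpres.measurable hms)).2 (.of_forall fun φ => ?_)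
  refine angleMeasure_absolutelyContinuous.ae_le ?_
  obtain ⟨α, hα⟩ := amplitude_angle ω p i
  set s := ∑ j ∈ Finset.univ.erase i,
        (p (1, j) * Real.cos (φ j) + (ω j)⁻¹ * p (0, j) * Real.sin (φ j))
  have hc : {θ : ℝ | Real.cos (θ + α) = -s / amplitude ω p i}.Countable :=
    (countable_cos_eq _).preimage (add_left_injective α)
  filter_upwards [hc.ae_notMem volume] with θ hθ
  rw [inner_torusVec_update, hα]
  intro h0
  refine hθ (show Real.cos (θ + α) = -s / amplitude ω p i from ?_)
  field_simp
  linarith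

/-! ### The gradient of the support function -/

/-- The sign of a real number, as a real number. -/
def sgn (x : ℝ) : ℝ := (SignType.sign x : ℝ)

lemma sgn_of_pos {x : ℝ} (h : 0 < x) : sgn x = 1 := by simp [sgn, sign_pos h]
lemma sgn_of_neg {x : ℝ} (h : x < 0) : sgn x = -1 := by simp [sgn, sign_neg h]
lemma sgn_zero : sgn 0 = 0 := by simp [sgn]

lemma sgn_mul_self (x : ℝ) : sgn x * x = |x| := by
  rcases lt_trichotomy x 0 with h | h | h
  · rw [sgn_of_neg h, abs_of_neg h]; ring
  · simp [h]
  · rw [sgn_of_pos h, abs_of_pos h]; ring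

lemma abs_sgn_le (x : ℝ) : |sgn x| ≤ 1 := by
  rcases lt_trichotomy x 0 with h | h | h
  · simp [sgn_of_neg h]
  · simp [h, sgn_zero]
  · simp [sgn_of_pos h]

lemma sgn_mul_le (x y : ℝ) : sgn x * y ≤ |y| := by
  calc sgn x * y ≤ |sgn x * y| := le_abs_self _
    _ = |sgn x| * |y| := abs_mul _ _
    _ ≤ 1 * |y| := by gcongr; exact abs_sgn_le x
    _ = |y| := one_mul _

lemma monotone_sgn : Monotone sgn := by
  intro x y h
  rcases lt_trichotomy x 0 with hx | hx | hx <;> rcases lt_trichotomy y 0 with hy | hy | hy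
  all_goals first
    | (exfalso; linarith)
    | (simp [sgn_of_neg, sgn_of_pos, sgn_zero, hx, hy])

lemma measurable_sgn : Measurable sgn := monotone_sgn.measurable

lemma exists_norm_torusVec_le (ω : Fin N → ℝ) : ∃ C, 0 < C ∧ ∀ φ, ‖torusVec ω φ‖ ≤ C := by
  refine ⟨√(∑ k : Fin 2 × Fin N, (1 + |(ω k.2)⁻¹|) ^ 2) + 1, by positivity, fun φ => ?_⟩
  rw [EuclideanSpace.norm_eq]
  refine (Real.sqrt_le_sqrt (Finset.sum_le_sum fun k _ => ?_)).trans (le_add_of_nonneg_right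
    zero_le_one)
  gcongr
  simp only [torusVec, Real.norm_eq_abs]
  split_ifs
  · linarith [Real.abs_cos_le_one (φ k.2), abs_nonneg (ω k.2)⁻¹]
  · rw [abs_mul]
    nlinarith [Real.abs_sin_le_one (φ k.2), abs_nonneg (ω k.2)⁻¹]

lemma abs_inner_torusVec_le {ω : Fin N → ℝ} {C : ℝ} (hC : ∀ φ, ‖torusVec ω φ‖ ≤ C)
    (p : Phase N) (φ : Fin N → ℝ) : |⟪p, torusVec ω φ⟫_ℝ| ≤ ‖p‖ * C :=
  (abs_real_inner_le_norm _ _).trans (by gcongr; exact hC φ)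

lemma continuous_inner_torusVec (ω : Fin N → ℝ) :
    Continuous fun x : Phase N × (Fin N → ℝ) => ⟪x.1, torusVec ω x.2⟫_ℝ :=
  continuous_fst.inner ((continuous_torusVec ω).comp continuous_snd)

lemma continuous_inner_torusVec_right (ω : Fin N → ℝ) (p : Phase N) :
    Continuous fun φ => ⟪p, torusVec ω φ⟫_ℝ :=
  continuous_const.inner (continuous_torusVec ω)

lemma integrable_inner_torusVec (ω : Fin N → ℝ) (p : Phase N) :
    Integrable (fun φ => ⟪p, torusVec ω φ⟫_ℝ) (torusMeasure N) := by
  obtain ⟨C, -, hC⟩ := exists_norm_torusVec_le ω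
  exact Integrable.of_bound (continuous_inner_torusVec_right ω p).aestronglyMeasurable (‖p‖ * C)
    (.of_forall fun φ => by simpa using abs_inner_torusVec_le hC p φ)

lemma integrable_sgn_mul (ω : Fin N → ℝ) (p q : Phase N) :
    Integrable (fun φ => sgn ⟪p, torusVec ω φ⟫_ℝ * ⟪q, torusVec ω φ⟫_ℝ) (torusMeasure N) := by
  refine (integrable_inner_torusVec ω q).bdd_mul (c := 1)
    (measurable_sgn.comp (continuous_inner_torusVec_right ω p).measurable).aestronglyMeasurable
    (.of_forall fun φ => ?_)
  simpa using abs_sgn_le _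

/-- The gradient of the support function. -/
def gradH (ω : Fin N → ℝ) (p : Phase N) : Phase N :=
  ∫ φ, sgn ⟪p, torusVec ω φ⟫_ℝ • torusVec ω φ ∂torusMeasure N

lemma integrable_sgn_smul (ω : Fin N → ℝ) (p : Phase N) :
    Integrable (fun φ => sgn ⟪p, torusVec ω φ⟫_ℝ • torusVec ω φ) (torusMeasure N) := by
  obtain ⟨C, -, hC⟩ := exists_norm_torusVec_le ω
  refine Integrable.of_bound (C := C) ?_ (.of_forall fun φ => ?_)
  · exact ((measurable_sgn.comp
      (continuous_inner_torusVec_right ω p).measurable).aestronglyMeasurable).smul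
      (continuous_torusVec ω).aestronglyMeasurable
  · rw [norm_smul, Real.norm_eq_abs]
    have := abs_sgn_le ⟪p, torusVec ω φ⟫_ℝ
    nlinarith [hC φ, norm_nonneg (torusVec ω φ)]

lemma inner_gradH (ω : Fin N → ℝ) (p q : Phase N) : ⟪gradH ω p, q⟫_ℝ =
    ∫ φ, sgn ⟪p, torusVec ω φ⟫_ℝ * ⟪q, torusVec ω φ⟫_ℝ ∂torusMeasure N := by
  rw [real_inner_comm, gradH, ← integral_inner (integrable_sgn_smul ω p)]
  refine integral_congr_ae (.of_forall fun φ => ?_)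
  simp only [inner_smul_right]

lemma inner_gradH_self (ω : Fin N → ℝ) (p : Phase N) : ⟪gradH ω p, p⟫_ℝ = suppH ω p := by
  rw [inner_gradH, suppH_eq_integral]
  simp only [sgn_mul_self]

/-- Because `|sgn| ≤ 1`, the vector `gradH ω p` lies in `Ω`; together with `inner_gradH_self` this
is the supporting hyperplane inequality. -/
lemma inner_gradH_le (ω : Fin N → ℝ) (p q : Phase N) : ⟪gradH ω p, q⟫_ℝ ≤ suppH ω q := by
  rw [inner_gradH, suppH_eq_integral]
  exact integral_mono (integrable_sgn_mul ω p q) (integrable_inner_torusVec ω q).abs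
    fun φ => sgn_mul_le _ _

lemma suppH_smul (ω : Fin N → ℝ) (c : ℝ) (p : Phase N) : suppH ω (c • p) = |c| * suppH ω p := by
  simp only [suppH_eq_integral, inner_smul_left, conj_trivial, abs_mul, integral_const_mul]

lemma suppH_zero (ω : Fin N → ℝ) : suppH ω (0 : Phase N) = 0 := by
  simpa using suppH_smul ω 0 0

lemma suppH_add_le (ω : Fin N → ℝ) (p q : Phase N) :
    suppH ω (p + q) ≤ suppH ω p + suppH ω q := by
  simp only [suppH_eq_integral]
  rw [← integral_add (integrable_inner_torusVec ω p).abs (integrable_inner_torusVec ω q).abs]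
  refine integral_mono (integrable_inner_torusVec ω (p + q)).abs
    ((integrable_inner_torusVec ω p).abs.add (integrable_inner_torusVec ω q).abs) fun φ => ?_
  simp only [inner_add_left]
  exact abs_add_le _ _

lemma suppH_le (ω : Fin N → ℝ) {C : ℝ} (hC : ∀ φ, ‖torusVec ω φ‖ ≤ C) (p : Phase N) :
    suppH ω p ≤ C * ‖p‖ := by
  rw [suppH_eq_integral]
  calc _ ≤ ∫ _, ‖p‖ * C ∂torusMeasure N :=
        integral_mono (integrable_inner_torusVec ω p).abs (integrable_const _)
          fun φ => abs_inner_torusVec_le hC p φ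
    _ = C * ‖p‖ := by simp [mul_comm]

lemma continuous_suppH (ω : Fin N → ℝ) : Continuous (suppH ω) := by
  obtain ⟨C, hC0, hC⟩ := exists_norm_torusVec_le ω
  refine (LipschitzWith.of_le_add_mul ⟨C, hC0.le⟩ fun p q => ?_).continuous
  have h1 := suppH_add_le ω q (p - q)
  have h2 := suppH_le ω hC (p - q)
  rw [add_sub_cancel] at h1
  rw [dist_eq_norm]
  exact h1.trans (by gcongr; exact h2)

lemma suppH_pos {ω : Fin N → ℝ} (hpos : ∀ i, 0 < ω i) {p : Phase N} (hp : p ≠ 0) :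
    0 < suppH ω p := by
  rw [suppH_eq_integral, integral_pos_iff_support_of_nonneg (fun φ => abs_nonneg _)
    (integrable_inner_torusVec ω p).abs]
  have h : (Function.support fun φ => |⟪p, torusVec ω φ⟫_ℝ|) =ᵐ[torusMeasure N] Set.univ := by
    rw [ae_eq_univ]
    have := ae_inner_torusVec_ne_zero hpos hp
    rw [ae_iff] at this
    convert this using 2
    ext φ; simp
  rw [measure_congr h]; simp

/-- The absolute value fails to be differentiable only where `⟪p, torusVec ω φ⟫ = 0`, a null set of
angles, and the integrands are uniformly Lipschitz in `p`. Hence `H` is differentiable at every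
nonzero momentum. -/
lemma hasGradientAt_suppH {ω : Fin N → ℝ} (hpos : ∀ i, 0 < ω i) {p : Phase N} (hp : p ≠ 0) :
    HasGradientAt (suppH ω) (gradH ω p) p := by
  obtain ⟨C, hC0, hC⟩ := exists_norm_torusVec_le ω
  rw [hasGradientAt_iff_hasFDerivAt]
  have hfun : suppH ω = fun q => ∫ φ, |⟪q, torusVec ω φ⟫_ℝ| ∂torusMeasure N :=
    funext (suppH_eq_integral ω)
  let F' : (Fin N → ℝ) → Phase N →L[ℝ] ℝ := fun φ =>
    sgn ⟪p, torusVec ω φ⟫_ℝ • (innerSL ℝ (torusVec ω φ) : Phase N →L[ℝ] ℝ)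
  have hF'm : AEStronglyMeasurable F' (torusMeasure N) :=
    ((measurable_sgn.comp (continuous_inner_torusVec_right ω p).measurable).aestronglyMeasurable).smul
      ((innerSL ℝ).continuous.comp (continuous_torusVec ω)).aestronglyMeasurable
  have key := hasFDerivAt_integral_of_dominated_loc_of_lip (μ := torusMeasure N) (𝕜 := ℝ)
    (F := fun q φ => |⟪q, torusVec ω φ⟫_ℝ|) (F' := F') (x₀ := p) (bound := fun _ => C)
    (s := Set.univ) Filter.univ_mem
    (.of_forall fun q => (integrable_inner_torusVec ω q).abs.aestronglyMeasurable)
    (integrable_inner_torusVec ω p).abs hF'm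
    (.of_forall fun φ => by
      rw [lipschitzOnWith_univ]
      refine LipschitzWith.of_dist_le_mul fun q q' => ?_
      rw [Real.dist_eq]
      refine (abs_abs_sub_abs_le_abs_sub _ _).trans ?_
      rw [← inner_sub_left, dist_eq_norm, Real.coe_nnabs, abs_of_pos hC0, mul_comm]
      exact abs_inner_torusVec_le hC _ φ)
    (integrable_const _) (by
      filter_upwards [ae_inner_torusVec_ne_zero hpos hp] with φ hφ
      have h1 : HasFDerivAt (fun q : Phase N => ⟪q, torusVec ω φ⟫_ℝ)
          (innerSL ℝ (torusVec ω φ) : Phase N →L[ℝ] ℝ) p := by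
        have := (innerSL ℝ (torusVec ω φ) : Phase N →L[ℝ] ℝ).hasFDerivAt (x := p)
        refine this.congr_of_eventuallyEq (.of_forall fun q => ?_)
        simp [real_inner_comm]
      exact (hasDerivAt_abs hφ).comp_hasFDerivAt p h1)
  have heq : InnerProductSpace.toDual ℝ (Phase N) (gradH ω p) = ∫ φ, F' φ ∂torusMeasure N := by
    ext q
    rw [ContinuousLinearMap.integral_apply key.1, InnerProductSpace.toDual_apply_apply,
      inner_gradH]
    refine integral_congr_ae (.of_forall fun φ => ?_)
    simp [F', real_inner_comm]
  rw [hfun, heq]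
  exact key.2

/-- Monotonicity of the gradient in integral form. -/
lemma inner_gradH_sub (ω : Fin N → ℝ) (p q w : Phase N) : ⟪gradH ω q - gradH ω p, w⟫_ℝ =
    ∫ φ, (sgn ⟪q, torusVec ω φ⟫_ℝ - sgn ⟪p, torusVec ω φ⟫_ℝ) * ⟪w, torusVec ω φ⟫_ℝ
      ∂torusMeasure N := by
  rw [inner_sub_left, inner_gradH, inner_gradH, ← integral_sub (integrable_sgn_mul ω q w)
    (integrable_sgn_mul ω p w)]
  simp only [sub_mul]

/-! ### Strong monotonicity of the gradient -/

/-- The contribution of the `j`-th oscillator to `⟪p, torusVec ω φ⟫`. -/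
def wave (ω : Fin N → ℝ) (p : Phase N) (j : Fin N) (θ : ℝ) : ℝ :=
  p (1, j) * Real.cos θ + (ω j)⁻¹ * p (0, j) * Real.sin θ

lemma inner_eq_sum_wave (ω : Fin N → ℝ) (p : Phase N) (φ : Fin N → ℝ) :
    ⟪p, torusVec ω φ⟫_ℝ = ∑ j, wave ω p j (φ j) := inner_torusVec ω p φ

lemma inner_update_eq_wave (ω : Fin N → ℝ) (p : Phase N) (φ : Fin N → ℝ) (i : Fin N) (θ : ℝ) :
    ⟪p, torusVec ω (Function.update φ i θ)⟫_ℝ =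
      wave ω p i θ + ∑ j ∈ Finset.univ.erase i, wave ω p j (φ j) :=
  inner_torusVec_update ω p φ i θ

lemma wave_add (ω : Fin N → ℝ) (p : Phase N) (j : Fin N) (θ h : ℝ) :
    wave ω p j (θ + h) =
      wave ω p j θ * Real.cos h + wave ω p j (θ + Real.pi / 2) * Real.sin h := by
  simp only [wave, Real.cos_add, Real.sin_add, Real.cos_pi_div_two, Real.sin_pi_div_two]
  ring

lemma wave_sub_smul (ω : Fin N → ℝ) (r p : Phase N) (c : ℝ) (j : Fin N) (θ : ℝ) :
    wave ω (r - c • p) j θ = wave ω r j θ - c * wave ω p j θ := by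
  simp only [wave, PiLp.sub_apply, PiLp.smul_apply, smul_eq_mul]; ring

/-- The quarter-period shift of a wave is its derivative, so by `wave_add` a wave vanishing together
with its derivative at one angle vanishes identically. -/
lemma eq_zero_of_wave {ω : Fin N → ℝ} (hpos : ∀ i, 0 < ω i) {p : Phase N}
    (h : ∀ j, ∃ θ, wave ω p j θ = 0 ∧ wave ω p j (θ + Real.pi / 2) = 0) : p = 0 := by
  have h' : ∀ j θ, wave ω p j θ = 0 := fun j θ => by
    obtain ⟨θ₀, h1, h2⟩ := h j
    have := wave_add ω p j θ₀ (θ - θ₀)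
    simpa [h1, h2] using this
  refine PiLp.ext fun ⟨k, i⟩ => ?_
  have hi := (hpos i).ne'
  have h0 := h' i 0
  have h1 := h' i (Real.pi / 2)
  simp only [wave, Real.cos_zero, Real.sin_zero, Real.cos_pi_div_two, Real.sin_pi_div_two] at h0 h1
  fin_cases k
  · have : (ω i)⁻¹ * p (0, i) = 0 := by linarith
    simpa [hi] using this
  · simpa using h0

lemma inner_torusVec_add_pi (ω : Fin N → ℝ) (p : Phase N) (φ : Fin N → ℝ) :
    ⟪p, torusVec ω (φ + fun _ => Real.pi)⟫_ℝ = -⟪p, torusVec ω φ⟫_ℝ := by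
  simp only [inner_eq_sum_wave, wave, Pi.add_apply, Real.cos_add_pi, Real.sin_add_pi,
    ← Finset.sum_neg_distrib]
  refine Finset.sum_congr rfl fun j _ => ?_
  ring

/-- If `r` is not a multiple of `p ≠ 0`, then `⟪r, torusVec⟫` is positive at some regular zero of
`⟪p, torusVec⟫`. -/
lemma exists_regular_zero {ω : Fin N → ℝ} (hpos : ∀ i, 0 < ω i) {p r : Phase N} (hp : p ≠ 0)
    (hr : ∀ c : ℝ, r ≠ c • p) : ∃ (i : Fin N) (φ : Fin N → ℝ), ⟪p, torusVec ω φ⟫_ℝ = 0 ∧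
      0 < ⟪r, torusVec ω φ⟫_ℝ ∧ wave ω p i (φ i + Real.pi / 2) ≠ 0 := by
  obtain ⟨i, hi⟩ := exists_amplitude_ne_zero hpos hp
  by_contra! hcon
  choose α hα using amplitude_angle ω p
  have hα' : ∀ j θ, wave ω p j θ = amplitude ω p j * Real.cos (θ + α j) := hα
  have hz : 0 < amplitude ω p i := lt_of_le_of_ne (amplitude_nonneg _ _ _) hi.symm
  set z := amplitude ω p i
  have hzero : ∀ φ, ⟪p, torusVec ω φ⟫_ℝ = 0 → wave ω p i (φ i + Real.pi / 2) ≠ 0 →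
      ⟪r, torusVec ω φ⟫_ℝ = 0 := by
    intro φ h1 h2
    refine le_antisymm (not_lt.1 fun h => h2 (hcon i φ h1 h)) (not_lt.1 fun h => ?_)
    -- The antipodal point `φ + π` changes the sign of both forms, so absence of positive values at
    -- regular zeros also excludes negative ones.
    have h3 := hcon i (φ + fun _ => Real.pi) (by rw [inner_torusVec_add_pi, h1, neg_zero])
      (by rw [inner_torusVec_add_pi]; linarith)
    refine h2 ?_
    rw [Pi.add_apply, hα', show φ i + Real.pi + Real.pi / 2 + α i = φ i + Real.pi / 2 + α i +
      Real.pi by ring, Real.cos_add_pi] at h3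
    rw [hα']
    linarith
  set sp : (Fin N → ℝ) → ℝ := fun φ => ∑ j ∈ Finset.univ.erase i, wave ω p j (φ j)
  set sr : (Fin N → ℝ) → ℝ := fun φ => ∑ j ∈ Finset.univ.erase i, wave ω r j (φ j)
  set a := wave ω r i (-α i)
  set b := wave ω r i (-α i + Real.pi / 2)
  -- If the other oscillators contribute less than `z`, angle `i` can be solved for: there are two
  -- regular zeros `-α i ± β`. Evaluating `r` at both separates its sine part, which must vanish,
  -- from its cosine part, which fixes the factor `a / z`.
  have hkey : ∀ φ, |sp φ| < z → b = 0 ∧ sr φ = a / z * sp φ := by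
    intro φ hφ
    obtain ⟨hl, hu⟩ := abs_lt.1 hφ
    set β := Real.arccos (-sp φ / z)
    have hc : Real.cos β = -sp φ / z :=
      Real.cos_arccos (by rw [le_div_iff₀ hz]; linarith) (by rw [div_le_iff₀ hz]; linarith)
    have hs : 0 < Real.sin β := by
      rw [Real.sin_arccos]
      refine Real.sqrt_pos.2 ?_
      rw [div_pow, sub_pos, div_lt_one (by positivity)]
      nlinarith
    have hpoint : ∀ θ, (θ = β ∨ θ = -β) → a * Real.cos θ + b * Real.sin θ + sr φ = 0 := by
      intro θ hθ
      have hcθ : Real.cos θ = Real.cos β := by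
        rcases hθ with rfl | rfl
        · rfl
        · exact Real.cos_neg _
      have hsθ : Real.sin θ ≠ 0 := by
        rcases hθ with rfl | rfl
        · exact hs.ne'
        · rw [Real.sin_neg]; linarith
      have h := hzero (Function.update φ i (-α i + θ)) ?_ ?_
      · rw [inner_update_eq_wave, wave_add] at h
        exact h
      · rw [inner_update_eq_wave, hα', show -α i + θ + α i = θ by ring, hcθ, hc]
        have : z * (-sp φ / z) = -sp φ := by field_simp
        exact (congrArg (· + sp φ) this).trans (by ring)
      · rw [Function.update_self, hα', show -α i + θ + Real.pi / 2 + α i = θ + Real.pi / 2 by ring,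
          Real.cos_add_pi_div_two]
        exact mul_ne_zero hi (neg_ne_zero.2 hsθ)
    have h1 := hpoint β (Or.inl rfl)
    have h2 := hpoint (-β) (Or.inr rfl)
    rw [Real.cos_neg, Real.sin_neg] at h2
    have hb : b = 0 := by
      have : b * Real.sin β = 0 := by linarith
      exact (mul_eq_zero.1 this).resolve_right hs.ne'
    refine ⟨hb, ?_⟩
    rw [hb, hc] at h1
    field_simp at h1 ⊢
    linarith
  -- At `ψ` every oscillator of `p` contributes zero, so `hkey` applies at `ψ` and nearby. It is
  -- used to show `r = (a / z) • p` oscillator by oscillator.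
  set ψ : Fin N → ℝ := fun j => -α j + Real.pi / 2
  have hψ : ∀ j, wave ω p j (ψ j) = 0 := fun j => by
    rw [hα', show ψ j + α j = Real.pi / 2 by simp [ψ], Real.cos_pi_div_two, mul_zero]
  refine hr (a / z) (sub_eq_zero.1 (eq_zero_of_wave hpos fun j => ?_))
  by_cases hj : j = i
  · subst hj
    refine ⟨-α j, ?_, ?_⟩
    · rw [wave_sub_smul, hα', neg_add_cancel, Real.cos_zero, mul_one]
      exact sub_eq_zero.2 (div_mul_cancel₀ a hi).symm
    · have hsp : sp ψ = 0 := Finset.sum_eq_zero fun j _ => hψ j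
      rw [wave_sub_smul, hα', show -α j + Real.pi / 2 + α j = Real.pi / 2 by ring,
        Real.cos_pi_div_two]
      have := (hkey ψ (by rw [hsp, abs_zero]; exact hz)).1
      linarith
  · refine ⟨ψ j, ?_⟩
    have hjm : j ∈ Finset.univ.erase i := Finset.mem_erase.2 ⟨hj, Finset.mem_univ j⟩
    have hsum : ∀ (q : Phase N) t, ∑ l ∈ Finset.univ.erase i, wave ω q l
        (Function.update ψ j t l) = wave ω q j t +
          ∑ l ∈ (Finset.univ.erase i).erase j, wave ω q l (ψ l) := by
      intro q t
      rw [← Finset.add_sum_erase _ _ hjm, Function.update_self]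
      congr 1
      refine Finset.sum_congr rfl fun l hl => ?_
      rw [Function.update_of_ne (Finset.ne_of_mem_erase hl)]
    set zj := amplitude ω p j
    have hzj : 0 ≤ zj := amplitude_nonneg _ _ _
    -- Turning angle `j` alone by at most `h` keeps `|sp| < z`. There the wave of `r - (a / z) • p`
    -- is constant, and comparing the shifts `h` and `-h` makes it vanish with its derivative.
    set h := min 1 (z / (2 * (zj + 1)))
    have h0 : 0 < h := lt_min one_pos (by positivity)
    have hz' : zj * h < z := by
      have h1 : h ≤ z / (2 * (zj + 1)) := min_le_right _ _
      have h2 : zj * h ≤ zj * (z / (2 * (zj + 1))) := by gcongr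
      have h3 : zj * (z / (2 * (zj + 1))) < z := by
        rw [mul_div_assoc', div_lt_iff₀ (by positivity)]; nlinarith
      linarith
    have hspt : ∀ t, sp (Function.update ψ j (ψ j + t)) = zj * -Real.sin t := by
      intro t
      change ∑ l ∈ Finset.univ.erase i, wave ω p l _ = _
      rw [hsum, Finset.sum_eq_zero fun l _ => hψ l, add_zero, hα',
        show ψ j + t + α j = t + Real.pi / 2 by simp only [ψ]; ring, Real.cos_add_pi_div_two]
    have hconst : ∀ t, |t| ≤ h → wave ω (r - (a / z) • p) j (ψ j + t) =
        wave ω (r - (a / z) • p) j (ψ j) := by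
      have : ∀ t, |t| ≤ h → wave ω (r - (a / z) • p) j (ψ j + t) =
          -∑ l ∈ (Finset.univ.erase i).erase j, wave ω r l (ψ l) := by
        intro t ht
        have hlt : |sp (Function.update ψ j (ψ j + t))| < z := by
          rw [hspt, abs_mul, abs_neg, abs_of_nonneg hzj]
          refine lt_of_le_of_lt ?_ hz'
          gcongr
          exact Real.abs_sin_le_abs.trans ht
        have h1 := (hkey _ hlt).2
        have h2 : sr (Function.update ψ j (ψ j + t)) = _ := hsum r (ψ j + t)
        have h3 : sp (Function.update ψ j (ψ j + t)) = _ := hsum p (ψ j + t)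
        rw [Finset.sum_eq_zero fun l _ => hψ l, add_zero] at h3
        rw [h2, h3] at h1
        rw [wave_sub_smul]
        linarith
      intro t ht
      have h1 := this 0 (by simpa using h0.le)
      rw [add_zero] at h1
      rw [this t ht, h1]
    have e1 := hconst h (abs_of_pos h0).le
    have e2 := hconst (-h) (by rw [abs_neg]; exact (abs_of_pos h0).le)
    rw [wave_add] at e1 e2
    rw [Real.cos_neg, Real.sin_neg] at e2
    have hh1 : h ≤ 1 := min_le_left _ _
    have hpi := Real.pi_gt_three
    have hsin : 0 < Real.sin h := Real.sin_pos_of_pos_of_lt_pi h0 (by linarith)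
    have hcos : Real.cos h < 1 := by
      have := Real.cos_lt_cos_of_nonneg_of_le_pi le_rfl (by linarith : h ≤ Real.pi) h0
      rwa [Real.cos_zero] at this
    constructor
    · have : wave ω (r - (a / z) • p) j (ψ j) * (1 - Real.cos h) = 0 := by linarith
      exact (mul_eq_zero.1 this).resolve_right (by linarith)
    · have : wave ω (r - (a / z) • p) j (ψ j + Real.pi / 2) * Real.sin h = 0 := by linarith
      exact (mul_eq_zero.1 this).resolve_right hsin.ne'

lemma abs_apply_le_norm (p : Phase N) (k : Fin 2 × Fin N) : |p k| ≤ ‖p‖ := by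
  simpa using PiLp.norm_apply_le p k

lemma lipschitzWith_wave (ω : Fin N → ℝ) (p : Phase N) (i : Fin N) {K : NNReal}
    (hK : ‖p‖ * (1 + |(ω i)⁻¹|) ≤ K) : LipschitzWith K (wave ω p i) := by
  refine lipschitzWith_of_nnnorm_deriv_le (fun θ => ?_) fun θ => ?_
  · unfold wave; fun_prop
  · have : HasDerivAt (wave ω p i)
        (p (1, i) * -Real.sin θ + (ω i)⁻¹ * p (0, i) * Real.cos θ) θ :=
      ((Real.hasDerivAt_cos θ).const_mul _).add ((Real.hasDerivAt_sin θ).const_mul _)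
    rw [this.deriv, ← NNReal.coe_le_coe, coe_nnnorm, Real.norm_eq_abs]
    refine le_trans ?_ hK
    have h1 := abs_apply_le_norm p (1, i)
    have h2 := abs_apply_le_norm p (0, i)
    calc _ ≤ |p (1, i) * -Real.sin θ| + |(ω i)⁻¹ * p (0, i) * Real.cos θ| := abs_add_le _ _
      _ = |p (1, i)| * |Real.sin θ| + |(ω i)⁻¹| * |p (0, i)| * |Real.cos θ| := by
        simp only [abs_mul, abs_neg]
      _ ≤ ‖p‖ * 1 + |(ω i)⁻¹| * ‖p‖ * 1 := by
        gcongr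
        · exact Real.abs_sin_le_one θ
        · exact Real.abs_cos_le_one θ
      _ = _ := by ring

/-- A `K`-Lipschitz function crossing the level interval `(-η, 0)` spends time at least `η / K`
there. -/
lemma le_volume_of_crossing {g : ℝ → ℝ} {K : NNReal} (hg : LipschitzWith K g) {I : Set ℝ}
    (hI : I.OrdConnected) {s e η : ℝ} (hs : s ∈ I) (he : e ∈ I) (hgs : g s ≤ -η)
    (hge : 0 ≤ g e) : ENNReal.ofReal η ≤ K * volume (I ∩ g ⁻¹' Set.Ioo (-η) 0) := by
  have h1 : Set.Ioo (-η) 0 ⊆ g '' (I ∩ g ⁻¹' Set.Ioo (-η) 0) := by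
    intro y hy
    have hmem : y ∈ Set.uIcc (g s) (g e) :=
      Set.mem_uIcc.2 (Or.inl ⟨hgs.trans hy.1.le, hy.2.le.trans hge⟩)
    obtain ⟨θ, hθ, rfl⟩ := intermediate_value_uIcc hg.continuous.continuousOn hmem
    exact ⟨θ, ⟨hI.uIcc_subset hs he hθ, hy⟩, rfl⟩
  have h2 := hg.hausdorffMeasure_image_le zero_le_one (I ∩ g ⁻¹' Set.Ioo (-η) 0)
  rw [MeasureTheory.hausdorffMeasure_real, ENNReal.rpow_one] at h2
  calc ENNReal.ofReal η = volume (Set.Ioo (-η) 0) := by simp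
    _ ≤ _ := (measure_mono h1).trans h2

lemma sgn_add_sub_mul_nonneg (a w δ : ℝ) (hδ : 0 ≤ δ) : 0 ≤ (sgn (a + δ * w) - sgn a) * w := by
  rcases le_total 0 w with hw | hw
  · exact mul_nonneg (sub_nonneg.2 (monotone_sgn (by nlinarith))) hw
  · exact mul_nonneg_of_nonpos_of_nonpos (sub_nonpos.2 (monotone_sgn (by nlinarith))) hw

lemma angleMeasure_apply {s : Set ℝ} (hs : s ⊆ Set.Ioc 0 (2 * Real.pi)) (hm : MeasurableSet s) :
    angleMeasure s = (ENNReal.ofReal (2 * Real.pi))⁻¹ * volume s := by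
  rw [angleMeasure, Measure.smul_apply, Measure.restrict_apply hm, Set.inter_eq_left.2 hs,
    smul_eq_mul]

lemma update_add_shift (φ α : Fin N → ℝ) (i : Fin N) (θ : ℝ) :
    Function.update φ i θ + α = Function.update (φ + α) i (θ + α i) := by
  ext j
  by_cases h : j = i
  · subst h; simp
  · simp [h]

/-- The gradient of the support function is strongly monotone in directions transversal to the
radial one, locally uniformly. -/
lemma local_strong_monotone {ω : Fin N → ℝ} (hpos : ∀ i, 0 < ω i) {p₀ r₀ : Phase N} (hp : p₀ ≠ 0)
    (hr : ∀ c : ℝ, r₀ ≠ c • p₀) : ∃ ε > 0, ∃ c > 0, ∀ (p r : Phase N) (δ : ℝ),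
      dist p p₀ < ε → dist r r₀ < ε → 0 < δ → δ < ε →
        c * δ ≤ ⟪gradH ω (p + δ • r) - gradH ω p, r⟫_ℝ := by
  obtain ⟨i, φ₀, ha, hw, hd⟩ := exists_regular_zero hpos hp hr
  set ℓ := ⟪r₀, torusVec ω φ₀⟫_ℝ / 2 with hℓ
  have hℓ0 : 0 < ℓ := by positivity
  obtain ⟨ε₁, hε₁, H1⟩ : ∃ ε₁ > 0, ∀ (r : Phase N) (φ : Fin N → ℝ), dist r r₀ < ε₁ →
      dist φ φ₀ < ε₁ → ℓ < ⟪r, torusVec ω φ⟫_ℝ := by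
    have hc := (continuous_inner_torusVec ω).continuousAt (x := (r₀, φ₀))
    obtain ⟨ε, hε, h⟩ := Metric.eventually_nhds_iff.1
      (hc.eventually (lt_mem_nhds (show ℓ < ⟪r₀, torusVec ω φ₀⟫_ℝ by linarith)))
    exact ⟨ε, hε, fun r φ h1 h2 => h (y := (r, φ)) (max_lt h1 h2)⟩
  set ε₂ := min ε₁ 1
  have hε₂ : 0 < ε₂ := lt_min hε₁ one_pos
  have hwc : ∀ θ, ⟪p₀, torusVec ω (Function.update φ₀ i θ)⟫_ℝ =
      wave ω p₀ i θ + ∑ j ∈ Finset.univ.erase i, wave ω p₀ j (φ₀ j) :=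
    inner_update_eq_wave ω p₀ φ₀ i
  set f : ℝ → ℝ := fun θ => ⟪p₀, torusVec ω (Function.update φ₀ i θ)⟫_ℝ
  have hf0 : f (φ₀ i) = 0 := by simp only [f, Function.update_eq_self, ha]
  have hfd : HasDerivAt f (wave ω p₀ i (φ₀ i + Real.pi / 2)) (φ₀ i) := by
    have h1 : HasDerivAt (wave ω p₀ i) (wave ω p₀ i (φ₀ i + Real.pi / 2)) (φ₀ i) := by
      have h := ((Real.hasDerivAt_cos (φ₀ i)).const_mul (p₀ (1, i))).add
        ((Real.hasDerivAt_sin (φ₀ i)).const_mul ((ω i)⁻¹ * p₀ (0, i)))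
      have hv : wave ω p₀ i (φ₀ i + Real.pi / 2) = p₀ (1, i) * -Real.sin (φ₀ i) +
          (ω i)⁻¹ * p₀ (0, i) * Real.cos (φ₀ i) := by
        simp only [wave, Real.cos_add_pi_div_two, Real.sin_add_pi_div_two]
      rw [hv]
      exact h
    rw [show f = fun θ => wave ω p₀ i θ + ∑ j ∈ Finset.univ.erase i, wave ω p₀ j (φ₀ j)
      from funext hwc]
    exact h1.add_const _
  have hnear : ∀ᶠ θ in nhds (φ₀ i), |θ - φ₀ i| < ε₂ := by
    filter_upwards [Metric.ball_mem_nhds (φ₀ i) hε₂] with θ hθ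
    rwa [Metric.mem_ball, Real.dist_eq] at hθ
  -- The derivative of `f` at its zero is nonzero, so the zero is no local extremum and `f` takes
  -- both signs arbitrarily close to it.
  obtain ⟨e, he, hfe⟩ : ∃ e, |e - φ₀ i| < ε₂ ∧ 0 < f e := by
    by_contra! h
    refine hd (IsLocalMax.hasDerivAt_eq_zero (f := f) (a := φ₀ i) ?_ hfd)
    filter_upwards [hnear] with θ hθ
    rw [hf0]; exact h θ hθ
  obtain ⟨s, hs, hfs⟩ : ∃ s, |s - φ₀ i| < ε₂ ∧ f s < 0 := by
    by_contra! h
    refine hd (IsLocalMin.hasDerivAt_eq_zero (f := f) (a := φ₀ i) ?_ hfd)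
    filter_upwards [hnear] with θ hθ
    rw [hf0]; exact h θ hθ
  have hcu : ∀ θ, Continuous fun x : Phase N × (Fin N → ℝ) =>
      ⟪x.1, torusVec ω (Function.update x.2 i θ)⟫_ℝ := fun θ =>
    continuous_fst.inner ((continuous_torusVec ω).comp (continuous_snd.update i continuous_const))
  obtain ⟨ε₃, hε₃, H3⟩ : ∃ ε > 0, ∀ (p : Phase N) (φ : Fin N → ℝ), dist p p₀ < ε →
      dist φ φ₀ < ε → 0 < ⟪p, torusVec ω (Function.update φ i e)⟫_ℝ := by
    obtain ⟨ε, hε, h⟩ := Metric.eventually_nhds_iff.1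
      ((hcu e).continuousAt (x := (p₀, φ₀)) |>.eventually (lt_mem_nhds hfe))
    exact ⟨ε, hε, fun r φ h1 h2 => h (y := (r, φ)) (max_lt h1 h2)⟩
  obtain ⟨ε₄, hε₄, H4⟩ : ∃ ε > 0, ∀ (p : Phase N) (φ : Fin N → ℝ), dist p p₀ < ε →
      dist φ φ₀ < ε → ⟪p, torusVec ω (Function.update φ i s)⟫_ℝ < f s / 2 := by
    obtain ⟨ε, hε, h⟩ := Metric.eventually_nhds_iff.1
      ((hcu s).continuousAt (x := (p₀, φ₀)) |>.eventually
        (gt_mem_nhds (show f s < f s / 2 by linarith)))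
    exact ⟨ε, hε, fun r φ h1 h2 => h (y := (r, φ)) (max_lt h1 h2)⟩
  -- The last bound gives `f s / 2 ≤ -(δ * ℓ)` for `δ < ε`, so passing from the angle `s` to `e`
  -- crosses the whole level interval `(-δℓ, 0)`.
  set ε := min (min ε₂ ε₃) (min ε₄ (-f s / (2 * ℓ)))
  have hεpos : 0 < ε := lt_min (lt_min hε₂ hε₃) (lt_min hε₄ (div_pos (by linarith) (by linarith)))
  have hεε₂ : ε ≤ ε₂ := (min_le_left _ _).trans (min_le_left _ _)
  have hεε₃ : ε ≤ ε₃ := (min_le_left _ _).trans (min_le_right _ _)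
  have hεε₄ : ε ≤ ε₄ := (min_le_right _ _).trans (min_le_left _ _)
  have hεm : ε ≤ -f s / (2 * ℓ) := (min_le_right _ _).trans (min_le_right _ _)
  have hε₂1 : ε₂ ≤ 1 := min_le_right _ _
  have hε₂ε₁ : ε₂ ≤ ε₁ := min_le_left _ _
  have hpi := Real.pi_gt_three
  obtain ⟨K, hK⟩ : ∃ K : NNReal, (K : ℝ) = (‖p₀‖ + 1) * (1 + |(ω i)⁻¹|) :=
    ⟨_, Real.coe_toNNReal _ (by positivity)⟩
  have hK0 : 0 < (K : ℝ) := by rw [hK]; positivity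
  -- The shift `α` moves `φ₀` to the point `(π, …, π)`, so that the neighbourhoods used lie inside
  -- the fundamental domain `(0, 2π]` of `angleMeasure`.
  set V : Set (Fin N → ℝ) := Set.pi Set.univ fun _ => Set.Ioo (Real.pi - ε) (Real.pi + ε)
  have hVm : MeasurableSet V := MeasurableSet.univ_pi fun _ => measurableSet_Ioo
  have hV0 : 0 < (torusMeasure N).real V := by
    refine ENNReal.toReal_pos ?_ (measure_ne_top _ _)
    rw [torusMeasure, Measure.pi_pi]
    refine Finset.prod_ne_zero_iff.2 fun j _ => ?_
    rw [angleMeasure_apply (fun x hx => ⟨by linarith [hx.1], by linarith [hx.2]⟩)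
      measurableSet_Ioo]
    refine mul_ne_zero (ENNReal.inv_ne_zero.2 ENNReal.ofReal_ne_top) ?_
    rw [Real.volume_Ioo]
    simp only [ne_eq, ENNReal.ofReal_eq_zero, not_le]
    linarith
  refine ⟨ε, hεpos, 2 * ℓ * ((2 * Real.pi)⁻¹ * (ℓ / K) * (torusMeasure N).real V), by positivity,
    fun p r δ hpp hrr hδ hδε => ?_⟩
  set α : Fin N → ℝ := fun j => φ₀ j - Real.pi
  set k : Phase N → ℝ := fun v => (sgn ⟪p + δ • r, v⟫_ℝ - sgn ⟪p, v⟫_ℝ) * ⟪r, v⟫_ℝ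
  have hkm : Measurable k := by
    have h : ∀ q : Phase N, Measurable fun v : Phase N => ⟪q, v⟫_ℝ := fun q =>
      (continuous_const.inner continuous_id).measurable
    exact ((measurable_sgn.comp (h _)).sub (measurable_sgn.comp (h _))).mul (h _)
  have hk0 : ∀ v, 0 ≤ k v := fun v => by
    simp only [k, inner_add_left, inner_smul_left, conj_trivial]
    exact sgn_add_sub_mul_nonneg _ _ _ hδ.le
  have hpres := measurePreserving_update (N := N) i
  have hcont : Continuous fun x : (Fin N → ℝ) × ℝ =>
      torusVec ω (Function.update x.1 i x.2 + α) :=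
    (continuous_torusVec ω).comp ((continuous_fst.update i continuous_snd).add continuous_const)
  have hE : ⟪gradH ω (p + δ • r) - gradH ω p, r⟫_ℝ =
      ∫ x : (Fin N → ℝ) × ℝ, k (torusVec ω (Function.update x.1 i x.2 + α))
        ∂(torusMeasure N).prod angleMeasure := by
    rw [inner_gradH_sub]
    change ∫ φ, k (torusVec ω φ) ∂torusMeasure N = _
    rw [integral_torusVec_add ω hkm.stronglyMeasurable α]
    conv_lhs => rw [← hpres.map_eq]
    rw [integral_map (f := fun φ => k (torusVec ω (φ + α))) hpres.measurable.aemeasurable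
      (hkm.comp ((continuous_torusVec ω).comp
        (continuous_id.add continuous_const)).measurable).aestronglyMeasurable]
  obtain ⟨C, hC0, hC⟩ := exists_norm_torusVec_le ω
  have hintegr : Integrable (fun x : (Fin N → ℝ) × ℝ =>
      k (torusVec ω (Function.update x.1 i x.2 + α))) ((torusMeasure N).prod angleMeasure) := by
    refine Integrable.of_bound (C := 2 * (‖r‖ * C))
      (hkm.comp hcont.measurable).aestronglyMeasurable (.of_forall fun x => ?_)
    simp only [k, Real.norm_eq_abs, abs_mul]
    gcongr
    · refine (abs_sub _ _).trans ?_
      linarith [abs_sgn_le ⟪p + δ • r, torusVec ω (Function.update x.1 i x.2 + α)⟫_ℝ,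
        abs_sgn_le ⟪p, torusVec ω (Function.update x.1 i x.2 + α)⟫_ℝ]
    · exact abs_inner_torusVec_le hC _ _
  set I : Set ℝ := Set.Ioo (Real.pi - ε₂) (Real.pi + ε₂)
  set g : (Fin N → ℝ) × ℝ → ℝ := fun x => ⟪p, torusVec ω (Function.update x.1 i x.2 + α)⟫_ℝ
  have hgc : Continuous g := continuous_const.inner hcont
  -- On `S` the form of `p` lies in `(-δℓ, 0)` and that of `r` exceeds `ℓ`. Adding `δ • r` flips the
  -- sign from `-1` to `1`, and the nonnegative integrand is at least `2ℓ`.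
  set S : Set ((Fin N → ℝ) × ℝ) := (V ×ˢ I) ∩ g ⁻¹' Set.Ioo (-(δ * ℓ)) 0
  have hSm : MeasurableSet S :=
    (hVm.prod measurableSet_Ioo).inter (hgc.measurable measurableSet_Ioo)
  have hV : ∀ φ ∈ V, dist (φ + α) φ₀ < ε := fun φ hφ => by
    refine (dist_pi_lt_iff hεpos).2 fun j => ?_
    have := hφ j (Set.mem_univ j)
    rw [Real.dist_eq, abs_lt]
    simp only [α, Pi.add_apply]
    constructor <;> linarith [this.1, this.2]
  have hkS : ∀ x ∈ S, 2 * ℓ ≤ k (torusVec ω (Function.update x.1 i x.2 + α)) := by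
    rintro ⟨φ, θ⟩ ⟨⟨hφ, hθ⟩, hg1, hg2⟩
    have hdist : dist (Function.update φ i θ + α) φ₀ < ε₁ := by
      rw [update_add_shift]
      refine (dist_pi_lt_iff hε₁).2 fun j => ?_
      by_cases hj : j = i
      · subst hj
        rw [Function.update_self, Real.dist_eq, abs_lt]
        simp only [α]
        constructor <;> linarith [hθ.1, hθ.2]
      · rw [Function.update_of_ne hj]
        exact (dist_le_pi_dist _ _ j).trans_lt ((hV φ hφ).trans_le (hεε₂.trans hε₂ε₁))
    have hw1 := H1 r _ (hrr.trans_le (hεε₂.trans hε₂ε₁)) hdist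
    simp only [g] at hg1 hg2
    simp only [k, inner_add_left, inner_smul_left, conj_trivial]
    rw [sgn_of_neg hg2, sgn_of_pos (by nlinarith)]
    linarith
  have hνS : ∀ φ ∈ V, ENNReal.ofReal ((2 * Real.pi)⁻¹ * (ℓ / K) * δ) ≤
      angleMeasure (Prod.mk φ ⁻¹' S) := by
    intro φ hφ
    have hpre : Prod.mk φ ⁻¹' S = I ∩ (fun θ => g (φ, θ)) ⁻¹' Set.Ioo (-(δ * ℓ)) 0 := by
      ext θ; simp [S, hφ]
    have hgw : ∀ θ, g (φ, θ) = wave ω p i (θ + α i) +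
        ∑ j ∈ Finset.univ.erase i, wave ω p j ((φ + α) j) := fun θ => by
      simp only [g, update_add_shift, inner_update_eq_wave]
    have hlip : LipschitzWith K fun θ => g (φ, θ) := by
      have hw : LipschitzWith K (wave ω p i) := by
        refine lipschitzWith_wave ω p i ?_
        rw [hK]
        gcongr
        have := norm_le_norm_add_norm_sub' p p₀
        rw [dist_eq_norm] at hpp
        linarith
      refine LipschitzWith.of_dist_le_mul fun θ θ' => ?_
      rw [hgw, hgw, dist_add_right]
      simpa using hw.dist_le_mul (θ + α i) (θ' + α i)
    have hmem : ∀ t, |t - φ₀ i| < ε₂ → t - α i ∈ I := fun t ht => by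
      obtain ⟨h1, h2⟩ := abs_lt.1 ht
      simp only [α, I, Set.mem_Ioo]
      constructor <;> linarith
    have hgt : ∀ t, g (φ, t - α i) = ⟪p, torusVec ω (Function.update (φ + α) i t)⟫_ℝ := fun t => by
      simp only [g, update_add_shift, sub_add_cancel]
    have hcross := le_volume_of_crossing hlip (I := I) Set.ordConnected_Ioo (hmem s hs) (hmem e he)
      (η := δ * ℓ) (by
        rw [hgt]
        have h1 := H4 p (φ + α) (hpp.trans_le hεε₄) ((hV φ hφ).trans_le hεε₄)
        have h2 : δ * (2 * ℓ) ≤ -f s := by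
          rw [← le_div_iff₀ (by positivity)]; linarith
        linarith) (by
        rw [hgt]
        exact (H3 p (φ + α) (hpp.trans_le hεε₃) ((hV φ hφ).trans_le hεε₃)).le)
    rw [hpre, angleMeasure_apply (fun x hx => ⟨by linarith [hx.1.1], by linarith [hx.1.2]⟩)
      (measurableSet_Ioo.inter (hlip.continuous.measurable measurableSet_Ioo))]
    set vol := volume (I ∩ (fun θ => g (φ, θ)) ⁻¹' Set.Ioo (-(δ * ℓ)) 0)
    have hvol : ENNReal.ofReal (ℓ / K * δ) ≤ vol := by
      rw [show ℓ / K * δ = δ * ℓ / K by ring, ENNReal.ofReal_div_of_pos hK0,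
        ENNReal.ofReal_coe_nnreal]
      exact ENNReal.div_le_of_le_mul' hcross
    rw [mul_assoc, ENNReal.ofReal_mul (by positivity), ENNReal.ofReal_inv_of_pos Real.two_pi_pos]
    gcongr
  have hPS : (2 * Real.pi)⁻¹ * (ℓ / K) * δ * (torusMeasure N).real V ≤
      ((torusMeasure N).prod angleMeasure).real S := by
    have h : ENNReal.ofReal ((2 * Real.pi)⁻¹ * (ℓ / K) * δ) * torusMeasure N V ≤
        ((torusMeasure N).prod angleMeasure) S := by
      rw [Measure.prod_apply hSm, ← setLIntegral_const]
      exact (setLIntegral_mono' hVm hνS).trans (setLIntegral_le_lintegral _ _)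
    have h' := ENNReal.toReal_mono (measure_ne_top _ _) h
    rwa [ENNReal.toReal_mul, ENNReal.toReal_ofReal (by positivity)] at h'
  rw [hE]
  calc _ = 2 * ℓ * ((2 * Real.pi)⁻¹ * (ℓ / K) * δ * (torusMeasure N).real V) := by ring
    _ ≤ 2 * ℓ * ((torusMeasure N).prod angleMeasure).real S := by gcongr
    _ = ∫ x, S.indicator (fun _ => 2 * ℓ) x ∂(torusMeasure N).prod angleMeasure := by
      rw [integral_indicator_const _ hSm, smul_eq_mul, mul_comm]
    _ ≤ _ := by
      refine integral_mono ((integrable_const _).indicator hSm) hintegr fun x => ?_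
      by_cases hx : x ∈ S
      · rw [Set.indicator_of_mem hx]; exact hkS x hx
      · rw [Set.indicator_of_notMem hx]; exact hk0 _

lemma exists_mul_norm_le_suppH {ω : Fin N → ℝ} (hpos : ∀ i, 0 < ω i) :
    ∃ m > 0, ∀ p : Phase N, m * ‖p‖ ≤ suppH ω p := by
  by_cases hne : (Metric.sphere (0 : Phase N) 1).Nonempty
  · obtain ⟨q, hq, hmin⟩ := (isCompact_sphere (0 : Phase N) 1).exists_isMinOn hne
      (continuous_suppH ω).continuousOn
    have hq0 : q ≠ 0 := by rintro rfl; simp at hq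
    refine ⟨suppH ω q, suppH_pos hpos hq0, fun p => ?_⟩
    by_cases hp : p = 0
    · simp [hp, suppH_zero]
    · have hn : 0 < ‖p‖ := norm_pos_iff.2 hp
      have h : suppH ω q ≤ suppH ω (‖p‖⁻¹ • p) :=
        hmin (a := ‖p‖⁻¹ • p) (by simp [norm_smul, hn.ne'])
      rw [suppH_smul, abs_of_pos (by positivity), ← div_eq_inv_mul, le_div_iff₀ hn] at h
      exact h
  -- The unit sphere is empty only if the phase space is trivial.
  · refine ⟨1, one_pos, fun p => ?_⟩
    have hp : p = 0 := by
      by_contra hp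
      have hn : 0 < ‖p‖ := norm_pos_iff.2 hp
      exact hne ⟨‖p‖⁻¹ • p, by simp [norm_smul, hn.ne']⟩
    simp [hp, suppH_zero]

lemma isCompact_suppH_eq_one {ω : Fin N → ℝ} (hpos : ∀ i, 0 < ω i) :
    IsCompact {p : Phase N | suppH ω p = 1} := by
  obtain ⟨m, hm, h⟩ := exists_mul_norm_le_suppH hpos
  refine Metric.isCompact_of_isClosed_isBounded
    (isClosed_eq (continuous_suppH ω) continuous_const)
    ((Metric.isBounded_closedBall (x := (0 : Phase N)) (r := m⁻¹)).subset fun p hp => ?_)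
  have h1 : m * ‖p‖ ≤ 1 := (h p).trans_eq hp
  rw [mem_closedBall_zero_iff, ← one_div, le_div_iff₀ hm]
  linarith

lemma ne_zero_of_suppH_eq_one {ω : Fin N → ℝ} {p : Phase N} (h : suppH ω p = 1) : p ≠ 0 := by
  rintro rfl; simp [suppH_zero] at h

/-- Convexity along a line. It carries a lower bound obtained for a short step over to a longer step
in the same direction. -/
lemma gradH_monotone (ω : Fin N → ℝ) (p r : Phase N) {s t : ℝ} (hst : s ≤ t) :
    ⟪gradH ω (p + s • r) - gradH ω p, r⟫_ℝ ≤ ⟪gradH ω (p + t • r) - gradH ω p, r⟫_ℝ := by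
  have h : 0 ≤ ⟪gradH ω (p + t • r) - gradH ω (p + s • r), r⟫_ℝ := by
    rw [inner_gradH_sub]
    refine integral_nonneg fun φ => ?_
    simp only [inner_add_left, inner_smul_left, conj_trivial]
    have := sgn_add_sub_mul_nonneg
      (⟪p, torusVec ω φ⟫_ℝ + s * ⟪r, torusVec ω φ⟫_ℝ) ⟪r, torusVec ω φ⟫_ℝ (t - s) (by linarith)
    rwa [show ⟪p, torusVec ω φ⟫_ℝ + s * ⟪r, torusVec ω φ⟫_ℝ + (t - s) * ⟪r, torusVec ω φ⟫_ℝ =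
      ⟪p, torusVec ω φ⟫_ℝ + t * ⟪r, torusVec ω φ⟫_ℝ by ring] at this
  simp only [inner_sub_left] at h ⊢
  linarith

lemma suppH_neg (ω : Fin N → ℝ) (p : Phase N) : suppH ω (-p) = suppH ω p := by
  simpa using suppH_smul ω (-1) p

/-- The gradient of the support function is strongly monotone on its unit sphere. -/
lemma strong_monotone {ω : Fin N → ℝ} (hpos : ∀ i, 0 < ω i) : ∃ c > 0, ∀ p q : Phase N,
    suppH ω p = 1 → suppH ω q = 1 → c * ‖q - p‖ ^ 2 ≤ ⟪gradH ω q - gradH ω p, q - p⟫_ℝ := by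
  by_contra! hcon
  choose p q hp hq hlt using fun n : ℕ => hcon (1 / ((n : ℝ) + 1)) (by positivity)
  have hne : ∀ n, 0 < ‖q n - p n‖ := fun n => by
    rw [norm_pos_iff]
    intro h
    have := hlt n
    simp [h] at this
  set δ : ℕ → ℝ := fun n => ‖q n - p n‖
  set r : ℕ → Phase N := fun n => (δ n)⁻¹ • (q n - p n)
  have hqr : ∀ n, q n = p n + δ n • r n := fun n => by
    simp only [r]
    rw [smul_smul, mul_inv_cancel₀ (hne n).ne', one_smul, add_sub_cancel]
  have hr1 : ∀ n, ‖r n‖ = 1 := fun n => by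
    simp only [r, norm_smul, norm_inv, Real.norm_eq_abs, abs_of_pos (hne n), δ]
    exact inv_mul_cancel₀ (hne n).ne'
  clear_value r
  have hK := isCompact_suppH_eq_one hpos
  obtain ⟨⟨p', q', r'⟩, ⟨hp', hq', hr'⟩, ψ, hψ, hlim⟩ :=
    ((hK.prod (hK.prod (isCompact_sphere (0 : Phase N) 1)))).tendsto_subseq
      (x := fun n => (p n, q n, r n)) fun n => ⟨hp n, hq n, by simpa using hr1 n⟩
  have hlp : Tendsto (fun n => p (ψ n)) atTop (𝓝 p') := (continuous_fst.tendsto _).comp hlim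
  have hlq : Tendsto (fun n => q (ψ n)) atTop (𝓝 q') :=
    ((continuous_fst.comp continuous_snd).tendsto _).comp hlim
  have hlr : Tendsto (fun n => r (ψ n)) atTop (𝓝 r') :=
    ((continuous_snd.comp continuous_snd).tendsto _).comp hlim
  have hlδ : Tendsto (fun n => δ (ψ n)) atTop (𝓝 ‖q' - p'‖) := (hlq.sub hlp).norm
  have hinv : Tendsto (fun n => 1 / (((ψ n : ℕ) : ℝ) + 1)) atTop (𝓝 0) :=
    tendsto_one_div_add_atTop_nhds_zero_nat.comp hψ.tendsto_atTop
  simp only [Set.mem_ofPred_eq] at hp' hq'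
  have hp'0 := ne_zero_of_suppH_eq_one hp'
  -- The limit direction `r'` may be radial, where `local_strong_monotone` says nothing. In that
  -- case the contradiction comes from both points lying on the sphere `H = 1`: the limits satisfy
  -- `q' = p'` or `q' = -p'`.
  by_cases hpar : ∃ c : ℝ, r' = c • p'
  · obtain ⟨lam, hlam⟩ := hpar
    have hlam0 : lam ≠ 0 := by
      rintro rfl
      rw [zero_smul] at hlam
      simp [hlam] at hr'
    have hrel : q' = (1 + ‖q' - p'‖ * lam) • p' := by
      have h1 : Tendsto (fun n => p (ψ n) + δ (ψ n) • r (ψ n)) atTop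
          (𝓝 (p' + ‖q' - p'‖ • r')) := hlp.add (hlδ.smul hlr)
      have h2 := tendsto_nhds_unique hlq (h1.congr fun n => (hqr (ψ n)).symm)
      rw [hlam] at h2
      rw [add_smul, one_smul, mul_smul]
      exact h2
    have habs : |1 + ‖q' - p'‖ * lam| = 1 := by
      have h := hq'
      rw [hrel, suppH_smul, hp', mul_one] at h
      exact h
    have hH0 : Tendsto (fun n => suppH ω (r (ψ n) - lam • p (ψ n))) atTop (𝓝 0) := by
      have h := ((continuous_suppH ω).tendsto (r' - lam • p')).comp
        (hlr.sub (hlp.const_smul lam))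
      rwa [hlam, sub_self, suppH_zero] at h
    have hGp : ∀ n, ⟪gradH ω (p n), r n⟫_ℝ ≤ 0 := fun n => by
      have h := inner_gradH_le ω (p n) (q n)
      rw [hqr n, inner_add_right, inner_smul_right, inner_gradH_self, ← hqr n, hp, hq] at h
      have : δ n * ⟪gradH ω (p n), r n⟫_ℝ ≤ 0 := by linarith
      by_contra! h'
      linarith [mul_pos (hne n) h']
    have hGq : ∀ n, 0 ≤ ⟪gradH ω (q n), r n⟫_ℝ := fun n => by
      have h := inner_gradH_le ω (q n) (p n)
      rw [show p n = q n - δ n • r n by rw [hqr n]; abel, inner_sub_right, inner_smul_right,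
        inner_gradH_self, show q n - δ n • r n = p n by rw [hqr n]; abel, hp, hq] at h
      by_contra! h'
      linarith [mul_neg_of_pos_of_neg (hne n) h']
    have hle : lam ≤ 0 := by
      refine ge_of_tendsto hH0 (.of_forall fun n => ?_)
      have h1 := hGp (ψ n)
      have h2 := inner_gradH_le ω (p (ψ n)) (-(r (ψ n) - lam • p (ψ n)))
      rw [suppH_neg, inner_neg_right, inner_sub_right, inner_smul_right, inner_gradH_self, hp] at h2
      linarith
    -- If `q' = p'`, the supporting inequality at `p n` gives `lam ≤ 0` and the one at `q n` gives
    -- `lam ≥ 0`, whereas `lam ≠ 0`. If `q' = -p'`, the monotonicity pairing is at least `4 - 2 H(p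
    -- + q)`, which tends to 4, and it is also bounded by a null sequence.
    rcases eq_or_eq_neg_of_abs_eq habs with h | h
    · have hd0 : ‖q' - p'‖ = 0 := by
        have : ‖q' - p'‖ * lam = 0 := by linarith
        exact (mul_eq_zero.1 this).resolve_right hlam0
      have hqp : q' - p' = 0 := norm_eq_zero.1 hd0
      have hH1 : Tendsto (fun n => suppH ω (q (ψ n) - p (ψ n))) atTop (𝓝 0) := by
        have h := ((continuous_suppH ω).tendsto (q' - p')).comp (hlq.sub hlp)
        rwa [hqp, suppH_zero] at h
      have hge : 0 ≤ lam * (1 - 0) + 0 := by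
        refine ge_of_tendsto (((tendsto_const_nhds (x := (1 : ℝ))).sub hH1).const_mul lam |>.add hH0)
          (.of_forall fun n => ?_)
        have h1 := hGq (ψ n)
        have h2 := inner_gradH_le ω (q (ψ n)) (r (ψ n) - lam • p (ψ n))
        have h3 := inner_gradH_le ω (q (ψ n)) (q (ψ n) - p (ψ n))
        rw [inner_sub_right, inner_gradH_self, hq] at h3
        rw [inner_sub_right, inner_smul_right] at h2
        nlinarith
      exact hlam0 (le_antisymm hle (by linarith))
    · have hqp : p' + q' = 0 := by rw [hrel, h]; simp
      have hH1 : Tendsto (fun n => 4 - 2 * suppH ω (p (ψ n) + q (ψ n))) atTop (𝓝 (4 - 2 * 0)) := by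
        have h := ((continuous_suppH ω).tendsto (p' + q')).comp (hlp.add hlq)
        rw [hqp, suppH_zero] at h
        exact tendsto_const_nhds.sub (h.const_mul 2)
      have hR : Tendsto (fun n => 1 / (((ψ n : ℕ) : ℝ) + 1) * δ (ψ n) ^ 2) atTop
          (𝓝 (0 * ‖q' - p'‖ ^ 2)) := hinv.mul (hlδ.pow 2)
      have := le_of_tendsto_of_tendsto' hH1 hR fun n => by
        refine le_trans ?_ (hlt (ψ n)).le
        have h1 := inner_gradH_le ω (p (ψ n)) (p (ψ n) + q (ψ n))
        have h2 := inner_gradH_le ω (q (ψ n)) (p (ψ n) + q (ψ n))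
        rw [inner_add_right, inner_gradH_self] at h1 h2
        simp only [inner_sub_left, inner_sub_right, inner_gradH_self]
        have e1 := hp (ψ n)
        have e2 := hq (ψ n)
        linarith
      linarith
  · push Not at hpar
    obtain ⟨ε, hε, c, hc, hloc⟩ := local_strong_monotone hpos hp'0 hpar
    set D := ‖q' - p'‖ + 1
    have hD : 0 < D := by positivity
    -- The distance `δ` need not tend to zero. The local estimate is applied to the shortened step
    -- `κ δ < ε`, and `gradH_monotone` extends it to the full one.
    set κ := min 1 (ε / (2 * D))
    have hκ : 0 < κ := lt_min one_pos (by positivity)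
    have ev1 : ∀ᶠ n in atTop, dist (p (ψ n)) p' < ε := Metric.tendsto_nhds.1 hlp ε hε
    have ev2 : ∀ᶠ n in atTop, dist (r (ψ n)) r' < ε := Metric.tendsto_nhds.1 hlr ε hε
    have ev3 : ∀ᶠ n in atTop, δ (ψ n) < D := hlδ.eventually (gt_mem_nhds (by simp [D]))
    have ev4 : ∀ᶠ n in atTop, 1 / (((ψ n : ℕ) : ℝ) + 1) < c * κ :=
      hinv.eventually (gt_mem_nhds (by positivity))
    obtain ⟨n, h1, h2, h3, h4⟩ := (ev1.and (ev2.and (ev3.and ev4))).exists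
    have hδ := hne (ψ n)
    change 0 < δ (ψ n) at hδ
    have hκ1 : κ ≤ 1 := min_le_left _ _
    have hκε : κ * δ (ψ n) < ε := by
      have : κ ≤ ε / (2 * D) := min_le_right _ _
      rw [le_div_iff₀ (by positivity)] at this
      nlinarith
    have h5 := hloc (p (ψ n)) (r (ψ n)) (κ * δ (ψ n)) h1 h2 (by positivity) hκε
    have h6 := gradH_monotone ω (p (ψ n)) (r (ψ n)) (show κ * δ (ψ n) ≤ δ (ψ n) by nlinarith)
    rw [← hqr] at h6
    have h7 := hlt (ψ n)
    have h8 : q (ψ n) - p (ψ n) = δ (ψ n) • r (ψ n) := by rw [hqr (ψ n)]; abel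
    have h9 : ⟪gradH ω (q (ψ n)) - gradH ω (p (ψ n)), q (ψ n) - p (ψ n)⟫_ℝ =
        δ (ψ n) * ⟪gradH ω (q (ψ n)) - gradH ω (p (ψ n)), r (ψ n)⟫_ℝ := by
      rw [h8, inner_smul_right]
    rw [h9] at h7
    change _ < 1 / (((ψ n : ℕ) : ℝ) + 1) * δ (ψ n) ^ 2 at h7
    have h10 : c * κ * δ (ψ n) ^ 2 < c * κ * δ (ψ n) ^ 2 := by
      calc c * κ * δ (ψ n) ^ 2 = δ (ψ n) * (c * (κ * δ (ψ n))) := by ring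
        _ ≤ δ (ψ n) * ⟪gradH ω (q (ψ n)) - gradH ω (p (ψ n)), r (ψ n)⟫_ℝ := by
          gcongr; exact h5.trans h6
        _ < _ := h7
        _ ≤ _ := by gcongr
    exact lt_irrefl _ h10

/-! ### Duality: the radius `ρ` and the momentum map -/

/-- Every nonzero point has a momentum, and `rho` is the norm dual to the support function. -/
lemma exists_dual {ω : Fin N → ℝ} (hpos : ∀ i, 0 < ω i) {x : Phase N} (hx : x ≠ 0) :
    ∃ p, suppH ω p = 1 ∧ ⟪x, p⟫_ℝ = rho ω x ∧ 0 < rho ω x ∧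
      ∀ q, ⟪x, q⟫_ℝ ≤ rho ω x * suppH ω q := by
  have hHx := suppH_pos hpos hx
  have hunit : ∀ q : Phase N, q ≠ 0 → suppH ω ((suppH ω q)⁻¹ • q) = 1 := fun q hq => by
    have := suppH_pos hpos hq
    rw [suppH_smul, abs_of_pos (by positivity), inv_mul_cancel₀ this.ne']
  -- The momentum is a maximizer of `⟪x, ·⟫` on the compact sphere `H = 1`. Homogeneity extends the
  -- bound to all `q`, which says that `x` divided by the maximum belongs to `Ω`.
  obtain ⟨p, hp, hmax⟩ := (isCompact_suppH_eq_one hpos).exists_isMaxOn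
    ⟨(suppH ω x)⁻¹ • x, hunit x hx⟩
    (f := fun q => ⟪x, q⟫_ℝ) (continuous_const.inner continuous_id).continuousOn
  have hle : ∀ q, ⟪x, q⟫_ℝ ≤ ⟪x, p⟫_ℝ * suppH ω q := fun q => by
    by_cases hq : q = 0
    · simp [hq, suppH_zero]
    · have h := hmax (hunit q hq)
      simp only [Set.mem_ofPred_eq, inner_smul_right] at h
      rw [← div_eq_inv_mul] at h
      exact (div_le_iff₀ (suppH_pos hpos hq)).1 h
  have hM : 0 < ⟪x, p⟫_ℝ := by
    have h := hle x
    have h2 : 0 < ⟪x, x⟫_ℝ := real_inner_self_pos.2 hx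
    exact pos_of_mul_pos_left (h2.trans_le h) hHx.le
  have hgauge : rho ω x = ⟪x, p⟫_ℝ := by
    refine le_antisymm (gauge_le_of_mem hM.le ?_) ?_
    · rw [Set.mem_smul_set_iff_inv_smul_mem₀ hM.ne']
      intro q
      rw [inner_smul_left, conj_trivial, ← div_eq_inv_mul, div_le_iff₀ hM, mul_comm]
      exact hle q
    · rw [rho, gauge_def]
      refine le_csInf ⟨⟪x, p⟫_ℝ, hM, ?_⟩ ?_
      · rw [Set.mem_smul_set_iff_inv_smul_mem₀ hM.ne']
        intro q
        rw [inner_smul_left, conj_trivial, ← div_eq_inv_mul, div_le_iff₀ hM, mul_comm]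
        exact hle q
      · rintro r ⟨hr, hxr⟩
        rw [Set.mem_Ioi] at hr
        rw [Set.mem_smul_set_iff_inv_smul_mem₀ hr.ne'] at hxr
        have h := hxr p
        rw [inner_smul_left, conj_trivial, ← div_eq_inv_mul, div_le_iff₀ hr] at h
        rw [Set.mem_ofPred_eq] at hp
        rwa [hp, one_mul] at h
  refine ⟨p, hp, hgauge.symm, hgauge ▸ hM, fun q => ?_⟩
  rw [hgauge]; exact hle q

open Classical in
/-- The momentum of a nonzero point. -/
def momentum (ω : Fin N → ℝ) (x : Phase N) : Phase N :=
  if h : ∃ p, suppH ω p = 1 ∧ ⟪x, p⟫_ℝ = rho ω x then h.choose else 0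

lemma momentum_spec {ω : Fin N → ℝ} (hpos : ∀ i, 0 < ω i) {x : Phase N} (hx : x ≠ 0) :
    suppH ω (momentum ω x) = 1 ∧ ⟪x, momentum ω x⟫_ℝ = rho ω x := by
  obtain ⟨p, hp, hxp, -⟩ := exists_dual hpos hx
  have h : ∃ p, suppH ω p = 1 ∧ ⟪x, p⟫_ℝ = rho ω x := ⟨p, hp, hxp⟩
  rw [momentum, dif_pos h]
  exact h.choose_spec

lemma rho_pos {ω : Fin N → ℝ} (hpos : ∀ i, 0 < ω i) {x : Phase N} (hx : x ≠ 0) : 0 < rho ω x := by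
  obtain ⟨p, -, -, h, -⟩ := exists_dual hpos hx
  exact h

lemma rho_zero (ω : Fin N → ℝ) : rho ω (0 : Phase N) = 0 := gauge_zero

lemma ne_zero_of_rho_pos {ω : Fin N → ℝ} {x : Phase N} (h : 0 < rho ω x) : x ≠ 0 := by
  rintro rfl; rw [rho_zero] at h; exact lt_irrefl _ h

lemma inner_le_rho_mul {ω : Fin N → ℝ} (hpos : ∀ i, 0 < ω i) (x q : Phase N) :
    ⟪x, q⟫_ℝ ≤ rho ω x * suppH ω q := by
  by_cases hx : x = 0
  · simp [hx, rho_zero]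
  · obtain ⟨p, -, -, -, h⟩ := exists_dual hpos hx
    exact h q

lemma rho_nonneg (ω : Fin N → ℝ) (x : Phase N) : 0 ≤ rho ω x := gauge_nonneg x

lemma rho_smul (ω : Fin N → ℝ) {c : ℝ} (hc : 0 ≤ c) (x : Phase N) :
    rho ω (c • x) = c * rho ω x := gauge_smul_of_nonneg hc x

lemma momentum_ne_zero {ω : Fin N → ℝ} (hpos : ∀ i, 0 < ω i) {x : Phase N} (hx : x ≠ 0) :
    momentum ω x ≠ 0 := ne_zero_of_suppH_eq_one (momentum_spec hpos hx).1

/-- A maximizer of `⟪x, ·⟫` on the unit sphere of the support function satisfies the Lagrange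
condition. -/
lemma eq_rho_smul_gradH {ω : Fin N → ℝ} (hpos : ∀ i, 0 < ω i) {x p : Phase N}
    (hp : suppH ω p = 1) (hxp : ⟪x, p⟫_ℝ = rho ω x) : x = rho ω x • gradH ω p := by
  have hp0 := ne_zero_of_suppH_eq_one hp
  have hH := (hasGradientAt_suppH hpos hp0).hasFDerivAt
  have hf : HasFDerivAt (fun q : Phase N => rho ω x * suppH ω q - ⟪x, q⟫_ℝ)
      (rho ω x • (InnerProductSpace.toDual ℝ (Phase N) (gradH ω p)) -
        (innerSL ℝ x : Phase N →L[ℝ] ℝ)) p :=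
    (hH.const_mul (rho ω x)).sub ((innerSL ℝ x : Phase N →L[ℝ] ℝ).hasFDerivAt)
  have hmin : IsLocalMin (fun q : Phase N => rho ω x * suppH ω q - ⟪x, q⟫_ℝ) p := by
    refine .of_forall fun q => ?_
    simp only [hp, hxp, mul_one, sub_self]
    linarith [inner_le_rho_mul hpos x q]
  have h0 := hmin.hasFDerivAt_eq_zero hf
  refine ext_inner_right ℝ fun q => ?_
  have := congrArg (fun L : Phase N →L[ℝ] ℝ => L q) h0
  simp at this
  rw [inner_smul_left, conj_trivial]
  linarith

lemma rho_smul_gradH_momentum {ω : Fin N → ℝ} (hpos : ∀ i, 0 < ω i) {x : Phase N} (hx : x ≠ 0) :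
    rho ω x • gradH ω (momentum ω x) = x :=
  (eq_rho_smul_gradH hpos (momentum_spec hpos hx).1 (momentum_spec hpos hx).2).symm

lemma gradH_smul (ω : Fin N → ℝ) {c : ℝ} (hc : 0 < c) (p : Phase N) :
    gradH ω (c • p) = gradH ω p := by
  simp only [gradH, inner_smul_left, conj_trivial]
  congr 1
  ext1 φ
  congr 1
  rcases lt_trichotomy ⟪p, torusVec ω φ⟫_ℝ 0 with h | h | h
  · rw [sgn_of_neg h, sgn_of_neg (mul_neg_of_pos_of_neg hc h)]
  · rw [h, mul_zero]
  · rw [sgn_of_pos h, sgn_of_pos (mul_pos hc h)]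

/-- Strong monotonicity makes the gradient injective on the unit sphere; this is the uniqueness of
momenta. -/
lemma eq_of_gradH_eq {ω : Fin N → ℝ} (hpos : ∀ i, 0 < ω i) {p q : Phase N}
    (hp : suppH ω p = 1) (hq : suppH ω q = 1) (h : gradH ω p = gradH ω q) : p = q := by
  obtain ⟨c, hc, hmono⟩ := strong_monotone hpos
  have := hmono p q hp hq
  rw [h, sub_self, inner_zero_left] at this
  have h2 : ‖q - p‖ ^ 2 ≤ 0 := by
    by_contra! h'
    linarith [mul_pos hc h']
  have h3 : ‖q - p‖ = 0 := by nlinarith [norm_nonneg (q - p)]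
  exact (sub_eq_zero.1 (norm_eq_zero.1 h3)).symm

lemma gradH_ne_zero {ω : Fin N → ℝ} (hpos : ∀ i, 0 < ω i) {p : Phase N} (hp : p ≠ 0) :
    gradH ω p ≠ 0 := by
  intro h
  have h1 := inner_gradH_self ω p
  rw [h, inner_zero_left] at h1
  exact (suppH_pos hpos hp).ne h1

lemma rho_gradH {ω : Fin N → ℝ} (hpos : ∀ i, 0 < ω i) {p : Phase N} (hp : p ≠ 0) :
    rho ω (gradH ω p) = 1 := by
  have hG := gradH_ne_zero hpos hp
  obtain ⟨h1, h2⟩ := momentum_spec hpos hG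
  refine le_antisymm ?_ ?_
  · rw [← h2]
    exact (inner_gradH_le ω p _).trans_eq h1
  · have h3 := inner_le_rho_mul hpos (gradH ω p) p
    rw [inner_gradH_self] at h3
    have := suppH_pos hpos hp
    by_contra! h4
    nlinarith

lemma momentum_eq {ω : Fin N → ℝ} (hpos : ∀ i, 0 < ω i) {x p : Phase N}
    (hx : x ≠ 0) (hp : suppH ω p = 1) (hxp : x = rho ω x • gradH ω p) : momentum ω x = p := by
  refine eq_of_gradH_eq hpos (momentum_spec hpos hx).1 hp ?_
  have h := (rho_smul_gradH_momentum hpos hx).trans hxp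
  exact smul_right_injective _ (rho_pos hpos hx).ne' h

lemma momentum_gradH {ω : Fin N → ℝ} (hpos : ∀ i, 0 < ω i) {p : Phase N} (hp : suppH ω p = 1) :
    momentum ω (gradH ω p) = p := by
  have hp0 := ne_zero_of_suppH_eq_one hp
  refine momentum_eq hpos (gradH_ne_zero hpos hp0) hp ?_
  rw [rho_gradH hpos hp0, one_smul]

lemma momentum_smul {ω : Fin N → ℝ} (hpos : ∀ i, 0 < ω i) {x : Phase N} (hx : x ≠ 0) {c : ℝ}
    (hc : 0 < c) : momentum ω (c • x) = momentum ω x := by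
  refine momentum_eq hpos (smul_ne_zero hc.ne' hx) (momentum_spec hpos hx).1 ?_
  rw [rho_smul ω hc.le, mul_smul, rho_smul_gradH_momentum hpos hx]

lemma gradient_suppH {ω : Fin N → ℝ} (hpos : ∀ i, 0 < ω i) {p : Phase N} (hp : p ≠ 0) :
    gradient (suppH ω) p = gradH ω p := (hasGradientAt_suppH hpos hp).gradient

lemma gradH_momentum {ω : Fin N → ℝ} (hpos : ∀ i, 0 < ω i) {x : Phase N} (hx : rho ω x = 1) :
    gradH ω (momentum ω x) = x := by
  have h := rho_smul_gradH_momentum hpos (ne_zero_of_rho_pos (hx ▸ one_pos))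
  rwa [hx, one_smul] at h

lemma isMomentum_momentum {ω : Fin N → ℝ} (hpos : ∀ i, 0 < ω i) {x : Phase N} (hx : x ≠ 0) :
    IsMomentum ω x (momentum ω x) := by
  refine ⟨(momentum_spec hpos hx).1, ?_⟩
  have h := hasGradientAt_suppH hpos (momentum_ne_zero hpos hx)
  convert h using 1
  rw [inv_smul_eq_iff₀ (rho_pos hpos hx).ne', rho_smul_gradH_momentum hpos hx]

lemma IsMomentum.eq {ω : Fin N → ℝ} (hpos : ∀ i, 0 < ω i) {x p : Phase N}
    (h : IsMomentum ω x p) : x ≠ 0 ∧ p = momentum ω x := by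
  have hp0 := ne_zero_of_suppH_eq_one h.1
  have hG := h.2.unique (hasGradientAt_suppH hpos hp0)
  have hx : x ≠ 0 := by
    rintro rfl
    rw [smul_zero] at hG
    exact gradH_ne_zero hpos hp0 hG.symm
  refine ⟨hx, (momentum_eq hpos hx h.1 ?_).symm⟩
  rw [← hG, smul_inv_smul₀ (rho_pos hpos hx).ne']

/-- Comparison of two nonzero points in terms of their radii and momenta. -/
lemma exists_cocoercive {ω : Fin N → ℝ} (hpos : ∀ i, 0 < ω i) : ∃ c > 0, ∀ x y : Phase N,
    x ≠ 0 → y ≠ 0 →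
    c * ‖rho ω x • momentum ω x - rho ω y • momentum ω y‖ ^ 2 ≤
      ⟪x - y, rho ω x • momentum ω x - rho ω y • momentum ω y⟫_ℝ := by
  obtain ⟨c, hc, hmono⟩ := strong_monotone hpos
  obtain ⟨m, hm, hlow⟩ := exists_mul_norm_le_suppH hpos
  refine ⟨min (m ^ 2 / 2) (c / 2), lt_min (by positivity) (by positivity), fun x y hx hy => ?_⟩
  obtain ⟨hp, -⟩ := momentum_spec hpos hx
  obtain ⟨hq, -⟩ := momentum_spec hpos hy
  have hα := rho_pos hpos hx
  have hβ := rho_pos hpos hy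
  have ex := rho_smul_gradH_momentum hpos hx
  have ey := rho_smul_gradH_momentum hpos hy
  -- In polar form the pairing splits into `(α - β)²` and an angular term, controlled by
  -- `strong_monotone`. The displacement `α • p - β • q` splits likewise, `a • v + b • (p - q)`,
  -- with `v` one of the momenta and `b` the smaller radius, so that `b² ≤ αβ`.
  set p := momentum ω x
  set q := momentum ω y
  set α := rho ω x
  set β := rho ω y
  have h1 : ⟪x - y, α • p - β • q⟫_ℝ = (α - β) ^ 2 +
      α * β * ⟪gradH ω p - gradH ω q, p - q⟫_ℝ := by
    rw [← ex, ← ey]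
    simp only [inner_sub_left, inner_sub_right, inner_smul_left, inner_smul_right, conj_trivial,
      inner_gradH_self, hp, hq]
    ring
  have h2 := hmono q p hq hp
  have hmp : m * ‖p‖ ≤ 1 := (hlow p).trans_eq hp
  have hmq : m * ‖q‖ ≤ 1 := (hlow q).trans_eq hq
  have hsq : ∀ (a b : ℝ) (v : Phase N), 0 < b → b ^ 2 ≤ α * β → a ^ 2 = (α - β) ^ 2 →
      m * ‖v‖ ≤ 1 → α • p - β • q = a • v + b • (p - q) →
      min (m ^ 2 / 2) (c / 2) * ‖α • p - β • q‖ ^ 2 ≤ (α - β) ^ 2 + α * β * (c * ‖p - q‖ ^ 2) := by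
    intro a b v hb hbb haa hv heq
    have h3 : ‖α • p - β • q‖ ≤ |a| * ‖v‖ + b * ‖p - q‖ := by
      rw [heq]
      refine (norm_add_le _ _).trans_eq ?_
      rw [norm_smul, norm_smul, Real.norm_eq_abs, Real.norm_eq_abs, abs_of_pos hb]
    have h4 : ‖α • p - β • q‖ ^ 2 ≤ 2 * (a ^ 2 * ‖v‖ ^ 2) + 2 * (b ^ 2 * ‖p - q‖ ^ 2) := by
      calc ‖α • p - β • q‖ ^ 2 ≤ (|a| * ‖v‖ + b * ‖p - q‖) ^ 2 := by gcongr
        _ ≤ 2 * (|a| * ‖v‖) ^ 2 + 2 * (b * ‖p - q‖) ^ 2 := by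
          nlinarith [sq_nonneg (|a| * ‖v‖ - b * ‖p - q‖)]
        _ = _ := by rw [mul_pow, mul_pow, sq_abs]
    have h5 : m ^ 2 * ‖v‖ ^ 2 ≤ 1 := by
      rw [← mul_pow]; exact pow_le_one₀ (by positivity) hv
    calc min (m ^ 2 / 2) (c / 2) * ‖α • p - β • q‖ ^ 2
        ≤ min (m ^ 2 / 2) (c / 2) * (2 * (a ^ 2 * ‖v‖ ^ 2) + 2 * (b ^ 2 * ‖p - q‖ ^ 2)) := by
          gcongr
      _ = min (m ^ 2 / 2) (c / 2) * (2 * (a ^ 2 * ‖v‖ ^ 2)) +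
          min (m ^ 2 / 2) (c / 2) * (2 * (b ^ 2 * ‖p - q‖ ^ 2)) := by ring
      _ ≤ m ^ 2 / 2 * (2 * (a ^ 2 * ‖v‖ ^ 2)) + c / 2 * (2 * (b ^ 2 * ‖p - q‖ ^ 2)) := by
          gcongr
          · exact min_le_left _ _
          · exact min_le_right _ _
      _ = a ^ 2 * (m ^ 2 * ‖v‖ ^ 2) + b ^ 2 * (c * ‖p - q‖ ^ 2) := by ring
      _ ≤ a ^ 2 * 1 + α * β * (c * ‖p - q‖ ^ 2) := by gcongr
      _ = _ := by rw [mul_one, haa]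
  have h6 : min (m ^ 2 / 2) (c / 2) * ‖α • p - β • q‖ ^ 2 ≤
      (α - β) ^ 2 + α * β * (c * ‖p - q‖ ^ 2) := by
    rcases le_total β α with h | h
    · refine hsq (α - β) β p hβ (by nlinarith) rfl hmp ?_
      module
    · refine hsq (α - β) α q hα (by nlinarith) rfl hmq ?_
      module
  rw [h1]
  refine h6.trans ?_
  gcongr

/-- Cauchy–Schwarz turns cocoercivity into a Lipschitz bound once both radii equal 1. -/
lemma exists_lipschitz_momentum {ω : Fin N → ℝ} (hpos : ∀ i, 0 < ω i) : ∃ L : NNReal,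
    LipschitzOnWith L (momentum ω) {x : Phase N | rho ω x = 1} := by
  obtain ⟨c, hc, h⟩ := exists_cocoercive hpos
  refine ⟨c⁻¹.toNNReal, LipschitzOnWith.of_dist_le_mul fun x hx y hy => ?_⟩
  rw [Set.mem_ofPred_eq] at hx hy
  have h1 := h x y (ne_zero_of_rho_pos (hx ▸ one_pos)) (ne_zero_of_rho_pos (hy ▸ one_pos))
  rw [hx, hy, one_smul, one_smul] at h1
  have h2 := real_inner_le_norm (x - y) (momentum ω x - momentum ω y)
  rw [Real.coe_toNNReal _ (by positivity), dist_eq_norm, dist_eq_norm, ← div_eq_inv_mul,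
    le_div_iff₀ hc]
  rcases (norm_nonneg (momentum ω x - momentum ω y)).eq_or_lt with h0 | h0
  · rw [← h0]; simp
  · refine le_of_mul_le_mul_right ?_ h0
    nlinarith

lemma exists_lipschitz_rho {ω : Fin N → ℝ} (hpos : ∀ i, 0 < ω i) : ∃ L : NNReal,
    LipschitzWith L (rho ω : Phase N → ℝ) := by
  obtain ⟨m, hm, hlow⟩ := exists_mul_norm_le_suppH hpos
  refine ⟨m⁻¹.toNNReal, LipschitzWith.of_le_add_mul _ fun x y => ?_⟩
  rw [Real.coe_toNNReal _ (by positivity), dist_eq_norm]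
  by_cases hx : x = 0
  · rw [hx, rho_zero]
    have := rho_nonneg ω y
    positivity
  obtain ⟨h1, h2⟩ := momentum_spec hpos hx
  have h3 := inner_le_rho_mul hpos y (momentum ω x)
  rw [h1, mul_one] at h3
  have h4 : m * ‖momentum ω x‖ ≤ 1 := (hlow _).trans_eq h1
  have h5 : ‖momentum ω x‖ ≤ m⁻¹ := by
    rw [← one_div, le_div_iff₀ hm]; linarith
  have h6 := real_inner_le_norm (x - y) (momentum ω x)
  rw [inner_sub_left] at h6
  have h7 : ‖x - y‖ * ‖momentum ω x‖ ≤ m⁻¹ * ‖x - y‖ := by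
    rw [mul_comm]; gcongr
  linarith

lemma continuous_rho {ω : Fin N → ℝ} (hpos : ∀ i, 0 < ω i) :
    Continuous (rho ω : Phase N → ℝ) := by
  obtain ⟨L, hL⟩ := exists_lipschitz_rho hpos
  exact hL.continuous

lemma rho_normalize {ω : Fin N → ℝ} (hpos : ∀ i, 0 < ω i) {x : Phase N} (hx : x ≠ 0) :
    rho ω ((rho ω x)⁻¹ • x) = 1 := by
  have := rho_pos hpos hx
  rw [rho_smul ω (by positivity), inv_mul_cancel₀ this.ne']

lemma continuousAt_momentum {ω : Fin N → ℝ} (hpos : ∀ i, 0 < ω i) {x : Phase N} (hx : x ≠ 0) :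
    ContinuousAt (momentum ω) x := by
  obtain ⟨L, hL⟩ := exists_lipschitz_momentum hpos
  have h1 : ContinuousAt (fun y => (rho ω y)⁻¹ • y) x :=
    ((continuous_rho hpos).continuousAt.inv₀ (rho_pos hpos hx).ne').smul continuousAt_id
  have hev : ∀ᶠ y in 𝓝 x, y ≠ 0 := isOpen_ne.mem_nhds hx
  have h2 : Tendsto (fun y => (rho ω y)⁻¹ • y) (𝓝 x) (𝓝[{x | rho ω x = 1}] ((rho ω x)⁻¹ • x)) :=
    tendsto_nhdsWithin_iff.2 ⟨h1, hev.mono fun y hy => rho_normalize hpos hy⟩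
  have h3 := (hL.continuousOn _ (rho_normalize hpos hx)).tendsto.comp h2
  have h4 : ∀ y : Phase N, y ≠ 0 → momentum ω ((rho ω y)⁻¹ • y) = momentum ω y := fun y hy =>
    momentum_smul hpos hy (by have := rho_pos hpos hy; positivity)
  rw [h4 x hx] at h3
  exact h3.congr' (hev.mono fun y hy => h4 y hy)

/-- The duality inequality, used with the momentum at `x` and with that at `y`, encloses `ρ(y) -
ρ(x)` between `⟪p(x), y - x⟫` and `⟪p(y), y - x⟫`. Continuity of the momentum then gives the
derivative. -/
lemma hasGradientAt_rho {ω : Fin N → ℝ} (hpos : ∀ i, 0 < ω i) {x : Phase N} (hx : x ≠ 0) :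
    HasGradientAt (rho ω) (momentum ω x) x := by
  rw [hasGradientAt_iff_isLittleO, Asymptotics.isLittleO_iff]
  intro c hc
  have hev : ∀ᶠ y in 𝓝 x, y ≠ 0 := isOpen_ne.mem_nhds hx
  filter_upwards [hev, Metric.tendsto_nhds.1 (continuousAt_momentum hpos hx) c hc] with y hy hyc
  obtain ⟨h1, h2⟩ := momentum_spec hpos hx
  obtain ⟨h3, h4⟩ := momentum_spec hpos hy
  have h5 := inner_le_rho_mul hpos y (momentum ω x)
  have h6 := inner_le_rho_mul hpos x (momentum ω y)
  rw [h1, mul_one] at h5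
  rw [h3, mul_one] at h6
  have h7 := real_inner_le_norm (momentum ω y - momentum ω x) (y - x)
  have e1 : ⟪momentum ω x, y - x⟫_ℝ = ⟪y, momentum ω x⟫_ℝ - rho ω x := by
    rw [inner_sub_right, ← h2, real_inner_comm y, real_inner_comm x]
  have e2 : ⟪momentum ω y, y - x⟫_ℝ = rho ω y - ⟪x, momentum ω y⟫_ℝ := by
    rw [inner_sub_right, ← h4, real_inner_comm y, real_inner_comm x]
  rw [inner_sub_left, e1, e2] at h7
  rw [dist_eq_norm] at hyc
  have h8 : ‖momentum ω y - momentum ω x‖ * ‖y - x‖ ≤ c * ‖y - x‖ := by gcongr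
  rw [e1, Real.norm_eq_abs, abs_of_nonneg (by linarith)]
  linarith

lemma gradient_rho_eventuallyEq {ω : Fin N → ℝ} (hpos : ∀ i, 0 < ω i) {x : Phase N} (hx : x ≠ 0) :
    gradient (rho ω) =ᶠ[𝓝 x] momentum ω := by
  filter_upwards [isOpen_ne.mem_nhds hx] with y hy
  exact (hasGradientAt_rho hpos hy).gradient

/-- The gradient of `ρ` is the momentum near the point, so the Hessian of `ρ` is the derivative of
the momentum map. -/
lemma tildeB_eq {ω : Fin N → ℝ} (hpos : ∀ i, 0 < ω i) {p : Phase N} (hp : suppH ω p = 1) :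
    tildeB ω p = fderiv ℝ (momentum ω) (gradH ω p) (vecB N) := by
  have hp0 := ne_zero_of_suppH_eq_one hp
  rw [tildeB, gradient_suppH hpos hp0,
    (gradient_rho_eventuallyEq hpos (gradH_ne_zero hpos hp0)).fderiv_eq]

/-! ### Differentiability of the momentum map -/

section Derivative

variable {E : Type*} [NormedAddCommGroup E] [InnerProductSpace ℝ E]

lemma tendsto_slope_line {g : E → E} {g' : E →L[ℝ] E} {x : E} (hg : HasFDerivAt g g' x) (h : E) :
    Tendsto (fun t : ℝ => t⁻¹ • (g (x + t • h) - g x)) (𝓝[≠] 0) (𝓝 (g' h)) := by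
  have h1 : HasDerivAt (fun t : ℝ => g (x + t • h)) (g' h) 0 := by
    have hl : HasDerivAt (fun t : ℝ => x + t • h) h 0 := by
      simpa using ((hasDerivAt_id (0 : ℝ)).smul_const h).const_add x
    have hg' : HasFDerivAt g g' (x + (0 : ℝ) • h) := by simpa using hg
    exact hg'.comp_hasDerivAt 0 hl
  simpa using h1.tendsto_slope_zero

lemma eventually_line {P : E → Prop} {x : E} (hP : ∀ᶠ y in 𝓝 x, P y) (h : E) :
    ∀ᶠ t in 𝓝[≠] (0 : ℝ), P (x + t • h) := by
  have hc : Tendsto (fun t : ℝ => x + t • h) (𝓝 0) (𝓝 x) := by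
    have : Continuous fun t : ℝ => x + t • h := by fun_prop
    simpa using this.tendsto 0
  exact (hc.eventually hP).filter_mono nhdsWithin_le_nhds

/-- Strong monotonicity passes to the derivative. -/
lemma strong_monotone_fderiv {g : E → E} {g' : E →L[ℝ] E} {x : E} (hg : HasFDerivAt g g' x) {c : ℝ}
    (hm : ∀ᶠ y in 𝓝 x, c * ‖y - x‖ ^ 2 ≤ ⟪g y - g x, y - x⟫_ℝ) (h : E) :
    c * ‖h‖ ^ 2 ≤ ⟪g' h, h⟫_ℝ := by
  refine ge_of_tendsto ((tendsto_slope_line hg h).inner tendsto_const_nhds) ?_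
  filter_upwards [eventually_line hm h, self_mem_nhdsWithin] with t ht ht0
  have ht0' : t ≠ 0 := ht0
  rw [add_sub_cancel_left, norm_smul, inner_smul_right, mul_pow, Real.norm_eq_abs, sq_abs] at ht
  rw [inner_smul_left, conj_trivial]
  have h2 : 0 < t ^ 2 := by positivity
  refine le_of_mul_le_mul_left ?_ h2
  calc t ^ 2 * (c * ‖h‖ ^ 2) = c * (t ^ 2 * ‖h‖ ^ 2) := by ring
    _ ≤ t * ⟪g (x + t • h) - g x, h⟫_ℝ := ht
    _ = _ := by field_simp

/-- Cocoercivity passes to the derivative. -/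
lemma cocoercive_fderiv {g : E → E} {g' : E →L[ℝ] E} {x : E} (hg : HasFDerivAt g g' x) {c : ℝ}
    (hm : ∀ᶠ y in 𝓝 x, c * ‖g y - g x‖ ^ 2 ≤ ⟪y - x, g y - g x⟫_ℝ) (h : E) :
    c * ‖g' h‖ ^ 2 ≤ ⟪h, g' h⟫_ℝ := by
  have hs := tendsto_slope_line hg h
  refine le_of_tendsto_of_tendsto ((hs.norm.pow 2).const_mul c) (tendsto_const_nhds.inner hs) ?_
  filter_upwards [eventually_line hm h, self_mem_nhdsWithin] with t ht ht0
  have ht0' : t ≠ 0 := ht0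
  rw [add_sub_cancel_left, inner_smul_left, conj_trivial] at ht
  rw [inner_smul_right, norm_smul, mul_pow, norm_inv, inv_pow, Real.norm_eq_abs, sq_abs]
  have h2 : 0 < t ^ 2 := by positivity
  refine le_of_mul_le_mul_left ?_ h2
  calc t ^ 2 * (c * ((t ^ 2)⁻¹ * ‖g (x + t • h) - g x‖ ^ 2)) = c * ‖g (x + t • h) - g x‖ ^ 2 := by
        field_simp
    _ ≤ t * ⟪h, g (x + t • h) - g x⟫_ℝ := ht
    _ = _ := by field_simp

end Derivative

/-- The momentum is differentiable where the gradient of the support function is. -/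
lemma differentiableAt_momentum {ω : Fin N → ℝ} (hpos : ∀ i, 0 < ω i) {x : Phase N}
    (hx : rho ω x = 1) (hG : DifferentiableAt ℝ (gradH ω) (momentum ω x)) :
    DifferentiableAt ℝ (momentum ω) x := by
  have hx0 : x ≠ 0 := ne_zero_of_rho_pos (hx ▸ one_pos)
  obtain ⟨c, hc, hcoc⟩ := exists_cocoercive hpos
  -- `K` and `F` are the gradients of `ρ² / 2` and `H² / 2`, mutually inverse away from zero.
  -- Cocoercivity of `K` is strong monotonicity of `F`, so the derivative of `F` is invertible and
  -- the inverse map `K` is differentiable.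
  set K : Phase N → Phase N := fun y => rho ω y • momentum ω y
  set F : Phase N → Phase N := fun q => suppH ω q • gradH ω q
  have hKx : K x = momentum ω x := by simp only [K, hx, one_smul]
  have hp0 := momentum_ne_zero hpos hx0
  have hF : DifferentiableAt ℝ F (K x) := by
    rw [hKx]
    exact (hasGradientAt_suppH hpos hp0).hasFDerivAt.differentiableAt.smul hG
  have hFK : ∀ y, y ≠ 0 → F (K y) = y := fun y hy => by
    have hy' := rho_pos hpos hy
    simp only [F, K]
    rw [suppH_smul, (momentum_spec hpos hy).1, mul_one, abs_of_pos hy', gradH_smul ω hy',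
      rho_smul_gradH_momentum hpos hy]
  have hKF : ∀ q, q ≠ 0 → F q ≠ 0 ∧ K (F q) = q := fun q hq => by
    have hq' := suppH_pos hpos hq
    have hGq := gradH_ne_zero hpos hq
    refine ⟨smul_ne_zero hq'.ne' hGq, ?_⟩
    have hu : suppH ω ((suppH ω q)⁻¹ • q) = 1 := by
      rw [suppH_smul, abs_of_pos (by positivity), inv_mul_cancel₀ hq'.ne']
    have hmom : momentum ω (gradH ω q) = (suppH ω q)⁻¹ • q := by
      have := momentum_gradH hpos hu
      rwa [gradH_smul ω (by positivity)] at this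
    simp only [F, K]
    rw [rho_smul ω hq'.le, rho_gradH hpos hq, momentum_smul hpos hGq hq', hmom, mul_one,
      smul_inv_smul₀ hq'.ne']
  have hstrong : ∀ᶠ q in 𝓝 (K x), c * ‖q - K x‖ ^ 2 ≤ ⟪F q - F (K x), q - K x⟫_ℝ := by
    have : ∀ᶠ q in 𝓝 (K x), q ≠ 0 := isOpen_ne.mem_nhds (hKx ▸ hp0)
    filter_upwards [this] with q hq
    have h := hcoc (F q) x (hKF q hq).1 hx0
    have e : rho ω (F q) • momentum ω (F q) = q := (hKF q hq).2
    rw [e] at h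
    rw [hFK x hx0]
    exact h
  have hinj : Function.Injective (fderiv ℝ F (K x)) := by
    refine (injective_iff_map_eq_zero _).2 fun h hh => ?_
    have h1 := strong_monotone_fderiv hF.hasFDerivAt hstrong h
    rw [hh, inner_zero_left] at h1
    have h2 : ‖h‖ ^ 2 ≤ 0 := by
      by_contra! h'
      linarith [mul_pos hc h']
    exact norm_eq_zero.1 (by nlinarith [norm_nonneg h])
  let e : Phase N ≃L[ℝ] Phase N :=
    (LinearEquiv.ofInjectiveEndo (fderiv ℝ F (K x) : Phase N →ₗ[ℝ] Phase N)
      hinj).toContinuousLinearEquiv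
  have he : (e : Phase N →L[ℝ] Phase N) = fderiv ℝ F (K x) := by ext; rfl
  have hFe : HasFDerivAt F (e : Phase N →L[ℝ] Phase N) (K x) := he ▸ hF.hasFDerivAt
  have hKc : ContinuousAt K x :=
    (continuous_rho hpos).continuousAt.smul (continuousAt_momentum hpos hx0)
  have hev : ∀ᶠ y in 𝓝 x, y ≠ 0 := isOpen_ne.mem_nhds hx0
  have hK : HasFDerivAt K (e.symm : Phase N →L[ℝ] Phase N) x :=
    hFe.of_local_left_inverse hKc (hev.mono hFK)
  have hρ : DifferentiableAt ℝ (fun y => (rho ω y)⁻¹) x :=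
    (hasGradientAt_rho hpos hx0).hasFDerivAt.differentiableAt.inv (by rw [hx]; exact one_ne_zero)
  refine (hρ.smul hK.differentiableAt).congr_of_eventuallyEq (hev.mono fun y hy => ?_)
  simp only [Pi.smul_apply', K]
  rw [inv_smul_smul₀ (rho_pos hpos hy).ne']

/-- The second derivative of `rho` is positive on tangent vectors which it does not annihilate. -/
lemma fderiv_momentum_eq_zero {ω : Fin N → ℝ} (hpos : ∀ i, 0 < ω i) {x : Phase N}
    (hx : rho ω x = 1) (hd : DifferentiableAt ℝ (momentum ω) x) {h : Phase N}
    (hh : ⟪momentum ω x, h⟫_ℝ = 0) (h0 : ⟪fderiv ℝ (momentum ω) x h, h⟫_ℝ = 0) :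
    fderiv ℝ (momentum ω) x h = 0 := by
  have hx0 : x ≠ 0 := ne_zero_of_rho_pos (hx ▸ one_pos)
  obtain ⟨c, hc, hcoc⟩ := exists_cocoercive hpos
  have hρ := (hasGradientAt_rho hpos hx0).hasFDerivAt
  have hK := hρ.smul hd.hasFDerivAt
  have hev : ∀ᶠ y in 𝓝 x, y ≠ 0 := isOpen_ne.mem_nhds hx0
  have h1 := cocoercive_fderiv hK (c := c) (hev.mono fun y hy => hcoc y x hy hx0) h
  -- At radius 1, and on vectors orthogonal to the momentum, the derivative of `ρ p` coincides with
  -- that of `p`, so cocoercivity of `ρ p` applies to the latter.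
  have e : (rho ω x • fderiv ℝ (momentum ω) x +
      ((InnerProductSpace.toDual ℝ (Phase N)) (momentum ω x)).smulRight (momentum ω x)) h =
      fderiv ℝ (momentum ω) x h := by
    simp [hx, hh]
  rw [e, real_inner_comm, h0] at h1
  have h2 : ‖fderiv ℝ (momentum ω) x h‖ ^ 2 ≤ 0 := by
    by_contra! h'
    linarith [mul_pos hc h']
  exact norm_eq_zero.1 (by nlinarith [norm_nonneg (fderiv ℝ (momentum ω) x h)])

/-! ### Bessel functions and their decay -/

/-- The Bessel function `J₀`. -/
def bessel (s : ℝ) : ℝ := ∫ θ, Real.cos (s * Real.cos θ) ∂angleMeasure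

/-- The first derivative of `J₀`. -/
def besselDeriv (s : ℝ) : ℝ := ∫ θ, -(Real.sin (s * Real.cos θ) * Real.cos θ) ∂angleMeasure

/-- The second derivative of `J₀`. -/
def besselDeriv₂ (s : ℝ) : ℝ :=
  ∫ θ, -(Real.cos (s * Real.cos θ) * Real.cos θ * Real.cos θ) ∂angleMeasure

lemma integrable_angle {f : ℝ → ℝ} (hf : Continuous f) {C : ℝ} (hC : ∀ θ, |f θ| ≤ C) :
    Integrable f angleMeasure :=
  Integrable.of_bound hf.aestronglyMeasurable C (.of_forall hC)

lemma abs_integral_angle_le {f : ℝ → ℝ} {C : ℝ} (hC : ∀ θ, |f θ| ≤ C) :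
    |∫ θ, f θ ∂angleMeasure| ≤ C := by
  have := norm_integral_le_of_norm_le_const (μ := angleMeasure) (f := f) (C := C) (.of_forall hC)
  simpa using this

lemma abs_sin_mul_cos_le (s θ : ℝ) : |-(Real.sin (s * Real.cos θ) * Real.cos θ)| ≤ 1 := by
  rw [abs_neg, abs_mul]
  exact mul_le_one₀ (Real.abs_sin_le_one _) (abs_nonneg _) (Real.abs_cos_le_one _)

lemma abs_cos_mul_cos_mul_cos_le (s θ : ℝ) :
    |-(Real.cos (s * Real.cos θ) * Real.cos θ * Real.cos θ)| ≤ 1 := by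
  rw [abs_neg, abs_mul, abs_mul]
  exact mul_le_one₀ (mul_le_one₀ (Real.abs_cos_le_one _) (abs_nonneg _) (Real.abs_cos_le_one _))
    (abs_nonneg _) (Real.abs_cos_le_one _)

lemma abs_bessel_le (s : ℝ) : |bessel s| ≤ 1 :=
  abs_integral_angle_le fun _ => Real.abs_cos_le_one _

lemma abs_besselDeriv_le (s : ℝ) : |besselDeriv s| ≤ 1 :=
  abs_integral_angle_le fun θ => abs_sin_mul_cos_le s θ

lemma abs_besselDeriv_le_abs (s : ℝ) : |besselDeriv s| ≤ |s| := by
  refine abs_integral_angle_le fun θ => ?_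
  have hc := Real.abs_cos_le_one θ
  rw [abs_neg, abs_mul]
  calc |Real.sin (s * Real.cos θ)| * |Real.cos θ| ≤ |s * Real.cos θ| * 1 :=
        mul_le_mul Real.abs_sin_le_abs hc (abs_nonneg _) (abs_nonneg _)
    _ = |s| * |Real.cos θ| := by rw [mul_one, abs_mul]
    _ ≤ |s| * 1 := by gcongr
    _ = |s| := mul_one _

lemma abs_besselDeriv₂_le (s : ℝ) : |besselDeriv₂ s| ≤ 1 :=
  abs_integral_angle_le fun θ => abs_cos_mul_cos_mul_cos_le s θ

lemma hasDerivAt_bessel (s : ℝ) : HasDerivAt bessel (besselDeriv s) s := by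
  refine (hasDerivAt_integral_of_dominated_loc_of_deriv_le (μ := angleMeasure) (s := Set.univ)
    (bound := fun _ => 1) (F := fun s θ => Real.cos (s * Real.cos θ))
    (F' := fun s θ => -(Real.sin (s * Real.cos θ) * Real.cos θ))
    univ_mem (.of_forall fun x => ?_) ?_ ?_ (.of_forall fun θ x _ => ?_) (integrable_const _)
    (.of_forall fun θ x _ => ?_)).2
  · exact Continuous.aestronglyMeasurable (by fun_prop)
  · exact integrable_angle (by fun_prop) fun θ => Real.abs_cos_le_one _
  · exact Continuous.aestronglyMeasurable (by fun_prop)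
  · exact abs_sin_mul_cos_le x θ
  · have := ((hasDerivAt_id x).mul_const (Real.cos θ)).cos
    simpa using this

lemma hasDerivAt_besselDeriv (s : ℝ) : HasDerivAt besselDeriv (besselDeriv₂ s) s := by
  refine (hasDerivAt_integral_of_dominated_loc_of_deriv_le (μ := angleMeasure) (s := Set.univ)
    (bound := fun _ => 1) (F := fun s θ => -(Real.sin (s * Real.cos θ) * Real.cos θ))
    (F' := fun s θ => -(Real.cos (s * Real.cos θ) * Real.cos θ * Real.cos θ))
    univ_mem (.of_forall fun x => ?_) ?_ ?_ (.of_forall fun θ x _ => ?_) (integrable_const _)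
    (.of_forall fun θ x _ => ?_)).2
  · exact Continuous.aestronglyMeasurable (by fun_prop)
  · exact integrable_angle (by fun_prop) fun θ => abs_sin_mul_cos_le s θ
  · exact Continuous.aestronglyMeasurable (by fun_prop)
  · exact abs_cos_mul_cos_mul_cos_le x θ
  · have := ((((hasDerivAt_id x).mul_const (Real.cos θ)).sin).mul_const (Real.cos θ)).fun_neg
    simpa using this

lemma continuous_bessel : Continuous bessel :=
  continuous_iff_continuousAt.2 fun s => (hasDerivAt_bessel s).continuousAt

lemma continuous_besselDeriv : Continuous besselDeriv :=
  continuous_iff_continuousAt.2 fun s => (hasDerivAt_besselDeriv s).continuousAt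

lemma continuous_besselDeriv₂ : Continuous besselDeriv₂ := by
  refine continuous_of_dominated (bound := fun _ => 1) (fun x => ?_)
    (fun x => .of_forall fun θ => ?_) (integrable_const _) (.of_forall fun θ => ?_)
  · exact Continuous.aestronglyMeasurable (by fun_prop)
  · exact abs_cos_mul_cos_mul_cos_le x θ
  · fun_prop

/-- Bessel's differential equation. -/
lemma bessel_ode (s : ℝ) : s * besselDeriv₂ s + besselDeriv s + s * bessel s = 0 := by
  -- Bessel's equation is the vanishing over a period of the integral of the derivative of `-sin (s
  -- cos θ) sin θ`.
  have h1 : ∫ θ in (0 : ℝ)..(2 * Real.pi), (s * (Real.cos (s * Real.cos θ) * Real.sin θ ^ 2) -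
      Real.sin (s * Real.cos θ) * Real.cos θ) = 0 := by
    have hd : ∀ θ ∈ Set.uIcc 0 (2 * Real.pi),
        HasDerivAt (fun θ => -(Real.sin (s * Real.cos θ) * Real.sin θ))
          (s * (Real.cos (s * Real.cos θ) * Real.sin θ ^ 2) -
            Real.sin (s * Real.cos θ) * Real.cos θ) θ := fun θ _ => by
      have := ((((Real.hasDerivAt_cos θ).const_mul s).sin).mul (Real.hasDerivAt_sin θ)).neg
      convert! this using 1
      ring
    rw [intervalIntegral.integral_eq_sub_of_hasDerivAt hd
      (Continuous.intervalIntegrable (by fun_prop) _ _)]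
    simp
  have hi0 : Integrable (fun θ => Real.cos (s * Real.cos θ)) angleMeasure :=
    integrable_angle (by fun_prop) fun θ => Real.abs_cos_le_one _
  have hi1 : Integrable (fun θ => -(Real.sin (s * Real.cos θ) * Real.cos θ)) angleMeasure :=
    integrable_angle (by fun_prop) fun θ => abs_sin_mul_cos_le s θ
  have hi2 : Integrable (fun θ => -(Real.cos (s * Real.cos θ) * Real.cos θ * Real.cos θ))
      angleMeasure := integrable_angle (by fun_prop) fun θ => abs_cos_mul_cos_mul_cos_le s θ
  have h2 : s * besselDeriv₂ s + besselDeriv s + s * bessel s =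
      ∫ θ, (s * (Real.cos (s * Real.cos θ) * Real.sin θ ^ 2) -
      Real.sin (s * Real.cos θ) * Real.cos θ) ∂angleMeasure := by
    rw [besselDeriv₂, besselDeriv, bessel, ← integral_const_mul, ← integral_const_mul,
      ← integral_add (hi2.const_mul s) hi1,
      ← integral_add (f := fun θ => s * -(Real.cos (s * Real.cos θ) * Real.cos θ * Real.cos θ) +
        -(Real.sin (s * Real.cos θ) * Real.cos θ)) ((hi2.const_mul s).add hi1) (hi0.const_mul s)]
    refine integral_congr_ae (.of_forall fun θ => ?_)
    simp only [Real.sin_sq]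
    ring
  rw [h2, integral_angleMeasure, h1, smul_zero]

/-- By the differential equation `s (J₀² + J₀'²)` has derivative `J₀² - J₀'²`. The corrections `J₀
J₀'` and `J₀² / (2s)` cancel everything except `-J₀² / (2s²)`. -/
lemma bessel_energy_antitone : AntitoneOn (fun s => s * (bessel s ^ 2 + besselDeriv s ^ 2) +
    bessel s * besselDeriv s + bessel s ^ 2 / (2 * s)) (Set.Ici 1) := by
  have hd : ∀ s : ℝ, 1 ≤ s → HasDerivAt (fun s => s * (bessel s ^ 2 + besselDeriv s ^ 2) +
      bessel s * besselDeriv s + bessel s ^ 2 / (2 * s)) (-(bessel s ^ 2 / (2 * s ^ 2))) s := by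
    intro s hs
    have hs0 : s ≠ 0 := by linarith
    have h0 := hasDerivAt_bessel s
    have h1 := hasDerivAt_besselDeriv s
    have hode := bessel_ode s
    have h := (((hasDerivAt_id s).mul ((h0.pow 2).add (h1.pow 2))).add (h0.mul h1)).add
      ((h0.pow 2).div ((hasDerivAt_id s).const_mul 2) (by simpa using hs0))
    convert! h using 1
    have h2 : besselDeriv₂ s = -besselDeriv s / s - bessel s := by
      field_simp; linarith
    simp only [h2, id, Pi.add_apply, Pi.pow_apply, Nat.cast_ofNat]
    field_simp
    ring
  refine antitoneOn_of_deriv_nonpos (convex_Ici 1)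
    (fun s hs => (hd s hs).continuousAt.continuousWithinAt)
    (fun s hs => ?_) fun s hs => ?_
  · rw [interior_Ici] at hs
    exact (hd s (le_of_lt hs)).differentiableAt.differentiableWithinAt
  · rw [interior_Ici] at hs
    rw [(hd s (le_of_lt hs)).deriv, neg_nonpos]
    positivity

/-- The energy is at most `7/2` at `s = 1`, and for `s ≥ 1` it is at least `(s - 1/2)(J₀² + J₀'²) ≥
(s/2)(J₀² + J₀'²)`. -/
lemma bessel_sq_add_le {s : ℝ} (hs : 1 ≤ s) : bessel s ^ 2 + besselDeriv s ^ 2 ≤ 7 / s := by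
  have h := bessel_energy_antitone (Set.mem_Ici.2 le_rfl) (Set.mem_Ici.2 hs) hs
  simp only [one_mul, mul_one] at h
  have hs0 : 0 < s := by linarith
  obtain ⟨a1, a2⟩ := abs_le.1 (abs_bessel_le 1)
  obtain ⟨b1, b2⟩ := abs_le.1 (abs_besselDeriv_le 1)
  have h1 : bessel 1 ^ 2 ≤ 1 := by nlinarith
  have h2 : besselDeriv 1 ^ 2 ≤ 1 := by nlinarith
  have h3 : bessel 1 * besselDeriv 1 ≤ 1 := by nlinarith [sq_nonneg (bessel 1 - besselDeriv 1)]
  have h4 : 0 ≤ bessel s ^ 2 / (2 * s) := by positivity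
  have h5 : -(bessel s ^ 2 + besselDeriv s ^ 2) / 2 ≤ bessel s * besselDeriv s := by
    nlinarith [sq_nonneg (bessel s + besselDeriv s)]
  rw [le_div_iff₀ hs0]
  nlinarith [sq_nonneg (bessel s), sq_nonneg (besselDeriv s)]

lemma abs_le_div_sqrt {a s C : ℝ} (hs : 0 ≤ s) (hC : 0 ≤ C) (h : a ^ 2 * (1 + s) ≤ C ^ 2) :
    |a| ≤ C / √(1 + s) := by
  have hpos : 0 < √(1 + s) := Real.sqrt_pos.2 (by linarith)
  rw [le_div_iff₀ hpos]
  refine abs_le_of_sq_le_sq' ?_ hC |>.2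
  rw [mul_pow, Real.sq_sqrt (by linarith), sq_abs]
  exact h

/-- Decay of the Bessel function and its derivatives. -/
lemma bessel_decay {s : ℝ} (hs : 0 ≤ s) : |bessel s| ≤ 8 / √(1 + s) ∧
    |besselDeriv s| ≤ 8 / √(1 + s) ∧ |besselDeriv₂ s| ≤ 8 / √(1 + s) := by
  rcases le_total s 1 with h1 | h1
  · have aux : ∀ a : ℝ, |a| ≤ 1 → |a| ≤ 8 / √(1 + s) := fun a ha => by
      refine abs_le_div_sqrt hs (by norm_num) ?_
      have : a ^ 2 ≤ 1 := by rw [← sq_abs]; exact pow_le_one₀ (abs_nonneg _) ha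
      nlinarith [sq_nonneg a]
    exact ⟨aux _ (abs_bessel_le s), aux _ (abs_besselDeriv_le s), aux _ (abs_besselDeriv₂_le s)⟩
  · have h := bessel_sq_add_le h1
    have hs0 : 0 < s := by linarith
    rw [le_div_iff₀ hs0] at h
    have hb : bessel s ^ 2 * (1 + s) ≤ 4 ^ 2 := by
      nlinarith [sq_nonneg (bessel s), sq_nonneg (besselDeriv s)]
    have hb1 : besselDeriv s ^ 2 * (1 + s) ≤ 4 ^ 2 := by
      nlinarith [sq_nonneg (bessel s), sq_nonneg (besselDeriv s)]
    have k0 := abs_le_div_sqrt hs (by norm_num) hb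
    have k1 := abs_le_div_sqrt hs (by norm_num) hb1
    have hpos : 0 < √(1 + s) := Real.sqrt_pos.2 (by linarith)
    have hle : (4 : ℝ) / √(1 + s) ≤ 8 / √(1 + s) := by gcongr; norm_num
    refine ⟨k0.trans hle, k1.trans hle, ?_⟩
    have h2 : besselDeriv₂ s = -(besselDeriv s / s) - bessel s := by
      have := bessel_ode s
      field_simp; linarith
    have h3 : |besselDeriv s / s| ≤ |besselDeriv s| := by
      rw [abs_div, abs_of_pos hs0]
      exact div_le_self (abs_nonneg _) h1
    calc |besselDeriv₂ s| ≤ |besselDeriv s / s| + |bessel s| := by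
          rw [h2]
          refine (abs_sub _ _).trans ?_
          rw [abs_neg]
      _ ≤ 4 / √(1 + s) + 4 / √(1 + s) := by linarith
      _ = 8 / √(1 + s) := by ring

/-! ### The Fourier formula for the averaged absolute value -/

lemma one_sub_cos_div_sq_nonneg (a t : ℝ) : 0 ≤ (1 - Real.cos (a * t)) / t ^ 2 :=
  div_nonneg (sub_nonneg.2 (Real.cos_le_one _)) (sq_nonneg _)

lemma one_sub_cos_div_sq_le (a t : ℝ) :
    (1 - Real.cos (a * t)) / t ^ 2 ≤ (a ^ 2 / 2 + 2) * (1 + t ^ 2)⁻¹ := by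
  by_cases ht : t = 0
  · simp only [ht]; norm_num; positivity
  have ht2 : 0 < t ^ 2 := by positivity
  rw [← div_eq_mul_inv, div_le_div_iff₀ ht2 (by positivity)]
  have h1 := Real.one_sub_sq_div_two_le_cos (x := a * t)
  have h2 := Real.neg_one_le_cos (a * t)
  have h3 : (1 - Real.cos (a * t)) * 1 ≤ a ^ 2 / 2 * t ^ 2 := by nlinarith
  have h4 : (1 - Real.cos (a * t)) * t ^ 2 ≤ 2 * t ^ 2 := by gcongr; linarith
  linarith

lemma measurable_one_sub_cos_div_sq (a : ℝ) :
    Measurable fun t : ℝ => (1 - Real.cos (a * t)) / t ^ 2 := by fun_prop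

lemma integrable_one_sub_cos_div_sq (a : ℝ) :
    Integrable (fun t : ℝ => (1 - Real.cos (a * t)) / t ^ 2) (volume.restrict (Set.Ioi 0)) := by
  refine Integrable.mono' ((integrable_inv_one_add_sq.const_mul (a ^ 2 / 2 + 2)).restrict
    (s := Set.Ioi 0)) (measurable_one_sub_cos_div_sq a).aestronglyMeasurable
    (.of_forall fun t => ?_)
  rw [Real.norm_eq_abs, abs_of_nonneg (one_sub_cos_div_sq_nonneg a t)]
  exact one_sub_cos_div_sq_le a t

/-- The constant in `∫ (1 - cos (a t)) / t² dt = c |a|`. -/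
def dirichletConst : ℝ := ∫ t in Set.Ioi (0 : ℝ), (1 - Real.cos (1 * t)) / t ^ 2

lemma dirichletConst_pos : 0 < dirichletConst := by
  rw [dirichletConst, setIntegral_pos_iff_support_of_nonneg_ae
    (.of_forall fun t => one_sub_cos_div_sq_nonneg 1 t) (integrable_one_sub_cos_div_sq 1)]
  refine lt_of_lt_of_le (b := volume (Set.Ioo (0 : ℝ) 1)) (by simp) (measure_mono fun t ht => ?_)
  refine ⟨?_, ht.1⟩
  have hc : Real.cos t < 1 := by
    have := Real.cos_lt_cos_of_nonneg_of_le_pi le_rfl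
      (by linarith [ht.2, Real.pi_gt_three] : t ≤ Real.pi) ht.1
    rwa [Real.cos_zero] at this
  have : 0 < (1 - Real.cos (1 * t)) / t ^ 2 := by
    rw [one_mul]; exact div_pos (by linarith) (pow_pos ht.1 2)
  exact this.ne'

/-- Scaling `t` by `|a|`. Only the positivity of the constant matters later, not its value. -/
lemma integral_one_sub_cos_div_sq (a : ℝ) :
    ∫ t in Set.Ioi (0 : ℝ), (1 - Real.cos (a * t)) / t ^ 2 = |a| * dirichletConst := by
  by_cases ha : a = 0
  · simp [ha]
  have hb : 0 < |a| := abs_pos.2 ha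
  have h := integral_comp_mul_left_Ioi (fun t => (1 - Real.cos (1 * t)) / t ^ 2) 0 hb
  rw [mul_zero, smul_eq_mul] at h
  have h2 : ∀ t, (1 - Real.cos (a * t)) / t ^ 2 =
      |a| ^ 2 * ((1 - Real.cos (1 * (|a| * t))) / (|a| * t) ^ 2) := fun t => by
    have hc : Real.cos (a * t) = Real.cos (|a| * t) := by
      rcases abs_choice a with h' | h' <;> rw [h']
      rw [neg_mul, Real.cos_neg]
    rw [hc, one_mul]
    by_cases ht : t = 0
    · simp [ht]
    · field_simp
  simp only [h2]
  rw [integral_const_mul, h, dirichletConst]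
  field_simp

lemma integral_cexp_cos (s : ℝ) :
    ∫ θ, Complex.exp ((s * Real.cos θ : ℝ) * Complex.I) ∂angleMeasure = (bessel s : ℂ) := by
  have hintegr : ∀ f : ℝ → ℝ, Continuous f → (∀ θ, |f θ| ≤ 1) →
      Integrable (fun θ => (f θ : ℂ)) angleMeasure := fun f hf h =>
    (integrable_angle hf h).ofReal
  -- Rotation by `π` changes the sign of the cosine, hence of this odd integrand.
  have hsin : ∫ θ, Real.sin (s * Real.cos θ) ∂angleMeasure = 0 := by
    obtain ⟨τ, hτ, hc⟩ := exists_rotation Real.pi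
    have h1 : ∫ θ, Real.sin (s * Real.cos θ) ∂angleMeasure =
        ∫ θ, Real.sin (s * Real.cos (τ θ)) ∂angleMeasure := by
      conv_lhs => rw [← hτ.map_eq]
      rw [integral_map hτ.measurable.aemeasurable
        (Continuous.aestronglyMeasurable (by fun_prop))]
    simp only [(hc _).1, Real.cos_add_pi, mul_neg, Real.sin_neg, integral_neg] at h1
    linarith
  have h : ∀ θ, Complex.exp ((s * Real.cos θ : ℝ) * Complex.I) =
      (Real.cos (s * Real.cos θ) : ℂ) + (Real.sin (s * Real.cos θ) : ℂ) * Complex.I := fun θ => by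
    rw [Complex.exp_mul_I, Complex.ofReal_cos, Complex.ofReal_sin]
  simp only [h]
  rw [integral_add (hintegr _ (by fun_prop) fun θ => Real.abs_cos_le_one _)
    ((hintegr _ (by fun_prop) fun θ => Real.abs_sin_le_one _).mul_const _), integral_mul_const,
    integral_complex_ofReal, integral_complex_ofReal, hsin, bessel]
  simp

/-- The characteristic function of `∑ z_i cos φ_i`. -/
lemma integral_cos_sum (z : Fin N → ℝ) (t : ℝ) :
    ∫ φ, Real.cos ((∑ i, z i * Real.cos (φ i)) * t) ∂torusMeasure N = ∏ i, bessel (z i * t) := by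
  have h1 : ∫ φ, Complex.exp (((∑ i, z i * Real.cos (φ i)) * t : ℝ) * Complex.I) ∂torusMeasure N =
      ((∏ i, bessel (z i * t) : ℝ) : ℂ) := by
    have h2 := integral_fintype_prod_eq_prod (𝕜 := ℂ) (μ := fun _ : Fin N => angleMeasure)
      (f := fun i θ => Complex.exp ((z i * t * Real.cos θ : ℝ) * Complex.I))
    simp only [integral_cexp_cos] at h2
    rw [Complex.ofReal_prod, ← h2, torusMeasure]
    refine integral_congr_ae (.of_forall fun φ => ?_)
    simp only
    rw [← Complex.exp_sum, ← Finset.sum_mul]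
    congr 2
    rw [← Complex.ofReal_sum, Finset.sum_mul]
    congr 1
    refine Finset.sum_congr rfl fun i _ => ?_
    ring
  have hintegr : Integrable (fun φ : Fin N → ℝ =>
      Complex.exp (((∑ i, z i * Real.cos (φ i)) * t : ℝ) * Complex.I)) (torusMeasure N) :=
    Integrable.of_bound (Continuous.aestronglyMeasurable (by fun_prop)) 1
      (.of_forall fun φ => (Complex.norm_exp_ofReal_mul_I _).le)
  have h3 := congrArg Complex.re h1
  rw [Complex.ofReal_re] at h3
  rw [← h3, ← RCLike.re_eq_complex_re, ← integral_re hintegr]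
  refine integral_congr_ae (.of_forall fun φ => ?_)
  simp only [RCLike.re_eq_complex_re, Complex.exp_ofReal_mul_I_re]

/-- `|S|` is written as an integral of `(1 - cos (S t)) / t²` and the order of integration is
exchanged. The angles are independent, so the mean of the cosine is a product of Bessel functions.
Smoothness in `z` becomes a question of decay of this product in `t`. -/
lemma averagedAbs_fourier (z : Fin N → ℝ) :
    averagedAbs z * dirichletConst =
      ∫ t in Set.Ioi (0 : ℝ), (1 - ∏ i, bessel (z i * t)) / t ^ 2 := by
  set S : (Fin N → ℝ) → ℝ := fun φ => ∑ i, z i * Real.cos (φ i)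
  have hS : Continuous S := by fun_prop
  set M := ∑ i, |z i|
  have hM : ∀ φ, |S φ| ≤ M := fun φ => by
    refine (Finset.abs_sum_le_sum_abs _ _).trans (Finset.sum_le_sum fun i _ => ?_)
    rw [abs_mul]
    exact mul_le_of_le_one_right (abs_nonneg _) (Real.abs_cos_le_one _)
  have hprod : Integrable (Function.uncurry fun (φ : Fin N → ℝ) (t : ℝ) =>
      (1 - Real.cos (S φ * t)) / t ^ 2) ((torusMeasure N).prod (volume.restrict (Set.Ioi 0))) := by
    have hg : Integrable (fun x : (Fin N → ℝ) × ℝ => (M ^ 2 / 2 + 2) * (1 + x.2 ^ 2)⁻¹)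
        ((torusMeasure N).prod (volume.restrict (Set.Ioi 0))) :=
      ((integrable_inv_one_add_sq.restrict (s := Set.Ioi 0)).comp_snd (torusMeasure N)).const_mul _
    refine hg.mono' ?_ (.of_forall fun x => ?_)
    · have : Measurable fun x : (Fin N → ℝ) × ℝ => (1 - Real.cos (S x.1 * x.2)) / x.2 ^ 2 := by
        have := hS.measurable
        fun_prop
      exact this.aestronglyMeasurable
    · simp only [Function.uncurry]
      rw [Real.norm_eq_abs, abs_of_nonneg (one_sub_cos_div_sq_nonneg _ _)]
      refine (one_sub_cos_div_sq_le _ _).trans ?_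
      have : S x.1 ^ 2 ≤ M ^ 2 := sq_le_sq' (abs_le.1 (hM x.1)).1 (abs_le.1 (hM x.1)).2
      gcongr
  rw [averagedAbs_eq_integral, ← integral_mul_const]
  calc ∫ φ, |S φ| * dirichletConst ∂torusMeasure N
      = ∫ φ, (∫ t in Set.Ioi (0 : ℝ), (1 - Real.cos (S φ * t)) / t ^ 2) ∂torusMeasure N := by
        simp only [integral_one_sub_cos_div_sq]
    _ = ∫ t in Set.Ioi (0 : ℝ), (∫ φ, (1 - Real.cos (S φ * t)) / t ^ 2 ∂torusMeasure N) :=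
        integral_integral_swap hprod
    _ = _ := by
        refine integral_congr_ae (.of_forall fun t => ?_)
        simp only
        rw [integral_div, integral_sub (integrable_const _), integral_cos_sum]
        · simp
        · exact Integrable.of_bound (Continuous.aestronglyMeasurable (by fun_prop)) 1
            (.of_forall fun φ => Real.abs_cos_le_one _)

/-- The integrable weight dominating products of at least three Bessel factors. -/
lemma integrable_weight : Integrable (fun t : ℝ => (1 / √(1 + t)) ^ 3)
    (volume.restrict (Set.Ioi 0)) := by
  have h := (integrable_one_add_norm (E := ℝ) (μ := volume) (r := 3 / 2)
    (by simp; norm_num)).restrict (s := Set.Ioi 0)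
  refine h.congr ?_
  filter_upwards [ae_restrict_mem measurableSet_Ioi] with t ht
  have ht0 : 0 < 1 + t := by linarith [Set.mem_Ioi.1 ht]
  rw [Real.norm_eq_abs, abs_of_pos ht, Real.sqrt_eq_rpow, one_div, ← Real.rpow_neg ht0.le,
    ← Real.rpow_natCast, ← Real.rpow_mul ht0.le]
  norm_num

/-- Uniform bounds for the Bessel factors on a compact range of amplitudes. -/
lemma bessel_factor_bounds {m Z : ℝ} (hm : 0 < m) : ∃ A : ℝ, 1 ≤ A ∧ ∀ z, m ≤ z → z ≤ Z →
    ∀ t, 0 < t → |bessel (z * t)| ≤ A * (1 / √(1 + t)) ∧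
      |besselDeriv (z * t)| ≤ A * (1 / √(1 + t)) ∧
      |besselDeriv₂ (z * t)| ≤ A * (1 / √(1 + t)) ∧
      |t⁻¹ * besselDeriv (z * t)| ≤ A * (1 / √(1 + t)) := by
  -- The choice of `k` gives `1 + z t ≥ k (1 + t)` for `z ≥ m`, which converts decay in `z t` into
  -- decay in `t`.
  set k := min 1 m
  have hk : 0 < k := lt_min one_pos hm
  have hk1 : k ≤ 1 := min_le_left _ _
  have hkm : k ≤ m := min_le_right _ _
  set A₀ := 8 / √k
  have hA₀ : 1 ≤ A₀ := by
    have : √k ≤ 1 := Real.sqrt_le_one.2 hk1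
    rw [le_div_iff₀ (Real.sqrt_pos.2 hk)]
    linarith
  refine ⟨A₀ + 2 * |Z|, by linarith [abs_nonneg Z],
    fun z hz hzZ t ht => ?_⟩
  have hs : 0 < √(1 + t) := Real.sqrt_pos.2 (by linarith)
  have hw : 0 < 1 / √(1 + t) := by positivity
  have hzt : 0 ≤ z * t := by nlinarith
  have hdec : 8 / √(1 + z * t) ≤ A₀ * (1 / √(1 + t)) := by
    rw [div_mul_div_comm, mul_one, ← Real.sqrt_mul hk.le]
    gcongr
    nlinarith
  have hle : A₀ * (1 / √(1 + t)) ≤ (A₀ + 2 * |Z|) * (1 / √(1 + t)) := by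
    gcongr; linarith [abs_nonneg Z]
  obtain ⟨h0, h1, h2⟩ := bessel_decay hzt
  refine ⟨h0.trans (hdec.trans hle), h1.trans (hdec.trans hle), h2.trans (hdec.trans hle), ?_⟩
  rw [abs_mul, abs_inv, abs_of_pos ht]
  -- The factor `t⁻¹` is singular at zero, where it is absorbed by `|J₀'(s)| ≤ |s|`.
  rcases le_total t 1 with h | h
  · have h3 := abs_besselDeriv_le_abs (z * t)
    rw [abs_of_nonneg hzt] at h3
    have h4 : t⁻¹ * |besselDeriv (z * t)| ≤ z := by
      rw [← div_eq_inv_mul, div_le_iff₀ ht]; exact h3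
    have h5 : √(1 + t) ≤ 2 := by
      rw [Real.sqrt_le_left (by norm_num)]; linarith
    have h6 : z ≤ 2 * |Z| * (1 / √(1 + t)) := by
      rw [mul_one_div, le_div_iff₀ hs]
      have := le_abs_self Z
      nlinarith
    have : 0 ≤ A₀ * (1 / √(1 + t)) := by positivity
    linarith
  · have h3 : t⁻¹ ≤ 1 := inv_le_one_of_one_le₀ h
    have h4 : t⁻¹ * |besselDeriv (z * t)| ≤ 1 * |besselDeriv (z * t)| := by gcongr
    linarith

/-- Twice differentiability at a point. -/
def TwiceDifferentiableAt {E : Type*} [NormedAddCommGroup E] [NormedSpace ℝ E] (f : E → ℝ)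
    (z : E) : Prop :=
  (∀ᶠ y in 𝓝 z, DifferentiableAt ℝ f y) ∧ DifferentiableAt ℝ (fderiv ℝ f) z

/-- Coefficients of the derivative of the Fourier integrand of `averagedAbs`. -/
def fourierCoeff (i : Fin N) (z : Fin N → ℝ) (t : ℝ) : ℝ :=
  -(t⁻¹ * besselDeriv (z i * t)) * ∏ j ∈ Finset.univ.erase i, bessel (z j * t)

/-- Derivative of `fourierCoeff` with respect to the amplitudes. -/
def fourierCoeffDeriv (i : Fin N) (z : Fin N → ℝ) (t : ℝ) : (Fin N → ℝ) →L[ℝ] ℝ :=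
  (∑ j ∈ Finset.univ.erase i, (-(besselDeriv (z i * t) * besselDeriv (z j * t)) *
      ∏ l ∈ (Finset.univ.erase i).erase j, bessel (z l * t)) •
        (ContinuousLinearMap.proj j : (Fin N → ℝ) →L[ℝ] ℝ)) +
    (-(besselDeriv₂ (z i * t)) * ∏ j ∈ Finset.univ.erase i, bessel (z j * t)) •
      (ContinuousLinearMap.proj i : (Fin N → ℝ) →L[ℝ] ℝ)

lemma hasFDerivAt_comp_proj {f : ℝ → ℝ} {f' t : ℝ} {z : Fin N → ℝ} {i : Fin N}
    (h : HasDerivAt f f' (z i * t)) : HasFDerivAt (fun z : Fin N → ℝ => f (z i * t))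
      ((f' * t) • (ContinuousLinearMap.proj i : (Fin N → ℝ) →L[ℝ] ℝ)) z := by
  have h1 : HasFDerivAt (fun z : Fin N → ℝ => z i * t)
      (t • (ContinuousLinearMap.proj i : (Fin N → ℝ) →L[ℝ] ℝ)) z :=
    ((ContinuousLinearMap.proj i : (Fin N → ℝ) →L[ℝ] ℝ).hasFDerivAt).mul_const t
  have h2 := h.comp_hasFDerivAt z h1
  rw [smul_smul] at h2
  exact h2

lemma hasFDerivAt_fourier (z : Fin N → ℝ) {t : ℝ} (ht : 0 < t) :
    HasFDerivAt (fun z : Fin N → ℝ => (1 - ∏ i, bessel (z i * t)) / t ^ 2)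
      (∑ i, fourierCoeff i z t • (ContinuousLinearMap.proj i : (Fin N → ℝ) →L[ℝ] ℝ)) z := by
  have h := HasFDerivAt.finsetProd (u := Finset.univ) fun i (_ : i ∈ Finset.univ) =>
    hasFDerivAt_comp_proj (z := z) (i := i) (hasDerivAt_bessel (z i * t))
  have h2 := (h.const_sub 1).mul_const (t ^ 2)⁻¹
  simp only [← div_eq_mul_inv] at h2
  refine h2.congr_fderiv ?_
  rw [smul_neg, Finset.smul_sum, ← Finset.sum_neg_distrib]
  refine Finset.sum_congr rfl fun i _ => ?_
  rw [smul_smul, smul_smul, ← neg_smul, fourierCoeff]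
  congr 1
  field_simp

lemma hasFDerivAt_fourierCoeff (i : Fin N) (z : Fin N → ℝ) {t : ℝ} (ht : 0 < t) :
    HasFDerivAt (fun z => fourierCoeff i z t) (fourierCoeffDeriv i z t) z := by
  have h := HasFDerivAt.finsetProd (u := Finset.univ.erase i)
    fun j (_ : j ∈ Finset.univ.erase i) =>
      hasFDerivAt_comp_proj (z := z) (i := j) (hasDerivAt_bessel (z j * t))
  have h1 := ((hasFDerivAt_comp_proj (z := z) (i := i)
    (hasDerivAt_besselDeriv (z i * t))).const_mul t⁻¹).neg
  refine (h1.mul h).congr_fderiv ?_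
  rw [fourierCoeffDeriv, Finset.smul_sum]
  congr 1
  · refine Finset.sum_congr rfl fun j _ => ?_
    rw [smul_smul, smul_smul]
    congr 1
    simp only [Pi.neg_apply]
    field_simp
  · rw [smul_smul, smul_neg, smul_smul, ← neg_smul]
    congr 1
    rw [show t⁻¹ * (besselDeriv₂ (z i * t) * t) = besselDeriv₂ (z i * t) by field_simp]
    ring

lemma norm_proj_le (i : Fin N) : ‖(ContinuousLinearMap.proj i : (Fin N → ℝ) →L[ℝ] ℝ)‖ ≤ 1 :=
  ContinuousLinearMap.opNorm_le_bound _ zero_le_one fun z => by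
    simpa using norm_le_pi_norm z i

lemma measurable_fourierCoeff (i : Fin N) (z : Fin N → ℝ) : Measurable (fourierCoeff i z) := by
  unfold fourierCoeff
  have h0 := continuous_bessel
  have h1 := continuous_besselDeriv
  have h2 : Measurable fun t => ∏ j ∈ Finset.univ.erase i, bessel (z j * t) :=
    Continuous.measurable (by fun_prop)
  have h3 : Measurable fun t => besselDeriv (z i * t) := Continuous.measurable (by fun_prop)
  exact ((measurable_inv.mul h3).neg).mul h2

lemma continuous_fourierCoeffDeriv (i : Fin N) (z : Fin N → ℝ) :
    Continuous (fourierCoeffDeriv i z) := by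
  unfold fourierCoeffDeriv
  have h0 := continuous_bessel
  have h1 := continuous_besselDeriv
  have h2 := continuous_besselDeriv₂
  fun_prop

/-- For at least three oscillators `averagedAbs` is twice differentiable at points with positive
amplitudes. -/
lemma twiceDifferentiableAt_averagedAbs_of_three_le (hN : 3 ≤ N) {z₀ : Fin N → ℝ}
    (hz₀ : ∀ i, 0 < z₀ i) : TwiceDifferentiableAt (averagedAbs (N := N)) z₀ := by
  obtain ⟨m, hm, hmz⟩ : ∃ m > 0, ∀ i, m < z₀ i := by
    obtain ⟨k, -, hk⟩ := Finset.exists_min_image (Finset.univ : Finset (Fin N)) z₀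
      ⟨⟨0, by omega⟩, Finset.mem_univ _⟩
    exact ⟨z₀ k / 2, by linarith [hz₀ k], fun i => by linarith [hz₀ k, hk i (Finset.mem_univ i)]⟩
  obtain ⟨Z, hZ⟩ : ∃ Z, ∀ i, z₀ i < Z :=
    ⟨∑ j, z₀ j + 1, fun i => by
      linarith [Finset.single_le_sum (fun j _ => (hz₀ j).le) (Finset.mem_univ i)]⟩
  obtain ⟨A, hA, hbd⟩ := bessel_factor_bounds (Z := Z) hm
  set s : Set (Fin N → ℝ) := Set.pi Set.univ fun _ => Set.Ioo m Z
  have hs : IsOpen s := isOpen_set_pi Set.finite_univ fun _ _ => isOpen_Ioo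
  have hz₀s : z₀ ∈ s := fun i _ => ⟨hmz i, hZ i⟩
  set q : ℝ → ℝ := fun t => A * (1 / √(1 + t))
  have hw : ∀ t, 0 < t → 0 < 1 / √(1 + t) ∧ 1 / √(1 + t) ≤ 1 := fun t ht => by
    have h1 : 1 ≤ √(1 + t) := Real.one_le_sqrt.2 (by linarith)
    exact ⟨by positivity, by rw [div_le_one (by linarith)]; exact h1⟩
  have hq : ∀ t, 0 < t → 0 ≤ q t := fun t ht => mul_nonneg (by linarith) (hw t ht).1.le
  have hb0 : ∀ z ∈ s, ∀ i t, 0 < t → |bessel (z i * t)| ≤ q t := fun z hz i t ht =>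
    (hbd (z i) (hz i trivial).1.le (hz i trivial).2.le t ht).1
  have hb1 : ∀ z ∈ s, ∀ i t, 0 < t → |besselDeriv (z i * t)| ≤ q t := fun z hz i t ht =>
    (hbd (z i) (hz i trivial).1.le (hz i trivial).2.le t ht).2.1
  have hb2 : ∀ z ∈ s, ∀ i t, 0 < t → |besselDeriv₂ (z i * t)| ≤ q t := fun z hz i t ht =>
    (hbd (z i) (hz i trivial).1.le (hz i trivial).2.le t ht).2.2.1
  have hb3 : ∀ z ∈ s, ∀ i t, 0 < t → |t⁻¹ * besselDeriv (z i * t)| ≤ q t := fun z hz i t ht =>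
    (hbd (z i) (hz i trivial).1.le (hz i trivial).2.le t ht).2.2.2
  have hprod : ∀ z ∈ s, ∀ (u : Finset (Fin N)) t, 0 < t →
      |∏ j ∈ u, bessel (z j * t)| ≤ q t ^ u.card := fun z hz u t ht => by
    rw [Finset.abs_prod]
    calc _ ≤ ∏ _j ∈ u, q t := Finset.prod_le_prod (fun j _ => abs_nonneg _)
          fun j _ => hb0 z hz j t ht
      _ = q t ^ u.card := Finset.prod_const _
  -- Every derivative of the integrand up to second order keeps `N` factors of order `(1 +
  -- t)^(-1/2)`. With `N ≥ 3` they are dominated by the integrable `(1 + t)^(-3/2)`, uniformly for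
  -- amplitudes near `z₀`.
  have hqN : ∀ t, 0 < t → q t ^ N ≤ A ^ N * (1 / √(1 + t)) ^ 3 := fun t ht => by
    rw [mul_pow]
    gcongr ?_ * ?_
    exact pow_le_pow_of_le_one (hw t ht).1.le (hw t ht).2 hN
  have hcard : ∀ i : Fin N, (Finset.univ.erase i).card = N - 1 := fun i => by
    rw [Finset.card_erase_of_mem (Finset.mem_univ i), Finset.card_univ, Fintype.card_fin]
  have hc : ∀ z ∈ s, ∀ i t, 0 < t → |fourierCoeff i z t| ≤ A ^ N * (1 / √(1 + t)) ^ 3 := by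
    intro z hz i t ht
    refine le_trans ?_ (hqN t ht)
    rw [fourierCoeff, abs_mul, abs_neg]
    calc _ ≤ q t * q t ^ (Finset.univ.erase i).card :=
          mul_le_mul (hb3 z hz i t ht) (hprod z hz _ t ht) (abs_nonneg _) (hq t ht)
      _ = q t ^ N := by rw [hcard, ← pow_succ']; congr 1; omega
  have hd : ∀ z ∈ s, ∀ i t, 0 < t →
      ‖fourierCoeffDeriv i z t‖ ≤ (N + 1) * (A ^ N * (1 / √(1 + t)) ^ 3) := by
    intro z hz i t ht
    have hq' := hq t ht
    have h1 : ‖fourierCoeffDeriv i z t‖ ≤ (N - 1 : ℕ) * q t ^ N + q t ^ N := by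
      rw [fourierCoeffDeriv]
      refine (norm_add_le _ _).trans (add_le_add ?_ ?_)
      · refine (norm_sum_le _ _).trans ?_
        rw [← hcard i, ← nsmul_eq_mul]
        refine Finset.sum_le_card_nsmul _ _ _ fun j hj => ?_
        rw [norm_smul, Real.norm_eq_abs, abs_mul, abs_neg, abs_mul]
        have hcj : ((Finset.univ.erase i).erase j).card = N - 2 := by
          rw [Finset.card_erase_of_mem hj, hcard]; omega
        calc _ ≤ q t * q t * q t ^ ((Finset.univ.erase i).erase j).card * 1 :=
              mul_le_mul (mul_le_mul (mul_le_mul (hb1 z hz i t ht) (hb1 z hz j t ht)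
                (abs_nonneg _) hq') (hprod z hz _ t ht) (abs_nonneg _) (by positivity))
                (norm_proj_le j) (norm_nonneg _) (by positivity)
          _ = q t ^ N := by
              rw [hcj, mul_one, ← pow_two, ← pow_add]; congr 1; omega
      · rw [norm_smul, Real.norm_eq_abs, abs_mul, abs_neg]
        calc _ ≤ q t * q t ^ (Finset.univ.erase i).card * 1 :=
              mul_le_mul (mul_le_mul (hb2 z hz i t ht) (hprod z hz _ t ht) (abs_nonneg _) hq')
                (norm_proj_le i) (norm_nonneg _) (by positivity)
          _ = q t ^ N := by rw [hcard, mul_one, ← pow_succ']; congr 1; omega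
    have h2 : (((N - 1 : ℕ) : ℝ)) ≤ N := by exact_mod_cast Nat.sub_le N 1
    calc _ ≤ (N - 1 : ℕ) * q t ^ N + q t ^ N := h1
      _ ≤ (N : ℝ) * q t ^ N + q t ^ N := by gcongr
      _ = (N + 1) * q t ^ N := by ring
      _ ≤ _ := by gcongr; exact hqN t ht
  have hwint := integrable_weight
  have hposae : ∀ᵐ t ∂(volume.restrict (Set.Ioi (0 : ℝ))), 0 < t :=
    ae_restrict_mem measurableSet_Ioi
  have hcint : ∀ z ∈ s, ∀ i, Integrable (fourierCoeff i z) (volume.restrict (Set.Ioi 0)) := by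
    intro z hz i
    refine Integrable.mono' (hwint.const_mul (A ^ N))
      (measurable_fourierCoeff i z).aestronglyMeasurable ?_
    filter_upwards [hposae] with t ht
    exact hc z hz i t ht
  set h : Fin N → (Fin N → ℝ) → ℝ := fun i z => ∫ t in Set.Ioi (0 : ℝ), fourierCoeff i z t
  have hFint : ∀ z : Fin N → ℝ, AEStronglyMeasurable
      (fun t => (1 - ∏ i, bessel (z i * t)) / t ^ 2) (volume.restrict (Set.Ioi 0)) := fun z => by
    have h0 := continuous_bessel
    have h1 : Measurable fun t => ∏ i, bessel (z i * t) := Continuous.measurable (by fun_prop)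
    exact ((measurable_const.sub h1).div (measurable_id.pow_const 2)).aestronglyMeasurable
  have hIntF : ∀ z : Fin N → ℝ, Integrable
      (fun t => (1 - ∏ i, bessel (z i * t)) / t ^ 2) (volume.restrict (Set.Ioi 0)) := fun z => by
    set M := ∑ i, |z i|
    refine Integrable.mono' ((integrable_inv_one_add_sq.const_mul (M ^ 2 / 2 + 2)).restrict
      (s := Set.Ioi 0)) (hFint z) (.of_forall fun t => ?_)
    have hS : ∀ φ : Fin N → ℝ, |∑ i, z i * Real.cos (φ i)| ≤ M := fun φ => by
      refine (Finset.abs_sum_le_sum_abs _ _).trans (Finset.sum_le_sum fun i _ => ?_)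
      rw [abs_mul]
      exact mul_le_of_le_one_right (abs_nonneg _) (Real.abs_cos_le_one _)
    have hi : Integrable (fun φ : Fin N → ℝ => Real.cos ((∑ i, z i * Real.cos (φ i)) * t))
        (torusMeasure N) :=
      Integrable.of_bound (Continuous.aestronglyMeasurable (by fun_prop)) 1
        (.of_forall fun φ => Real.abs_cos_le_one _)
    -- Read as a mean over the torus, the integrand inherits the bound for `(1 - cos (S t)) / t²`,
    -- including near `t = 0`.
    have e : (1 - ∏ i, bessel (z i * t)) / t ^ 2 =
        ∫ φ, (1 - Real.cos ((∑ i, z i * Real.cos (φ i)) * t)) / t ^ 2 ∂torusMeasure N := by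
      rw [integral_div, integral_sub (integrable_const _) hi, integral_cos_sum]
      simp
    rw [e]
    have hb := norm_integral_le_of_norm_le_const (μ := torusMeasure N)
      (f := fun φ => (1 - Real.cos ((∑ i, z i * Real.cos (φ i)) * t)) / t ^ 2)
      (C := (M ^ 2 / 2 + 2) * (1 + t ^ 2)⁻¹) (.of_forall fun φ => ?_)
    · simpa using hb
    · rw [Real.norm_eq_abs, abs_of_nonneg (one_sub_cos_div_sq_nonneg _ _)]
      refine (one_sub_cos_div_sq_le _ _).trans ?_
      have : (∑ i, z i * Real.cos (φ i)) ^ 2 ≤ M ^ 2 :=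
        sq_le_sq' (abs_le.1 (hS φ)).1 (abs_le.1 (hS φ)).2
      gcongr
  have hfirst : ∀ z ∈ s, HasFDerivAt (averagedAbs (N := N))
      (dirichletConst⁻¹ • ∑ i, h i z • (ContinuousLinearMap.proj i : (Fin N → ℝ) →L[ℝ] ℝ)) z := by
    intro z hz
    have hmeas : AEStronglyMeasurable (fun t => ∑ i, fourierCoeff i z t •
        (ContinuousLinearMap.proj i : (Fin N → ℝ) →L[ℝ] ℝ)) (volume.restrict (Set.Ioi 0)) :=
      Finset.aestronglyMeasurable_fun_sum _ fun i _ =>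
        (measurable_fourierCoeff i z).aestronglyMeasurable.smul_const _
    have key := hasFDerivAt_integral_of_dominated_of_fderiv_le (𝕜 := ℝ)
      (μ := volume.restrict (Set.Ioi (0 : ℝ))) (x₀ := z) (s := s)
      (F := fun (z : Fin N → ℝ) t => (1 - ∏ i, bessel (z i * t)) / t ^ 2)
      (F' := fun z t => ∑ i, fourierCoeff i z t •
        (ContinuousLinearMap.proj i : (Fin N → ℝ) →L[ℝ] ℝ))
      (bound := fun t => N * (A ^ N * (1 / √(1 + t)) ^ 3))
      (hs.mem_nhds hz) (.of_forall fun y => hFint y) (hIntF z) hmeas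
      (by
        filter_upwards [hposae] with t ht y hy
        refine (norm_sum_le _ _).trans ?_
        have : ∀ i ∈ (Finset.univ : Finset (Fin N)), ‖fourierCoeff i y t •
            (ContinuousLinearMap.proj i : (Fin N → ℝ) →L[ℝ] ℝ)‖ ≤
            A ^ N * (1 / √(1 + t)) ^ 3 := fun i _ => by
          rw [norm_smul, Real.norm_eq_abs]
          exact (mul_le_of_le_one_right (abs_nonneg _) (norm_proj_le i)).trans (hc y hy i t ht)
        refine (Finset.sum_le_card_nsmul _ _ _ this).trans_eq ?_
        simp)
      ((hwint.const_mul _).const_mul _)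
      (by
        filter_upwards [hposae] with t ht y _
        exact hasFDerivAt_fourier y ht)
    have hval : ∫ t in Set.Ioi (0 : ℝ), ∑ i, fourierCoeff i z t •
        (ContinuousLinearMap.proj i : (Fin N → ℝ) →L[ℝ] ℝ) =
        ∑ i, h i z • (ContinuousLinearMap.proj i : (Fin N → ℝ) →L[ℝ] ℝ) := by
      rw [integral_finsetSum _ fun i _ => (hcint z hz i).smul_const _]
      refine Finset.sum_congr rfl fun i _ => ?_
      rw [integral_smul_const]
    rw [hval] at key
    have hfun : (averagedAbs (N := N)) = fun z => dirichletConst⁻¹ •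
        ∫ t in Set.Ioi (0 : ℝ), (1 - ∏ i, bessel (z i * t)) / t ^ 2 := funext fun z => by
      rw [← averagedAbs_fourier, smul_eq_mul]
      have := dirichletConst_pos.ne'
      field_simp
    rw [hfun]
    exact key.fun_const_smul _
  have hsecond : ∀ i, DifferentiableAt ℝ (h i) z₀ := fun i => by
    have key := hasFDerivAt_integral_of_dominated_of_fderiv_le (𝕜 := ℝ)
      (μ := volume.restrict (Set.Ioi (0 : ℝ))) (x₀ := z₀) (s := s)
      (F := fun (z : Fin N → ℝ) t => fourierCoeff i z t)
      (F' := fun z t => fourierCoeffDeriv i z t)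
      (bound := fun t => (N + 1) * (A ^ N * (1 / √(1 + t)) ^ 3))
      (hs.mem_nhds hz₀s)
      (.of_forall fun y => (measurable_fourierCoeff i y).aestronglyMeasurable)
      (hcint z₀ hz₀s i) (continuous_fourierCoeffDeriv i z₀).aestronglyMeasurable
      (by
        filter_upwards [hposae] with t ht y hy
        exact hd y hy i t ht)
      ((hwint.const_mul _).const_mul _)
      (by
        filter_upwards [hposae] with t ht y _
        exact hasFDerivAt_fourierCoeff i y ht)
    exact key.differentiableAt
  have hev : ∀ᶠ y in 𝓝 z₀, y ∈ s := hs.mem_nhds hz₀s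
  refine ⟨hev.mono fun y hy => (hfirst y hy).differentiableAt, ?_⟩
  have hdiff : DifferentiableAt ℝ (fun z => dirichletConst⁻¹ •
      ∑ i, h i z • (ContinuousLinearMap.proj i : (Fin N → ℝ) →L[ℝ] ℝ)) z₀ :=
    (DifferentiableAt.fun_sum fun i _ => (hsecond i).smul_const _).fun_const_smul _
  exact hdiff.congr_of_eventuallyEq (hev.mono fun y hy => (hfirst y hy).fderiv)

/-! ### Twice differentiability of the support function; one and two oscillators -/

section TwiceDifferentiable

variable {E F : Type*} [NormedAddCommGroup E] [NormedSpace ℝ E]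
  [NormedAddCommGroup F] [NormedSpace ℝ F]

lemma TwiceDifferentiableAt.congr {f g : E → ℝ} {x : E} (hg : TwiceDifferentiableAt g x)
    (h : f =ᶠ[𝓝 x] g) : TwiceDifferentiableAt f x := by
  refine ⟨?_, hg.2.congr_of_eventuallyEq h.fderiv⟩
  filter_upwards [hg.1, h.eventuallyEq_nhds] with y hy hfy
  exact hy.congr_of_eventuallyEq hfy

lemma twiceDifferentiableAt_of_contDiffAt {f : E → ℝ} {x : E} (hf : ContDiffAt ℝ 2 f x) :
    TwiceDifferentiableAt f x := by
  refine ⟨?_, (hf.fderiv_right (m := 1) (by norm_num)).differentiableAt (by norm_num)⟩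
  filter_upwards [hf.eventually (by simp)] with y hy
  exact hy.differentiableAt (by norm_num)

lemma TwiceDifferentiableAt.comp {f : F → ℝ} {g : E → F} {x : E}
    (hf : TwiceDifferentiableAt f (g x)) (hg : ContDiffAt ℝ 2 g x) :
    TwiceDifferentiableAt (fun y => f (g y)) x := by
  have hgd : ∀ᶠ y in 𝓝 x, DifferentiableAt ℝ g y := by
    filter_upwards [hg.eventually (by simp)] with y hy
    exact hy.differentiableAt (by norm_num)
  have hfd : ∀ᶠ y in 𝓝 x, DifferentiableAt ℝ f (g y) := hg.continuousAt.eventually hf.1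
  refine ⟨(hgd.and hfd).mono fun y hy => hy.2.comp y hy.1, ?_⟩
  have h1 : DifferentiableAt ℝ (fun y => fderiv ℝ f (g y)) x :=
    hf.2.comp x (hg.differentiableAt (by norm_num))
  have h2 : DifferentiableAt ℝ (fderiv ℝ g) x :=
    (hg.fderiv_right (m := 1) (by norm_num)).differentiableAt (by norm_num)
  refine (h1.clm_comp h2).congr_of_eventuallyEq ((hgd.and hfd).mono fun y hy => ?_)
  exact fderiv_comp y hy.2 hy.1

lemma TwiceDifferentiableAt.mul {f g : E → ℝ} {x : E} (hf : TwiceDifferentiableAt f x)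
    (hg : TwiceDifferentiableAt g x) : TwiceDifferentiableAt (fun y => f y * g y) x := by
  refine ⟨(hf.1.and hg.1).mono fun y hy => hy.1.mul hy.2, ?_⟩
  have hfx := hf.1.self_of_nhds
  have hgx := hg.1.self_of_nhds
  refine ((hfx.fun_smul hg.2).add (hgx.fun_smul hf.2)).congr_of_eventuallyEq
    ((hf.1.and hg.1).mono fun y hy => ?_)
  exact fderiv_fun_mul hy.1 hy.2

lemma twiceDifferentiableAt_of_hasDerivAt {f f' : ℝ → ℝ} {x : ℝ}
    (h : ∀ᶠ y in 𝓝 x, HasDerivAt f (f' y) y) (h' : DifferentiableAt ℝ f' x) :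
    TwiceDifferentiableAt f x := by
  refine ⟨h.mono fun y hy => hy.differentiableAt, ?_⟩
  refine (h'.smul_const (1 : ℝ →L[ℝ] ℝ)).congr_of_eventuallyEq (h.mono fun y hy => ?_)
  rw [hy.hasFDerivAt.fderiv]
  ext; simp

end TwiceDifferentiable

lemma averagedAbs_smul (c : ℝ) (z : Fin N → ℝ) :
    averagedAbs (c • z) = |c| * averagedAbs z := by
  rw [averagedAbs_eq_integral, averagedAbs_eq_integral, ← integral_const_mul]
  refine integral_congr_ae (.of_forall fun φ => ?_)
  simp only [Pi.smul_apply, smul_eq_mul, mul_assoc, ← Finset.mul_sum, abs_mul]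

/-- By homogeneity the function is linear for positive amplitude. -/
lemma twiceDifferentiableAt_averagedAbs_one {z₀ : Fin 1 → ℝ} (hz₀ : ∀ i, 0 < z₀ i) :
    TwiceDifferentiableAt (averagedAbs (N := 1)) z₀ := by
  have hg : TwiceDifferentiableAt (fun z : Fin 1 → ℝ => z 0 * averagedAbs (fun _ : Fin 1 => 1))
      z₀ := twiceDifferentiableAt_of_contDiffAt (by fun_prop)
  refine hg.congr ?_
  have hev : ∀ᶠ z : Fin 1 → ℝ in 𝓝 z₀, 0 < z 0 :=
    (continuous_apply 0).continuousAt.eventually (lt_mem_nhds (hz₀ 0))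
  filter_upwards [hev] with z hz
  have : z = z 0 • fun _ : Fin 1 => (1 : ℝ) := by
    ext i; fin_cases i; simp
  conv_lhs => rw [this]
  rw [averagedAbs_smul, abs_of_pos hz]

/-- Mean of `|cos θ + u|`. -/
def meanAbsCos (u : ℝ) : ℝ := 2 / Real.pi * (√(1 - u ^ 2) + u * Real.arcsin u)

lemma integral_abs_cos_add {u : ℝ} (hu : |u| ≤ 1) :
    ∫ θ, |Real.cos θ + u| ∂angleMeasure = meanAbsCos u := by
  obtain ⟨hu1, hu2⟩ := abs_le.1 hu
  -- `β` is the zero of `cos θ + u` in `[0, π]`. The function is nonnegative on `[0, β]` and `[2π -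
  -- β, 2π]` and nonpositive in between.
  set β := Real.pi / 2 + Real.arcsin u
  have hβ : β = Real.arccos (-u) := by
    rw [Real.arccos, Real.arcsin_neg]; simp only [β]; ring
  have hβ0 : 0 ≤ β := hβ ▸ Real.arccos_nonneg _
  have hβπ : β ≤ Real.pi := hβ ▸ Real.arccos_le_pi _
  have hcβ : Real.cos β = -u := by rw [hβ, Real.cos_arccos (by linarith) (by linarith)]
  have hsβ : Real.sin β = √(1 - u ^ 2) := by rw [hβ, Real.sin_arccos, neg_sq]
  have hrefl : ∀ θ, Real.cos θ = Real.cos (2 * Real.pi - θ) := fun θ =>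
    (Real.cos_two_pi_sub θ).symm
  have hcont : ∀ a b, IntervalIntegrable (fun θ => |Real.cos θ + u|) volume a b := fun a b =>
    Continuous.intervalIntegrable (by fun_prop) _ _
  have hprim : ∀ a b, ∫ θ in a..b, (Real.cos θ + u) =
      Real.sin b - Real.sin a + (b - a) * u := fun a b => by
    rw [intervalIntegral.integral_add (Continuous.intervalIntegrable (by fun_prop) _ _)
      (Continuous.intervalIntegrable (by fun_prop) _ _)]
    simp
  have I1 : ∫ θ in (0 : ℝ)..β, |Real.cos θ + u| = Real.sin β + β * u := by
    rw [intervalIntegral.integral_congr (g := fun θ => Real.cos θ + u), hprim]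
    · simp
    · intro θ hθ
      rw [Set.uIcc_of_le hβ0] at hθ
      have := Real.cos_le_cos_of_nonneg_of_le_pi hθ.1 hβπ hθ.2
      exact abs_of_nonneg (by linarith)
  have I2 : ∫ θ in β..(2 * Real.pi - β), |Real.cos θ + u| =
      2 * Real.sin β - (2 * Real.pi - 2 * β) * u := by
    rw [intervalIntegral.integral_congr (g := fun θ => -(Real.cos θ + u)),
      intervalIntegral.integral_neg, hprim, Real.sin_two_pi_sub]
    · ring
    · intro θ hθ
      rw [Set.uIcc_of_le (by linarith)] at hθ
      have : Real.cos θ ≤ Real.cos β := by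
        rcases le_total θ Real.pi with h | h
        · exact Real.cos_le_cos_of_nonneg_of_le_pi hβ0 h hθ.1
        · rw [hrefl θ]
          exact Real.cos_le_cos_of_nonneg_of_le_pi hβ0 (by linarith) (by linarith [hθ.2])
      exact abs_of_nonpos (by linarith)
  have I3 : ∫ θ in (2 * Real.pi - β)..(2 * Real.pi), |Real.cos θ + u| = Real.sin β + β * u := by
    rw [intervalIntegral.integral_congr (g := fun θ => Real.cos θ + u), hprim,
      Real.sin_two_pi_sub, Real.sin_two_pi]
    · ring
    · intro θ hθ
      rw [Set.uIcc_of_le (by linarith)] at hθ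
      have : Real.cos β ≤ Real.cos θ := by
        rw [hrefl θ]
        exact Real.cos_le_cos_of_nonneg_of_le_pi (by linarith [hθ.2]) hβπ (by linarith [hθ.1])
      exact abs_of_nonneg (by linarith)
  rw [integral_angleMeasure, smul_eq_mul, ← intervalIntegral.integral_add_adjacent_intervals
    (hcont 0 β) (hcont β (2 * Real.pi)), ← intervalIntegral.integral_add_adjacent_intervals
    (hcont β (2 * Real.pi - β)) (hcont (2 * Real.pi - β) (2 * Real.pi)), I1, I2, I3, hsβ,
    meanAbsCos]
  simp only [β]
  have := Real.pi_ne_zero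
  field_simp
  ring

lemma hasDerivAt_meanAbsCos {u : ℝ} (hu : |u| < 1) :
    HasDerivAt meanAbsCos (2 / Real.pi * Real.arcsin u) u := by
  obtain ⟨hu1, hu2⟩ := abs_lt.1 hu
  have hpos : 0 < 1 - u ^ 2 := by nlinarith
  have h1 : HasDerivAt (fun u : ℝ => √(1 - u ^ 2)) (-(2 * u) / (2 * √(1 - u ^ 2))) u := by
    have : HasDerivAt (fun u : ℝ => 1 - u ^ 2) (-(2 * u)) u := by
      simpa using (hasDerivAt_pow 2 u).const_sub 1
    exact this.sqrt hpos.ne'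
  have h2 := (hasDerivAt_id u).fun_mul (Real.hasDerivAt_arcsin hu1.ne' hu2.ne)
  refine ((h1.fun_add h2).const_mul (2 / Real.pi)).congr_deriv ?_
  have : √(1 - u ^ 2) ≠ 0 := (Real.sqrt_pos.2 hpos).ne'
  simp only [id]
  field_simp
  ring

/-- Mean of `|cos φ + k cos θ|` over both angles, as a function of `k`. -/
def pairMean (k : ℝ) : ℝ := ∫ θ, meanAbsCos (k * Real.cos θ) ∂angleMeasure

lemma abs_mul_cos_lt {k r θ : ℝ} (hk : |k| < r) : |k * Real.cos θ| < r := by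
  rw [abs_mul]
  exact (mul_le_of_le_one_right (abs_nonneg _) (Real.abs_cos_le_one _)).trans_lt hk

lemma abs_arcsin_le (x : ℝ) : |Real.arcsin x| ≤ Real.pi / 2 :=
  abs_le.2 ⟨Real.neg_pi_div_two_le_arcsin x, Real.arcsin_le_pi_div_two x⟩

/-- For `|k| < 1` the argument `k cos θ` stays away from `±1`, where the derivative of the arcsine
is unbounded. This is why two oscillators are required to have distinct amplitudes. -/
lemma twiceDifferentiableAt_pairMean {k₀ : ℝ} (hk₀ : |k₀| < 1) :
    TwiceDifferentiableAt pairMean k₀ := by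
  obtain ⟨r, hkr, hr1⟩ := exists_between hk₀
  have hr0 : 0 < r := (abs_nonneg _).trans_lt hkr
  have hopen : IsOpen {k : ℝ | |k| < r} := isOpen_lt continuous_abs continuous_const
  have hcm : Continuous meanAbsCos := by unfold meanAbsCos; fun_prop
  refine twiceDifferentiableAt_of_hasDerivAt (f' := fun k =>
    ∫ θ, 2 / Real.pi * Real.arcsin (k * Real.cos θ) * Real.cos θ ∂angleMeasure) ?_ ?_
  · filter_upwards [hopen.mem_nhds hkr] with k hk
    refine (hasDerivAt_integral_of_dominated_loc_of_deriv_le (μ := angleMeasure)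
      (s := {k : ℝ | |k| < r}) (bound := fun _ => 1) (F := fun k θ => meanAbsCos (k * Real.cos θ))
      (F' := fun k θ => 2 / Real.pi * Real.arcsin (k * Real.cos θ) * Real.cos θ)
      (hopen.mem_nhds hk) (.of_forall fun x => ?_) ?_ ?_ (.of_forall fun θ x _ => ?_)
      (integrable_const _) (.of_forall fun θ x hx => ?_)).2
    · exact Continuous.aestronglyMeasurable (by fun_prop)
    · refine integrable_angle (C := 2 / Real.pi * (1 + Real.pi / 2)) (by fun_prop) fun θ => ?_
      have h1 := (abs_mul_cos_lt (θ := θ) hk).trans hr1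
      rw [meanAbsCos, abs_mul, abs_of_pos (by positivity : (0 : ℝ) < 2 / Real.pi)]
      gcongr
      refine (abs_add_le _ _).trans (add_le_add ?_ ?_)
      · rw [abs_of_nonneg (Real.sqrt_nonneg _)]
        exact Real.sqrt_le_one.2 (by nlinarith [sq_nonneg (k * Real.cos θ)])
      · rw [abs_mul]
        calc _ ≤ 1 * (Real.pi / 2) := mul_le_mul h1.le (abs_arcsin_le _) (abs_nonneg _) zero_le_one
          _ = _ := one_mul _
    · exact Continuous.aestronglyMeasurable (by fun_prop)
    · rw [Real.norm_eq_abs, abs_mul, abs_mul, abs_of_pos (by positivity : (0 : ℝ) < 2 / Real.pi)]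
      calc _ ≤ 2 / Real.pi * (Real.pi / 2) * 1 := by
            gcongr
            · exact abs_arcsin_le _
            · exact Real.abs_cos_le_one _
        _ = 1 := by field_simp
    · have h := (hasDerivAt_meanAbsCos ((abs_mul_cos_lt (θ := θ) hx).trans hr1)).comp x
        ((hasDerivAt_id x).mul_const (Real.cos θ))
      convert! h using 1
      simp
  · have hr2 : 0 < 1 - r ^ 2 := by nlinarith
    refine (hasDerivAt_integral_of_dominated_loc_of_deriv_le (μ := angleMeasure)
      (s := {k : ℝ | |k| < r}) (bound := fun _ => 2 / Real.pi * (1 / √(1 - r ^ 2)))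
      (F := fun k θ => 2 / Real.pi * Real.arcsin (k * Real.cos θ) * Real.cos θ)
      (F' := fun k θ => 2 / Real.pi * (1 / √(1 - (k * Real.cos θ) ^ 2) * Real.cos θ) * Real.cos θ)
      (hopen.mem_nhds hkr) (.of_forall fun x => ?_) ?_ ?_ (.of_forall fun θ x hx => ?_)
      (integrable_const _) (.of_forall fun θ x hx => ?_)).2.differentiableAt
    · exact Continuous.aestronglyMeasurable (by fun_prop)
    · refine integrable_angle (C := 1) (by fun_prop) fun θ => ?_
      rw [abs_mul, abs_mul, abs_of_pos (by positivity : (0 : ℝ) < 2 / Real.pi)]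
      calc _ ≤ 2 / Real.pi * (Real.pi / 2) * 1 := by
            gcongr
            · exact abs_arcsin_le _
            · exact Real.abs_cos_le_one _
        _ = 1 := by field_simp
    · have : Measurable fun θ : ℝ =>
          2 / Real.pi * (1 / √(1 - (k₀ * Real.cos θ) ^ 2) * Real.cos θ) * Real.cos θ := by
        fun_prop
      exact this.aestronglyMeasurable
    · have h1 := abs_mul_cos_lt (θ := θ) (show |x| < r from hx)
      have h2 : (x * Real.cos θ) ^ 2 ≤ r ^ 2 := sq_le_sq' (by linarith [(abs_lt.1 h1).1])
        (abs_lt.1 h1).2.le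
      have hs : 0 < √(1 - r ^ 2) := Real.sqrt_pos.2 hr2
      have h3 : 1 / √(1 - (x * Real.cos θ) ^ 2) ≤ 1 / √(1 - r ^ 2) := by gcongr
      have h4 : 0 ≤ 1 / √(1 - (x * Real.cos θ) ^ 2) := by positivity
      rw [Real.norm_eq_abs, abs_mul, abs_mul, abs_mul, abs_of_nonneg h4,
        abs_of_pos (by positivity : (0 : ℝ) < 2 / Real.pi)]
      have hc := Real.abs_cos_le_one θ
      calc _ ≤ 2 / Real.pi * (1 / √(1 - r ^ 2) * 1) * 1 := by gcongr
        _ = _ := by ring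
    · have h1 := abs_lt.1 ((abs_mul_cos_lt (θ := θ) (show |x| < r from hx)).trans hr1)
      have h := (((Real.hasDerivAt_arcsin h1.1.ne' h1.2.ne).comp x
        ((hasDerivAt_id x).mul_const (Real.cos θ))).const_mul (2 / Real.pi)).mul_const (Real.cos θ)
      simpa using h

/-- Dividing by the larger amplitude and averaging over its angle first reduces two amplitudes to
their ratio. -/
lemma averagedAbs_two {z : Fin 2 → ℝ} {i j : Fin 2} (hij : i ≠ j) (hi : 0 < z i)
    (hj : |z j| ≤ z i) : averagedAbs z = z i * pairMean (z j / z i) := by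
  have hpres := measurePreserving_update (N := 2) i
  have hsum : ∀ (φ : Fin 2 → ℝ) (θ : ℝ), ∑ l, z l * Real.cos (Function.update φ i θ l) =
      z i * Real.cos θ + z j * Real.cos (φ j) := by
    intro φ θ
    rw [← Finset.add_sum_erase _ _ (Finset.mem_univ i), Function.update_self]
    congr 1
    have : (Finset.univ : Finset (Fin 2)).erase i = {j} := by
      have h : ∀ a b : Fin 2, a ≠ b → Finset.univ.erase a = {b} := by decide
      exact h i j hij
    rw [this, Finset.sum_singleton, Function.update_of_ne hij.symm]
  have hintegr : Integrable (fun x : (Fin 2 → ℝ) × ℝ => |z i * Real.cos x.2 + z j * Real.cos (x.1 j)|)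
      ((torusMeasure 2).prod angleMeasure) := by
    refine Integrable.of_bound (C := |z i| + |z j|)
      (Continuous.aestronglyMeasurable (by fun_prop)) (.of_forall fun x => ?_)
    rw [Real.norm_eq_abs, abs_abs]
    refine (abs_add_le _ _).trans (add_le_add ?_ ?_) <;> rw [abs_mul] <;>
      exact mul_le_of_le_one_right (abs_nonneg _) (Real.abs_cos_le_one _)
  have hev : MeasurePreserving (fun φ : Fin 2 → ℝ => φ j) (torusMeasure 2) angleMeasure :=
    measurePreserving_eval (fun _ => angleMeasure) j
  rw [averagedAbs_eq_integral]
  conv_lhs => rw [← hpres.map_eq]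
  rw [integral_map hpres.measurable.aemeasurable (Continuous.aestronglyMeasurable (by fun_prop))]
  simp only [hsum]
  rw [integral_prod _ hintegr, pairMean, ← integral_const_mul]
  conv_rhs => rw [← hev.map_eq]
  have hcm : Continuous meanAbsCos := by unfold meanAbsCos; fun_prop
  rw [integral_map hev.measurable.aemeasurable (Continuous.aestronglyMeasurable (by fun_prop))]
  refine integral_congr_ae (.of_forall fun φ => ?_)
  simp only
  have hk : |z j / z i * Real.cos (φ j)| ≤ 1 := by
    rw [abs_mul, abs_div, abs_of_pos hi]
    exact mul_le_one₀ ((div_le_one hi).2 hj) (abs_nonneg _) (Real.abs_cos_le_one _)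
  rw [← integral_abs_cos_add hk, ← integral_const_mul]
  refine integral_congr_ae (.of_forall fun θ => ?_)
  simp only
  rw [← abs_of_pos hi, ← abs_mul, abs_of_pos hi]
  congr 1
  field_simp

lemma twiceDifferentiableAt_averagedAbs_two {z₀ : Fin 2 → ℝ} (hz₀ : ∀ i, 0 < z₀ i)
    (hne : z₀ 0 ≠ z₀ 1) : TwiceDifferentiableAt (averagedAbs (N := 2)) z₀ := by
  have key : ∀ i j : Fin 2, i ≠ j → z₀ j < z₀ i →
      TwiceDifferentiableAt (averagedAbs (N := 2)) z₀ := by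
    intro i j hij hlt
    have hi := hz₀ i
    have hj := hz₀ j
    have hk : |z₀ j / z₀ i| < 1 := by
      rw [abs_of_pos (by positivity), div_lt_one hi]; exact hlt
    have h1 : TwiceDifferentiableAt (fun z : Fin 2 → ℝ => pairMean (z j / z i)) z₀ := by
      refine (twiceDifferentiableAt_pairMean hk).comp (g := fun z : Fin 2 → ℝ => z j / z i) ?_
      exact ContDiffAt.div (by fun_prop) (by fun_prop) hi.ne'
    have h2 : TwiceDifferentiableAt (fun z : Fin 2 → ℝ => z i) z₀ :=
      twiceDifferentiableAt_of_contDiffAt (by fun_prop)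
    refine (h2.mul h1).congr ?_
    have e1 : ∀ᶠ z : Fin 2 → ℝ in 𝓝 z₀, 0 < z i :=
      (continuous_apply i).continuousAt.eventually (lt_mem_nhds hi)
    have e2 : ∀ᶠ z : Fin 2 → ℝ in 𝓝 z₀, 0 < z j :=
      (continuous_apply j).continuousAt.eventually (lt_mem_nhds hj)
    have e3 : ∀ᶠ z : Fin 2 → ℝ in 𝓝 z₀, z j < z i :=
      ((continuous_apply j).continuousAt (x := z₀)).eventually_lt (continuous_apply i).continuousAt hlt
    filter_upwards [e1, e2, e3] with z h1 h2 h3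
    exact averagedAbs_two hij h1 (by rw [abs_of_pos h2]; exact h3.le)
  rcases lt_or_gt_of_ne hne with h | h
  · exact key 1 0 (by decide) h
  · exact key 0 1 (by decide) h

/-- The momenta at which the support function is twice differentiable for an elementary reason: no
oscillator is at rest, and two oscillators have distinct amplitudes. -/
def IsRegular (ω : Fin N → ℝ) (p : Phase N) : Prop :=
  (∀ i, 0 < amplitude ω p i) ∧ (N = 2 → ∀ i j, i ≠ j → amplitude ω p i ≠ amplitude ω p j)

lemma twiceDifferentiableAt_averagedAbs (hN : 0 < N) {z : Fin N → ℝ} (hz : ∀ i, 0 < z i)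
    (hne : N = 2 → ∀ i j, i ≠ j → z i ≠ z j) : TwiceDifferentiableAt (averagedAbs (N := N)) z := by
  match N, hN with
  | 1, _ => exact twiceDifferentiableAt_averagedAbs_one hz
  | 2, _ => exact twiceDifferentiableAt_averagedAbs_two hz (hne rfl 0 1 (by decide))
  | n + 3, _ => exact twiceDifferentiableAt_averagedAbs_of_three_le (by omega) hz

lemma contDiffAt_amplitude {ω : Fin N → ℝ} {p : Phase N} (hp : ∀ i, 0 < amplitude ω p i) :
    ContDiffAt ℝ 2 (amplitude ω) p := by
  rw [contDiffAt_pi]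
  intro i
  unfold amplitude
  refine ContDiffAt.sqrt ?_ (Real.sqrt_pos.1 (hp i)).ne'
  have h : ∀ k, ContDiffAt ℝ 2 (fun q : Phase N => q k) p := fun k =>
    (EuclideanSpace.proj (𝕜 := ℝ) k).contDiff.contDiffAt
  exact ((h _).pow 2).add (contDiffAt_const.mul ((h _).pow 2))

lemma IsRegular.differentiableAt_gradH {ω : Fin N → ℝ} (hpos : ∀ i, 0 < ω i) {p : Phase N}
    (hp0 : p ≠ 0) (hp : IsRegular ω p) : DifferentiableAt ℝ (gradH ω) p := by
  obtain ⟨i, -⟩ := exists_amplitude_ne_zero hpos hp0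
  have hN : 0 < N := i.pos
  have h := (twiceDifferentiableAt_averagedAbs hN hp.1 hp.2).comp (contDiffAt_amplitude hp.1)
  have h2 : DifferentiableAt ℝ (fun q => (InnerProductSpace.toDual ℝ (Phase N)).symm
      (fderiv ℝ (suppH ω) q)) p :=
    ((InnerProductSpace.toDual ℝ (Phase N)).symm.toContinuousLinearEquiv
      |>.differentiableAt).comp p h.2
  refine h2.congr_of_eventuallyEq ?_
  filter_upwards [isOpen_ne.mem_nhds hp0] with q hq
  exact (gradient_suppH hpos hq).symm

lemma IsRegular.differentiableAt_momentum {ω : Fin N → ℝ} (hpos : ∀ i, 0 < ω i) {x : Phase N}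
    (hx : rho ω x = 1) (hp : IsRegular ω (momentum ω x)) : DifferentiableAt ℝ (momentum ω) x :=
  Oscillators.differentiableAt_momentum hpos hx
    (hp.differentiableAt_gradH hpos (momentum_ne_zero hpos (ne_zero_of_rho_pos (hx ▸ one_pos))))

/-! ### The free flow and its action on radius and momentum -/

lemma opA_apply_zero (ω : Fin N → ℝ) (x : Phase N) (i : Fin N) : opA ω x (0, i) = x (1, i) := by
  simp [opA, Matrix.ofLp_toEuclideanCLM, Matrix.mulVec, dotProduct, Matrix.blockDiagonal_apply,
    Fintype.sum_prod_type]

lemma opA_apply_one (ω : Fin N → ℝ) (x : Phase N) (i : Fin N) :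
    opA ω x (1, i) = -(ω i) ^ 2 * x (0, i) := by
  simp [opA, Matrix.ofLp_toEuclideanCLM, Matrix.mulVec, dotProduct, Matrix.blockDiagonal_apply,
    Fintype.sum_prod_type]

lemma inner_phase (x p : Phase N) :
    ⟪x, p⟫_ℝ = ∑ i, (x (0, i) * p (0, i) + x (1, i) * p (1, i)) := by
  rw [PiLp.inner_apply, Fintype.sum_prod_type_right]
  simp only [Fin.sum_univ_two, RCLike.inner_apply, conj_trivial, mul_comm]

lemma inner_vecB (p : Phase N) : ⟪p, vecB N⟫_ℝ = ∑ i, p (1, i) := by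
  simp [inner_phase, vecB]

lemma adjoint_opA (ω : Fin N → ℝ) (p : Phase N) : ContinuousLinearMap.adjoint (opA ω) p =
    WithLp.toLp 2 fun k => if k.1 = 1 then p (0, k.2) else -(ω k.2) ^ 2 * p (1, k.2) := by
  refine ext_inner_left ℝ fun v => ?_
  rw [ContinuousLinearMap.adjoint_inner_right, inner_phase, inner_phase]
  refine Finset.sum_congr rfl fun i _ => ?_
  rw [opA_apply_zero, opA_apply_one]
  simp
  ring

lemma adjoint_opA_zero (ω : Fin N → ℝ) (p : Phase N) (i : Fin N) :
    ContinuousLinearMap.adjoint (opA ω) p (0, i) = -(ω i) ^ 2 * p (1, i) := by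
  rw [adjoint_opA]; simp

lemma adjoint_opA_one (ω : Fin N → ℝ) (p : Phase N) (i : Fin N) :
    ContinuousLinearMap.adjoint (opA ω) p (1, i) = p (0, i) := by
  rw [adjoint_opA]; simp

lemma phase_ext {x y : Phase N} (h0 : ∀ i, x (0, i) = y (0, i)) (h1 : ∀ i, x (1, i) = y (1, i)) :
    x = y := by
  refine PiLp.ext fun ⟨k, i⟩ => ?_
  fin_cases k
  · exact h0 i
  · exact h1 i

/-- The phase point with given positions and velocities. -/
def phaseMk (a b : Fin N → ℝ) : Phase N := WithLp.toLp 2 fun k => if k.1 = 1 then b k.2 else a k.2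

@[simp] lemma phaseMk_zero (a b : Fin N → ℝ) (i : Fin N) : phaseMk a b (0, i) = a i := by
  simp [phaseMk]

@[simp] lemma phaseMk_one (a b : Fin N → ℝ) (i : Fin N) : phaseMk a b (1, i) = b i := by
  simp [phaseMk]

lemma hasDerivAt_phase {y : ℝ → Phase N} {y' : Phase N} {t : ℝ} :
    HasDerivAt y y' t ↔ ∀ k, HasDerivAt (fun s => y s k) (y' k) t := by
  constructor
  · intro h k
    exact (EuclideanSpace.proj (𝕜 := ℝ) k).hasFDerivAt.comp_hasDerivAt t h
  · intro h
    have h1 : HasDerivAt (fun s => (y s).ofLp) y'.ofLp t := hasDerivAt_pi.2 h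
    exact (PiLp.continuousLinearEquiv 2 ℝ fun _ : Fin 2 × Fin N => ℝ).symm.hasFDerivAt.comp_hasDerivAt
      t h1

/-- The free motion of the oscillators, `exp (t A)`. -/
def flow (ω : Fin N → ℝ) (t : ℝ) (x : Phase N) : Phase N :=
  phaseMk (fun i => Real.cos (ω i * t) * x (0, i) + (ω i)⁻¹ * Real.sin (ω i * t) * x (1, i))
    (fun i => Real.cos (ω i * t) * x (1, i) - ω i * Real.sin (ω i * t) * x (0, i))

/-- The free motion of the momenta, `exp (-t A*)`. -/
def dualFlow (ω : Fin N → ℝ) (t : ℝ) (p : Phase N) : Phase N :=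
  phaseMk (fun i => Real.cos (ω i * t) * p (0, i) + ω i * Real.sin (ω i * t) * p (1, i))
    (fun i => Real.cos (ω i * t) * p (1, i) - (ω i)⁻¹ * Real.sin (ω i * t) * p (0, i))

lemma flow_zero (ω : Fin N → ℝ) (x : Phase N) : flow ω 0 x = x := by
  refine phase_ext (fun i => ?_) (fun i => ?_) <;> simp [flow]

lemma flow_neg_flow {ω : Fin N → ℝ} (hpos : ∀ i, 0 < ω i) (t : ℝ) (x : Phase N) :
    flow ω (-t) (flow ω t x) = x := by
  refine phase_ext (fun i => ?_) (fun i => ?_) <;>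
  · have hi := (hpos i).ne'
    have := Real.sin_sq_add_cos_sq (ω i * t)
    simp only [flow, phaseMk_zero, phaseMk_one, mul_neg, Real.cos_neg, Real.sin_neg]
    field_simp
    first
      | linear_combination x (0, i) * this
      | linear_combination x (1, i) * this
      | linear_combination ω i * x (0, i) * this

lemma amplitude_dualFlow {ω : Fin N → ℝ} (hpos : ∀ i, 0 < ω i) (t : ℝ) (p : Phase N) :
    amplitude ω (dualFlow ω t p) = amplitude ω p := by
  ext i
  have hi := (hpos i).ne'
  have := Real.sin_sq_add_cos_sq (ω i * t)
  unfold amplitude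
  congr 1
  simp only [dualFlow, phaseMk_zero, phaseMk_one]
  field_simp
  linear_combination (ω i ^ 2 * p (1, i) ^ 2 + p (0, i) ^ 2) * this

lemma inner_flow {ω : Fin N → ℝ} (hpos : ∀ i, 0 < ω i) (t : ℝ) (x p : Phase N) :
    ⟪flow ω t x, dualFlow ω t p⟫_ℝ = ⟪x, p⟫_ℝ := by
  rw [inner_phase, inner_phase]
  refine Finset.sum_congr rfl fun i _ => ?_
  have hi := (hpos i).ne'
  have := Real.sin_sq_add_cos_sq (ω i * t)
  simp only [dualFlow, flow, phaseMk_zero, phaseMk_one]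
  field_simp
  linear_combination ω i * (x (1, i) * p (1, i) + x (0, i) * p (0, i)) * this

lemma flow_ne_zero {ω : Fin N → ℝ} (hpos : ∀ i, 0 < ω i) (t : ℝ) {x : Phase N} (hx : x ≠ 0) :
    flow ω t x ≠ 0 := by
  intro h
  apply hx
  rw [← flow_neg_flow hpos t x, h]
  refine phase_ext (fun i => ?_) (fun i => ?_) <;> simp [flow]

lemma suppH_dualFlow {ω : Fin N → ℝ} (hpos : ∀ i, 0 < ω i) (t : ℝ) (p : Phase N) :
    suppH ω (dualFlow ω t p) = suppH ω p := by
  rw [suppH, amplitude_dualFlow hpos, suppH]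

/-- The dual flow preserves the amplitudes, hence `H`, and the pairing of the two flows is constant.
Duality shows that `ρ` does not decrease for either direction of time. -/
lemma rho_flow {ω : Fin N → ℝ} (hpos : ∀ i, 0 < ω i) (t : ℝ) {x : Phase N} (hx : x ≠ 0) :
    rho ω (flow ω t x) = rho ω x := by
  have key : ∀ (s : ℝ) {y : Phase N}, y ≠ 0 → rho ω y ≤ rho ω (flow ω s y) := fun s y hy => by
    obtain ⟨h1, h2⟩ := momentum_spec hpos hy
    have := inner_le_rho_mul hpos (flow ω s y) (dualFlow ω s (momentum ω y))
    rwa [inner_flow hpos, suppH_dualFlow hpos, h1, h2, mul_one] at this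
  refine le_antisymm ?_ (key t hx)
  have := key (-t) (flow_ne_zero hpos t hx)
  rwa [flow_neg_flow hpos] at this

lemma momentum_flow {ω : Fin N → ℝ} (hpos : ∀ i, 0 < ω i) (t : ℝ) {x : Phase N} (hx : x ≠ 0) :
    momentum ω (flow ω t x) = dualFlow ω t (momentum ω x) := by
  obtain ⟨h1, h2⟩ := momentum_spec hpos hx
  have h3 : suppH ω (dualFlow ω t (momentum ω x)) = 1 := by rw [suppH_dualFlow hpos, h1]
  refine momentum_eq hpos (flow_ne_zero hpos t hx) h3 (eq_rho_smul_gradH hpos h3 ?_)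
  rw [inner_flow hpos, rho_flow hpos t hx, h2]

lemma hasDerivAt_flow {ω : Fin N → ℝ} (hpos : ∀ i, 0 < ω i) (x : Phase N) :
    HasDerivAt (fun t => flow ω t x) (opA ω x) 0 := by
  refine hasDerivAt_phase.2 fun ⟨k, i⟩ => ?_
  have hl : HasDerivAt (fun t : ℝ => ω i * t) (ω i) 0 := by
    simpa using (hasDerivAt_id (0 : ℝ)).const_mul (ω i)
  have hi := (hpos i).ne'
  fin_cases k
  · simp only [Fin.zero_eta, flow, phaseMk_zero, opA_apply_zero]
    convert! (hl.cos.mul_const (x (0, i))).fun_add ((hl.sin.const_mul (ω i)⁻¹).mul_const (x (1, i)))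
      using 1
    simp [hi]
  · simp only [Fin.mk_one, flow, phaseMk_one, opA_apply_one]
    convert! (hl.cos.mul_const (x (1, i))).fun_sub ((hl.sin.const_mul (ω i)).mul_const (x (0, i)))
      using 1
    simp
    grind

lemma hasDerivAt_dualFlow {ω : Fin N → ℝ} (hpos : ∀ i, 0 < ω i) (p : Phase N) :
    HasDerivAt (fun t => dualFlow ω t p) (-(ContinuousLinearMap.adjoint (opA ω) p)) 0 := by
  refine hasDerivAt_phase.2 fun ⟨k, i⟩ => ?_
  have hl : HasDerivAt (fun t : ℝ => ω i * t) (ω i) 0 := by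
    simpa using (hasDerivAt_id (0 : ℝ)).const_mul (ω i)
  have hi := (hpos i).ne'
  fin_cases k
  · simp only [Fin.zero_eta, dualFlow, phaseMk_zero, PiLp.neg_apply, adjoint_opA_zero]
    convert! (hl.cos.mul_const (p (0, i))).fun_add ((hl.sin.const_mul (ω i)).mul_const (p (1, i)))
      using 1
    simp
    grind
  · simp only [Fin.mk_one, dualFlow, phaseMk_one, PiLp.neg_apply, adjoint_opA_one]
    convert! (hl.cos.mul_const (p (1, i))).fun_sub ((hl.sin.const_mul (ω i)⁻¹).mul_const (p (0, i)))
      using 1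
    simp [hi]

/-- `ρ` is constant along the free flow and its gradient is the momentum. So only the control
changes `ρ` along a motion. -/
lemma inner_momentum_opA {ω : Fin N → ℝ} (hpos : ∀ i, 0 < ω i) {x : Phase N} (hx : x ≠ 0) :
    ⟪momentum ω x, opA ω x⟫_ℝ = 0 := by
  have h1 : HasFDerivAt (rho ω) (InnerProductSpace.toDual ℝ (Phase N) (momentum ω x))
      (flow ω 0 x) := by
    rw [flow_zero]; exact (hasGradientAt_rho hpos hx).hasFDerivAt
  have h2 := h1.comp_hasDerivAt 0 (hasDerivAt_flow hpos x)
  have h3 : (rho ω ∘ fun t => flow ω t x) = fun _ => rho ω x := by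
    ext t; exact rho_flow hpos t hx
  rw [h3] at h2
  simpa using h2.unique (hasDerivAt_const _ _)

/-- The momentum map intertwines the flow and the dual flow; this is the derivative of that relation
at time zero. -/
lemma fderiv_momentum_opA {ω : Fin N → ℝ} (hpos : ∀ i, 0 < ω i) {x : Phase N} (hx : x ≠ 0)
    (hd : DifferentiableAt ℝ (momentum ω) x) : fderiv ℝ (momentum ω) x (opA ω x) =
      -(ContinuousLinearMap.adjoint (opA ω) (momentum ω x)) := by
  have h1 : HasFDerivAt (momentum ω) (fderiv ℝ (momentum ω) x) (flow ω 0 x) := by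
    rw [flow_zero]; exact hd.hasFDerivAt
  have h2 := h1.comp_hasDerivAt 0 (hasDerivAt_flow hpos x)
  have h3 : (momentum ω ∘ fun t => flow ω t x) = fun t => dualFlow ω t (momentum ω x) := by
    ext1 t; exact momentum_flow hpos t hx
  rw [h3] at h2
  exact h2.unique (hasDerivAt_dualFlow hpos _)

/-- Where a curve on the unit sphere of `rho` moves freely, so does its momentum. -/
lemma hasDerivAt_momentum_of_free {ω : Fin N → ℝ} (hpos : ∀ i, 0 < ω i) {φ : ℝ → Phase N}
    (hφ : ∀ t, rho ω (φ t) = 1) {t : ℝ} (hd : HasDerivAt φ (opA ω (φ t)) t) :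
    HasDerivAt (fun s => momentum ω (φ s))
      (-(ContinuousLinearMap.adjoint (opA ω) (momentum ω (φ t)))) t := by
  have h0 : φ t ≠ 0 := ne_zero_of_rho_pos (by rw [hφ]; exact one_pos)
  obtain ⟨L, hL⟩ := exists_lipschitz_momentum hpos
  have hflow : HasDerivAt (fun s => flow ω (s - t) (φ t)) (opA ω (φ t)) t := by
    have h := hasDerivAt_flow hpos (φ t)
    rw [← sub_self t] at h
    exact h.comp_sub_const t t
  have hdual : HasDerivAt (fun s => dualFlow ω (s - t) (momentum ω (φ t)))
      (-(ContinuousLinearMap.adjoint (opA ω) (momentum ω (φ t)))) t := by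
    have h := hasDerivAt_dualFlow hpos (momentum ω (φ t))
    rw [← sub_self t] at h
    exact h.comp_sub_const t t
  -- The curve and the free orbit through `φ t` differ by `o(s - t)`, and so do their momenta since
  -- the momentum map is Lipschitz on the sphere. No differentiability of that map is needed.
  have hdiff : HasDerivAt (fun s => momentum ω (φ s) - dualFlow ω (s - t) (momentum ω (φ t))) 0 t := by
    have h := hd.fun_sub hflow
    rw [sub_self, hasDerivAt_iff_isLittleO] at h
    rw [hasDerivAt_iff_isLittleO]
    refine Asymptotics.IsBigO.trans_isLittleO (Asymptotics.IsBigO.of_bound L (.of_forall fun s => ?_)) h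
    have e1 : momentum ω (φ t) - dualFlow ω (t - t) (momentum ω (φ t)) = 0 := by
      rw [← momentum_flow hpos _ h0, sub_self, flow_zero, sub_self]
    have e2 : φ t - flow ω (t - t) (φ t) = 0 := by rw [sub_self, flow_zero, sub_self]
    rw [e1, e2, smul_zero, sub_zero, sub_zero, sub_zero, sub_zero, ← momentum_flow hpos _ h0]
    exact hL.norm_sub_le (hφ s) ((rho_flow hpos _ h0).trans (hφ t))
  simpa using hdiff.fun_add hdual

/-! ### Relations on sets of times, and Kalman's condition -/

/-- The isolated points of `S` form a discrete subspace of the line, hence a countable set. `S` need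
not be measurable. -/
lemma ae_accPt (S : Set ℝ) : ∀ᵐ t : ℝ, t ∈ S → AccPt t (𝓟 S) := by
  have hc : {t : ℝ | t ∈ S ∧ ¬AccPt t (𝓟 S)}.Countable := by
    have hd : DiscreteTopology {t : ℝ | t ∈ S ∧ ¬AccPt t (𝓟 S)} := by
      rw [discreteTopology_subtype_iff]
      rintro t ⟨htS, ht⟩
      rw [AccPt, not_neBot] at ht
      exact le_bot_iff.1 ((inf_le_inf_left _ (principal_mono.2 fun s hs => hs.1)).trans ht.le)
    exact Set.countable_coe_iff.1 (TopologicalSpace.separableSpace_iff_countable.1 inferInstance)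
  filter_upwards [hc.ae_notMem volume] with t ht htS
  by_contra h
  exact ht ⟨htS, h⟩

lemma eq_zero_of_hasDerivAt_of_accPt {E : Type*} [NormedAddCommGroup E] [NormedSpace ℝ E]
    {S : Set ℝ} {g : ℝ → E} {g' : E} {t : ℝ} (hS : AccPt t (𝓟 S)) (ht : t ∈ S)
    (hg : ∀ s ∈ S, g s = 0) (hd : HasDerivAt g g' t) : g' = 0 := by
  have h1 := hasDerivAt_iff_tendsto_slope.1 hd
  have hS' : NeBot (𝓝[≠] t ⊓ 𝓟 S) := hS
  have h2 : Tendsto (slope g t) (𝓝[≠] t ⊓ 𝓟 S) (𝓝 g') := h1.mono_left inf_le_left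
  refine tendsto_nhds_unique h2 (tendsto_const_nhds.congr' ?_)
  filter_upwards [mem_inf_of_right (mem_principal_self S)] with s hs
  simp [slope, hg s hs, hg t ht]

/-- A function vanishing on a set has zero derivative at almost all of its points. -/
lemma ae_deriv_eq_zero {E : Type*} [NormedAddCommGroup E] [NormedSpace ℝ E] {S : Set ℝ}
    {g g' : ℝ → E} (hg : ∀ s ∈ S, g s = 0) (hd : ∀ᵐ t, t ∈ S → HasDerivAt g (g' t) t) :
    ∀ᵐ t, t ∈ S → g' t = 0 := by
  filter_upwards [ae_accPt S, hd] with t h1 h2 ht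
  exact eq_zero_of_hasDerivAt_of_accPt (h1 ht) ht hg (h2 ht)

lemma ae_deriv_eq_zero_of_ae {E : Type*} [NormedAddCommGroup E] [NormedSpace ℝ E] {S : Set ℝ}
    {g g' : ℝ → E} (hg : ∀ᵐ s, s ∈ S → g s = 0) (hd : ∀ᵐ t, t ∈ S → HasDerivAt g (g' t) t) :
    ∀ᵐ t, t ∈ S → g' t = 0 := by
  have h := ae_deriv_eq_zero (S := {t | t ∈ S ∧ g t = 0}) (g := g) (g' := g') (fun s hs => hs.2)
    (hd.mono fun t ht hs => ht hs.1)
  filter_upwards [h, hg] with t h1 h2 ht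
  exact h1 ⟨ht, h2 ht⟩

lemma injective_neg_sq {ω : Fin N → ℝ} (hpos : ∀ i, 0 < ω i) (hω : NonResonant ω) :
    Function.Injective fun i => -(ω i) ^ 2 := by
  intro i j hij
  have h : ω i = ω j := by
    have : ω i ^ 2 = ω j ^ 2 := by simpa using hij
    exact (pow_left_inj₀ (hpos i).le (hpos j).le two_ne_zero).1 this
  by_contra hne
  have h0 := hω (Pi.single i 1 - Pi.single j 1) (by
    simp [Pi.single_apply, sub_mul, Finset.sum_sub_distrib, h])
  have := congrFun h0 i
  simp [hne] at this

/-- The Kalman controllability condition. -/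
lemma eq_zero_of_kalman {ω : Fin N → ℝ} (hpos : ∀ i, 0 < ω i) (hω : NonResonant ω) {p : Phase N}
    (h1 : ∀ k : ℕ, ∑ i, (-(ω i) ^ 2) ^ k * p (1, i) = 0)
    (h0 : ∀ k : ℕ, ∑ i, (-(ω i) ^ 2) ^ k * p (0, i) = 0) : p = 0 := by
  have key : ∀ v : Fin N → ℝ, (∀ k : ℕ, ∑ i, (-(ω i) ^ 2) ^ k * v i = 0) → v = 0 := by
    intro v hv
    -- The moments form a Vandermonde system with nodes `-ω_i²`, distinct by non-resonance and
    -- positivity.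
    refine Matrix.eq_zero_of_mulVec_eq_zero (M := (Matrix.vandermonde fun i => -(ω i) ^ 2).transpose)
      ?_ ?_
    · rw [Matrix.det_transpose]
      exact Matrix.det_vandermonde_ne_zero_iff.2 (injective_neg_sq hpos hω)
    · ext k
      simpa [Matrix.mulVec, dotProduct, Matrix.vandermonde_apply] using hv k
  exact phase_ext (fun i => by simpa using congrFun (key _ h0) i)
    (fun i => by simpa using congrFun (key _ h1) i)

/-- Free motions of the momentum do not stay in the switching hyperplane. -/
lemma ae_notMem_of_free {ω : Fin N → ℝ} (hpos : ∀ i, 0 < ω i) (hω : NonResonant ω)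
    {p : ℝ → Phase N} {S : Set ℝ} (hB : ∀ t ∈ S, ⟪p t, vecB N⟫_ℝ = 0) (h0 : ∀ t ∈ S, p t ≠ 0)
    (hd : ∀ᵐ t, t ∈ S → HasDerivAt p (-(ContinuousLinearMap.adjoint (opA ω) (p t))) t) :
    ∀ᵐ t, t ∉ S := by
  have hd0 : ∀ᵐ t, t ∈ S → ∀ i, HasDerivAt (fun s => p s (0, i)) ((ω i) ^ 2 * p t (1, i)) t := by
    filter_upwards [hd] with t ht hS i
    have := hasDerivAt_phase.1 (ht hS) (0, i)
    simpa [adjoint_opA_zero] using this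
  have hd1 : ∀ᵐ t, t ∈ S → ∀ i, HasDerivAt (fun s => p s (1, i)) (-p t (0, i)) t := by
    filter_upwards [hd] with t ht hS i
    have := hasDerivAt_phase.1 (ht hS) (1, i)
    simpa [adjoint_opA_one] using this
  -- Starting from `∑ η_i = 0` on `S`, each differentiation alternates between `η` and `ξ` and every
  -- second one multiplies the terms by `-ω_i²`. All Kalman relations follow at almost every time in
  -- `S`.
  have step1 : ∀ k : ℕ, (∀ᵐ t, t ∈ S → ∑ i, (-(ω i) ^ 2) ^ k * p t (1, i) = 0) →
      ∀ᵐ t, t ∈ S → ∑ i, (-(ω i) ^ 2) ^ k * p t (0, i) = 0 := by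
    intro k hk
    have := ae_deriv_eq_zero_of_ae (g' := fun t => ∑ i, (-(ω i) ^ 2) ^ k * -p t (0, i)) hk (by
      filter_upwards [hd1] with t ht hS
      exact HasDerivAt.fun_sum fun i _ => (ht hS i).const_mul _)
    filter_upwards [this] with t ht hS
    simpa using ht hS
  have step0 : ∀ k : ℕ, (∀ᵐ t, t ∈ S → ∑ i, (-(ω i) ^ 2) ^ k * p t (0, i) = 0) →
      ∀ᵐ t, t ∈ S → ∑ i, (-(ω i) ^ 2) ^ (k + 1) * p t (1, i) = 0 := by
    intro k hk
    have := ae_deriv_eq_zero_of_ae (g' := fun t => ∑ i, (-(ω i) ^ 2) ^ k * ((ω i) ^ 2 * p t (1, i)))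
      hk (by
      filter_upwards [hd0] with t ht hS
      exact HasDerivAt.fun_sum fun i _ => (ht hS i).const_mul _)
    filter_upwards [this] with t ht hS
    rw [← neg_eq_zero, ← ht hS, ← Finset.sum_neg_distrib]
    exact Finset.sum_congr rfl fun i _ => by ring
  have hall : ∀ k : ℕ, ∀ᵐ t, t ∈ S → ∑ i, (-(ω i) ^ 2) ^ k * p t (1, i) = 0 := by
    intro k
    induction k with
    | zero =>
      refine .of_forall fun t hS => ?_
      have := hB t hS
      rw [inner_vecB] at this
      simpa using this
    | succ k ih => exact step0 k (step1 k ih)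
  filter_upwards [ae_all_iff.2 hall, ae_all_iff.2 fun k => step1 k (hall k)] with t h1 h2 hS
  exact h0 t hS (eq_zero_of_kalman hpos hω (fun k => h1 k hS) fun k => h2 k hS)

/-! ### Absolutely continuous curves -/

lemma SolvesOn.ae_hasDerivAt_Icc {a b : ℝ} {y w : ℝ → Phase N} (h : SolvesOn (Set.Icc a b) y w) :
    ∀ᵐ t, t ∈ Set.Ioo a b → HasDerivAt y (w t) t := by
  by_cases hab : a ≤ b
  · have ha : a ∈ Set.Icc a b := Set.left_mem_Icc.2 hab
    have hi := (h a ha b (Set.right_mem_Icc.2 hab)).1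
    filter_upwards [hi.ae_hasDerivAt_integral] with t ht htI
    have h1 := ht (by rw [Set.uIcc_of_le hab]; exact Set.Ioo_subset_Icc_self htI) a
      (by rw [Set.uIcc_of_le hab]; exact ha)
    have h2 : y =ᶠ[𝓝 t] fun s => y a + ∫ τ in a..s, w τ := by
      filter_upwards [isOpen_Ioo.mem_nhds htI] with s hs
      rw [← (h a ha s (Set.Ioo_subset_Icc_self hs)).2]
      abel
    exact (h1.const_add (y a)).congr_of_eventuallyEq h2
  · exact .of_forall fun t ht => absurd (ht.1.trans ht.2).le hab

lemma SolvesOn.mono {I J : Set ℝ} {y w : ℝ → Phase N} (h : SolvesOn I y w) (hJ : J ⊆ I) :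
    SolvesOn J y w := fun s hs t ht => h s (hJ hs) t (hJ ht)

lemma SolvesOn.ae_hasDerivAt {y w : ℝ → Phase N} (h : SolvesOn Set.univ y w) :
    ∀ᵐ t, HasDerivAt y (w t) t := by
  have := ae_all_iff.2 fun n : ℕ =>
    (h.mono (Set.subset_univ (Set.Icc (-(n : ℝ)) n))).ae_hasDerivAt_Icc
  filter_upwards [this] with t ht
  obtain ⟨n, hn⟩ := exists_nat_gt |t|
  exact ht n ⟨(abs_lt.1 hn).1, (abs_lt.1 hn).2⟩

lemma norm_sub_le_of_solvesOn {I : Set ℝ} {y w : ℝ → Phase N} (h : SolvesOn I y w) {C : ℝ}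
    (hI : I.OrdConnected) (hC : ∀ᵐ t, t ∈ I → ‖w t‖ ≤ C) {s t : ℝ} (hs : s ∈ I) (ht : t ∈ I) :
    ‖y t - y s‖ ≤ C * |t - s| := by
  rw [(h s hs t ht).2]
  refine intervalIntegral.norm_integral_le_of_norm_le_const_ae (hC.mono fun τ hτ hm => hτ ?_)
  exact hI.uIcc_subset hs ht (Set.uIoc_subset_uIcc hm)

/-- A Lipschitz curve is the integral of its derivative. -/
lemma solvesOn_of_lipschitz {I : Set ℝ} (hI : I.OrdConnected) {y w : ℝ → Phase N} {K : NNReal}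
    (hy : LipschitzOnWith K y I) (hd : ∀ᵐ t, t ∈ interior I → HasDerivAt y (w t) t) :
    SolvesOn I y w := by
  intro s hs t ht
  have hsub : Set.uIcc s t ⊆ I := hI.uIcc_subset hs ht
  have hIoo : Set.Ioo (min s t) (max s t) ⊆ interior I :=
    interior_maximal (Set.Ioo_subset_Icc_self.trans hsub) isOpen_Ioo
  have hd' : ∀ᵐ τ, τ ∈ Set.uIoc s t → HasDerivAt y (w τ) τ := by
    filter_upwards [hd, (Set.countable_singleton (max s t)).ae_notMem volume] with τ h1 h2 h3
    exact h1 (hIoo ⟨h3.1, lt_of_le_of_ne h3.2 h2⟩)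
  have hcoord : ∀ k, AbsolutelyContinuousOnInterval (fun τ => y τ k) s t := fun k =>
    LipschitzOnWith.absolutelyContinuousOnInterval
      (((EuclideanSpace.proj (𝕜 := ℝ) k).lipschitz.comp_lipschitzOnWith (hy.mono hsub)))
  have hder : ∀ k, (fun τ => w τ k) =ᵐ[volume.restrict (Set.uIoc s t)]
      deriv (fun τ => y τ k) := fun k => by
    refine (ae_restrict_iff' measurableSet_uIoc).2 ?_
    filter_upwards [hd'] with τ hτ h
    exact (hasDerivAt_phase.1 (hτ h) k).deriv.symm
  have hintegr : ∀ k, IntervalIntegrable (fun τ => w τ k) volume s t := fun k =>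
    (hcoord k).intervalIntegrable_deriv.congr_ae (hder k).symm
  have hw : IntervalIntegrable w volume s t := by
    rw [intervalIntegrable_iff]
    have h1 : ∀ k, IntegrableOn (fun τ => w τ k) (Set.uIoc s t) := fun k =>
      intervalIntegrable_iff.1 (hintegr k)
    have h2 : Integrable (fun τ => (w τ).ofLp) (volume.restrict (Set.uIoc s t)) :=
      Integrable.of_eval h1
    exact (PiLp.continuousLinearEquiv 2 ℝ fun _ : Fin 2 × Fin N => ℝ).symm.toContinuousLinearMap
      |>.integrable_comp h2
  refine ⟨hw, PiLp.ext fun k => ?_⟩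
  have h3 : ∫ τ in s..t, w τ k = (∫ τ in s..t, w τ) k :=
    (EuclideanSpace.proj (𝕜 := ℝ) k).intervalIntegral_comp_comm hw
  have h4 := (hcoord k).integral_deriv_eq_sub
  have h5 : ∫ τ in s..t, w τ k = ∫ τ in s..t, deriv (fun τ => y τ k) τ :=
    intervalIntegral.integral_congr_ae ((ae_restrict_iff' measurableSet_uIoc).1 (hder k))
  rw [PiLp.sub_apply, ← h4, ← h5, h3]

/-! ### Symmetries of the support function at degenerate momenta -/

/-- Both sides are directional derivatives of `H`. In this way symmetries of `H` fixing `p` become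
linear relations for the point `φ`, even where `H` may fail to be `C²`. -/
lemma inner_gradH_eq_of_line {ω : Fin N → ℝ} (hpos : ∀ i, 0 < ω i) {p q r : Phase N} (hp : p ≠ 0)
    (h : ∀ t : ℝ, suppH ω (p + t • q) = suppH ω (p + t • r)) :
    ⟪gradH ω p, q⟫_ℝ = ⟪gradH ω p, r⟫_ℝ := by
  have hd : ∀ w : Phase N, HasDerivAt (fun t : ℝ => suppH ω (p + t • w)) ⟪gradH ω p, w⟫_ℝ 0 := by
    intro w
    have hl : HasDerivAt (fun t : ℝ => p + t • w) w 0 := by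
      simpa using ((hasDerivAt_id (0 : ℝ)).smul_const w).const_add p
    have hg : HasFDerivAt (suppH ω) (InnerProductSpace.toDual ℝ (Phase N) (gradH ω p))
        (p + (0 : ℝ) • w) := by
      simpa using (hasGradientAt_suppH hpos hp).hasFDerivAt
    have := hg.comp_hasDerivAt 0 hl
    rwa [InnerProductSpace.toDual_apply_apply] at this
  have h2 : (fun t : ℝ => suppH ω (p + t • q)) = fun t => suppH ω (p + t • r) := by
    ext t; exact h t
  have h3 := hd q
  rw [h2] at h3
  exact h3.unique (hd r)

lemma inner_single (x : Phase N) (k : Fin 2 × Fin N) (c : ℝ) :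
    ⟪x, EuclideanSpace.single k c⟫_ℝ = c * x k := by
  rw [EuclideanSpace.inner_single_right]; simp

/-- At zero amplitude `H` is even in each coordinate of that oscillator. -/
lemma gradH_apply_eq_zero {ω : Fin N → ℝ} (hpos : ∀ i, 0 < ω i) {p : Phase N} (hp : p ≠ 0)
    {l : Fin N} (hl : amplitude ω p l = 0) (k : Fin 2) : gradH ω p (k, l) = 0 := by
  obtain ⟨h0, h1⟩ := (amplitude_eq_zero_iff hpos p l).1 hl
  have := inner_gradH_eq_of_line hpos hp (q := EuclideanSpace.single (k, l) (1 : ℝ))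
    (r := EuclideanSpace.single (k, l) (-1 : ℝ)) fun t => by
      rw [suppH, suppH]
      congr 1
      ext i
      unfold amplitude
      by_cases hi : i = l
      · subst hi
        fin_cases k <;> simp [h0, h1]
      · simp [hi]
  rw [inner_single, inner_single] at this
  linarith

lemma averagedAbs_comp_perm (σ : Equiv.Perm (Fin N)) (z : Fin N → ℝ) :
    averagedAbs (fun i => z (σ i)) = averagedAbs z := by
  have hpres := measurePreserving_piCongrLeft (fun _ : Fin N => angleMeasure) σ
  rw [averagedAbs_eq_integral, averagedAbs_eq_integral, torusMeasure]
  rw [← hpres.integral_comp' (g := fun φ => |∑ i, z i * Real.cos (φ i)|)]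
  refine integral_congr_ae (.of_forall fun φ => ?_)
  simp only
  rw [← Equiv.sum_comp σ fun i => z i * Real.cos _]
  congr 1
  refine Finset.sum_congr rfl fun i _ => ?_
  congr 2
  exact (Equiv.piCongrLeft_apply_apply (fun _ => ℝ) σ φ i).symm

lemma averagedAbs_swap {z z' : Fin 2 → ℝ} (h0 : z 0 = z' 1) (h1 : z 1 = z' 0) :
    averagedAbs z = averagedAbs z' := by
  rw [← averagedAbs_comp_perm (Equiv.swap 0 1) z']
  congr 1
  ext i
  fin_cases i
  · simpa using h0
  · simpa using h1

/-- If two oscillators have equal amplitudes and opposite `η`, then exchanging them is a symmetry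
of the support function which fixes the momentum. -/
lemma gradH_of_amplitude_eq {ω : Fin 2 → ℝ} (hpos : ∀ i, 0 < ω i) {p : Phase 2} (hp : p ≠ 0)
    (hB : ⟪p, vecB 2⟫_ℝ = 0) (h : amplitude ω p 0 = amplitude ω p 1) :
    gradH ω p (1, 0) + gradH ω p (1, 1) = 0 ∧
      ω 0 ^ 2 * gradH ω p (0, 0) ^ 2 = ω 1 ^ 2 * gradH ω p (0, 1) ^ 2 := by
  have hη : p (1, 1) = -p (1, 0) := by
    rw [inner_vecB, Fin.sum_univ_two] at hB; linarith
  have hw0 := (hpos 0).ne'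
  have hw1 := (hpos 1).ne'
  have hsq : ((ω 0)⁻¹ * p (0, 0)) ^ 2 = ((ω 1)⁻¹ * p (0, 1)) ^ 2 := by
    have := congrArg (· ^ 2) h
    simp only [amplitude_sq, hη] at this
    linear_combination this
  constructor
  · have := inner_gradH_eq_of_line hpos hp (q := EuclideanSpace.single (1, 0) (1 : ℝ))
      (r := EuclideanSpace.single (1, 1) (-1 : ℝ)) fun t => by
        refine averagedAbs_swap ?_ ?_ <;> unfold amplitude <;> congr 1 <;> simp [hη] <;>
          first | linear_combination hsq | linear_combination -hsq
    rw [inner_single, inner_single] at this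
    linarith
  · have key : ∀ s : ℝ, s ^ 2 = 1 → (ω 0)⁻¹ * p (0, 0) = s * ((ω 1)⁻¹ * p (0, 1)) →
        ω 0 * gradH ω p (0, 0) = s * ω 1 * gradH ω p (0, 1) := by
      intro s hs hps
      have := inner_gradH_eq_of_line hpos hp (q := EuclideanSpace.single (0, 0) (ω 0))
        (r := EuclideanSpace.single (0, 1) (s * ω 1)) fun t => by
          refine averagedAbs_swap ?_ ?_ <;> unfold amplitude <;> congr 1 <;> simp [hη]
          · have e1 : (ω 0 ^ 2)⁻¹ * (p (0, 0) + t * ω 0) ^ 2 = ((ω 0)⁻¹ * p (0, 0) + t) ^ 2 := by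
              field_simp
            have e2 : (ω 1 ^ 2)⁻¹ * (p (0, 1) + t * (s * ω 1)) ^ 2 =
                ((ω 1)⁻¹ * p (0, 1) + t * s) ^ 2 := by field_simp
            rw [e1, e2, hps]
            linear_combination (((ω 1)⁻¹ * p (0, 1)) ^ 2 - t ^ 2) * hs
          · linear_combination -hsq
      rwa [inner_single, inner_single] at this
    rcases sq_eq_sq_iff_eq_or_eq_neg.1 hsq with h' | h'
    · have := key 1 (by norm_num) (by rw [h', one_mul])
      rw [← mul_pow, this]; ring
    · have := key (-1) (by norm_num) (by rw [h']; ring)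
      rw [← mul_pow, this]; ring

/-! ### Singular curves and the dual system -/

/-- A curve on the unit sphere of `rho` and on the switching surface, driven by the control `v`
which is bounded by `M`. -/
structure IsSingularCurve (ω : Fin N → ℝ) (M : ℝ) (φ : ℝ → Phase N) (v : ℝ → ℝ) : Prop where
  rho_eq : ∀ t, rho ω (φ t) = 1
  inner_eq : ∀ t, ⟪momentum ω (φ t), vecB N⟫_ℝ = 0
  solves : SolvesOn Set.univ φ fun t => opA ω (φ t) + v t • vecB N
  bound : ∀ᵐ t, |v t| ≤ M

section

variable {ω : Fin N → ℝ} {M : ℝ} {φ : ℝ → Phase N} {v : ℝ → ℝ}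

lemma vecB_zero (i : Fin N) : vecB N (0, i) = 0 := by simp [vecB]

lemma vecB_one (i : Fin N) : vecB N (1, i) = 1 := by simp [vecB]

lemma IsSingularCurve.ne_zero (h : IsSingularCurve ω M φ v) (t : ℝ) : φ t ≠ 0 :=
  ne_zero_of_rho_pos (by rw [h.rho_eq]; exact one_pos)

lemma ae_coord (hs : SolvesOn Set.univ φ fun t => opA ω (φ t) + v t • vecB N) :
    ∀ᵐ t, ∀ i, HasDerivAt (fun s => φ s (0, i)) (φ t (1, i)) t ∧
      HasDerivAt (fun s => φ s (1, i)) (-(ω i) ^ 2 * φ t (0, i) + v t) t := by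
  filter_upwards [hs.ae_hasDerivAt] with t ht i
  have h0 := hasDerivAt_phase.1 ht (0, i)
  have h1 := hasDerivAt_phase.1 ht (1, i)
  rw [PiLp.add_apply, PiLp.smul_apply, opA_apply_zero, vecB_zero, smul_zero, add_zero] at h0
  rw [PiLp.add_apply, PiLp.smul_apply, opA_apply_one, vecB_one, smul_eq_mul, mul_one] at h1
  exact ⟨h0, h1⟩

/-- The control of a singular curve cannot vanish. -/
lemma IsSingularCurve.ae_notMem (hpos : ∀ i, 0 < ω i) (hω : NonResonant ω)
    (h : IsSingularCurve ω M φ v) {S : Set ℝ} (hS : ∀ᵐ t, t ∈ S → v t = 0) : ∀ᵐ t, t ∉ S := by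
  refine ae_notMem_of_free hpos hω (p := fun t => momentum ω (φ t)) (fun t _ => h.inner_eq t)
    (fun t _ => momentum_ne_zero hpos (h.ne_zero t)) ?_
  filter_upwards [h.solves.ae_hasDerivAt, hS] with t h1 h2 ht
  rw [h2 ht, zero_smul, add_zero] at h1
  exact hasDerivAt_momentum_of_free hpos h.rho_eq h1

/-- While amplitude `l` vanishes, so do both coordinates of `φ` for that oscillator. Differentiating
its velocity leaves the control alone, which therefore vanishes almost everywhere on this set of
times; the set is then null. -/
lemma IsSingularCurve.ae_amplitude_pos (hpos : ∀ i, 0 < ω i) (hω : NonResonant ω)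
    (h : IsSingularCurve ω M φ v) : ∀ᵐ t, ∀ l, 0 < amplitude ω (momentum ω (φ t)) l := by
  refine ae_all_iff.2 fun l => ?_
  have hz : ∀ t, amplitude ω (momentum ω (φ t)) l = 0 → ∀ k, φ t (k, l) = 0 := fun t ht k => by
    rw [← gradH_momentum hpos (h.rho_eq t)]
    exact gradH_apply_eq_zero hpos (momentum_ne_zero hpos (h.ne_zero t)) ht k
  have := h.ae_notMem hpos hω (S := {t | amplitude ω (momentum ω (φ t)) l = 0}) (by
    have h1 := ae_deriv_eq_zero (S := {t | amplitude ω (momentum ω (φ t)) l = 0})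
      (fun t ht => hz t ht 1) ((ae_coord h.solves).mono fun t ht _ => (ht l).2)
    filter_upwards [h1] with t ht hS
    have := ht hS
    rwa [hz t hS 0, mul_zero, zero_add] at this)
  filter_upwards [this] with t ht
  exact lt_of_le_of_ne (amplitude_nonneg _ _ _) (Ne.symm ht)

end

/-- Equal amplitudes force `y₀ + y₁ = 0` and `ω₀² x₀² = ω₁² x₁²`. Differentiating these relations,
and using `ω₀ ≠ ω₁`, leaves only `φ = 0`, which is impossible on `∂Ω`. -/
lemma IsSingularCurve.ae_amplitude_ne {ω : Fin 2 → ℝ} {M : ℝ} {φ : ℝ → Phase 2} {v : ℝ → ℝ}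
    (hpos : ∀ i, 0 < ω i) (hω : NonResonant ω) (h : IsSingularCurve ω M φ v) :
    ∀ᵐ t, amplitude ω (momentum ω (φ t)) 0 ≠ amplitude ω (momentum ω (φ t)) 1 := by
  set S := {t | amplitude ω (momentum ω (φ t)) 0 = amplitude ω (momentum ω (φ t)) 1}
  have hne : ω 0 ^ 2 ≠ ω 1 ^ 2 := fun he => by
    have := @injective_neg_sq 2 ω hpos hω 0 1 (by simp [he])
    simp at this
  have hw0 := (hpos 0).ne'
  have hw1 := (hpos 1).ne'
  have hy : ∀ t ∈ S, φ t (1, 0) + φ t (1, 1) = 0 ∧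
      ω 0 ^ 2 * φ t (0, 0) ^ 2 = ω 1 ^ 2 * φ t (0, 1) ^ 2 := fun t ht => by
    have := gradH_of_amplitude_eq hpos (momentum_ne_zero hpos (h.ne_zero t)) (h.inner_eq t) ht
    rwa [gradH_momentum hpos (h.rho_eq t)] at this
  have hc := ae_coord h.solves
  have d1 := ae_deriv_eq_zero (S := S) (g := fun t => φ t (1, 0) + φ t (1, 1))
    (fun t ht => (hy t ht).1) (hc.mono fun t ht _ => (ht 0).2.fun_add (ht 1).2)
  have d2 := ae_deriv_eq_zero (S := S)
    (g := fun t => ω 0 ^ 2 * φ t (0, 0) ^ 2 - ω 1 ^ 2 * φ t (0, 1) ^ 2)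
    (fun t ht => sub_eq_zero.2 (hy t ht).2) (hc.mono fun t ht _ =>
      (((ht 0).1.fun_pow 2).const_mul _).fun_sub (((ht 1).1.fun_pow 2).const_mul _))
  have d3 := ae_deriv_eq_zero (S := {t | t ∈ S ∧ φ t (1, 0) = 0}) (g := fun t => φ t (1, 0))
    (fun t ht => ht.2) (hc.mono fun t ht _ => (ht 0).2)
  have d4 := ae_deriv_eq_zero (S := {t | φ t (0, 0) = 0}) (g := fun t => φ t (0, 0))
    (fun t ht => ht) (hc.mono fun t ht _ => (ht 0).1)
  filter_upwards [d1, d2, d3, d4] with t h1 h2 h3 h4 ht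
  obtain ⟨e1, e2⟩ := hy t ht
  have h1 := h1 ht
  have h2 := h2 ht
  simp only [Nat.cast_ofNat, Nat.add_one_sub_one, pow_one] at h2
  have e3 : φ t (1, 1) = -φ t (1, 0) := by linarith
  -- Two cases. If `y₀ = 0`, its derivative and that of `y₀ + y₁` eliminate the control and give
  -- `ω₀² x₀ = ω₁² x₁`. Otherwise `ω₀² x₀ = -ω₁² x₁`. Either relation and the equality of the
  -- squares give `x₀ = 0`.
  have e4 : φ t (1, 0) * (ω 0 ^ 2 * φ t (0, 0) + ω 1 ^ 2 * φ t (0, 1)) = 0 := by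
    rw [e3] at h2; linear_combination h2 / 2
  have hfin : φ t (0, 0) = 0 → φ t (1, 0) = 0 → False := by
    intro f0 f1
    have f2 : φ t (0, 1) = 0 := by
      rw [f0] at e2
      have : φ t (0, 1) ^ 2 = 0 := by
        have : ω 1 ^ 2 * φ t (0, 1) ^ 2 = 0 := by rw [← e2]; ring
        exact (mul_eq_zero.1 this).resolve_left (by positivity)
      exact pow_eq_zero_iff two_ne_zero |>.1 this
    refine h.ne_zero t (phase_ext (fun i => ?_) (fun i => ?_)) <;> fin_cases i
    · exact f0
    · exact f2
    · exact f1
    · simpa [f1] using e3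
  rcases mul_eq_zero.1 e4 with h5 | h5
  · refine hfin ?_ h5
    have h3 := h3 ⟨ht, h5⟩
    have e5 : ω 0 ^ 2 * φ t (0, 0) = ω 1 ^ 2 * φ t (0, 1) := by linarith
    have e6 : (ω 1 ^ 2 - ω 0 ^ 2) * (ω 0 ^ 2 * φ t (0, 0) ^ 2) = 0 := by
      linear_combination ω 1 ^ 2 * e2 - (ω 0 ^ 2 * φ t (0, 0) + ω 1 ^ 2 * φ t (0, 1)) * e5
    have := (mul_eq_zero.1 e6).resolve_left (sub_ne_zero.2 hne.symm)
    simpa [hw0] using this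
  · have e6 : (ω 1 ^ 2 - ω 0 ^ 2) * (ω 0 ^ 2 * φ t (0, 0) ^ 2) = 0 := by
      linear_combination ω 1 ^ 2 * e2 - (ω 0 ^ 2 * φ t (0, 0) - ω 1 ^ 2 * φ t (0, 1)) * h5
    have := (mul_eq_zero.1 e6).resolve_left (sub_ne_zero.2 hne.symm)
    have f0 : φ t (0, 0) = 0 := by simpa [hw0] using this
    exact hfin f0 (h4 f0)

section

variable {ω : Fin N → ℝ} {M : ℝ} {φ : ℝ → Phase N} {v : ℝ → ℝ}

lemma IsSingularCurve.ae_isRegular (hpos : ∀ i, 0 < ω i) (hω : NonResonant ω)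
    (h : IsSingularCurve ω M φ v) : ∀ᵐ t, IsRegular ω (momentum ω (φ t)) := by
  by_cases hN : N = 2
  · subst hN
    filter_upwards [h.ae_amplitude_pos hpos hω, h.ae_amplitude_ne hpos hω] with t h1 h2
    refine ⟨h1, fun _ i j hij => ?_⟩
    fin_cases i <;> fin_cases j
    · exact absurd rfl hij
    · exact h2
    · exact h2.symm
    · exact absurd rfl hij
  · filter_upwards [h.ae_amplitude_pos hpos hω] with t h1
    exact ⟨h1, fun h2 => absurd h2 hN⟩

/-- The momentum of a singular curve satisfies the dual system, and the driving control is the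
singular one. -/
lemma IsSingularCurve.ae_hasDerivAt_momentum (hpos : ∀ i, 0 < ω i) (hω : NonResonant ω)
    (h : IsSingularCurve ω M φ v) : ∀ᵐ t, singularControl ω (momentum ω (φ t)) = v t ∧
      HasDerivAt (fun s => momentum ω (φ s))
        (-(ContinuousLinearMap.adjoint (opA ω) (momentum ω (φ t))) +
          v t • tildeB ω (momentum ω (φ t))) t := by
  have hB : ∀ t, tildeB ω (momentum ω (φ t)) = fderiv ℝ (momentum ω) (φ t) (vecB N) := fun t => by
    rw [tildeB_eq hpos (momentum_spec hpos (h.ne_zero t)).1, gradH_momentum hpos (h.rho_eq t)]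
  have hd : ∀ᵐ t, HasDerivAt (fun s => momentum ω (φ s))
        (-(ContinuousLinearMap.adjoint (opA ω) (momentum ω (φ t))) +
          v t • tildeB ω (momentum ω (φ t))) t := by
    filter_upwards [h.ae_isRegular hpos hω, h.solves.ae_hasDerivAt] with t hr ht
    have hm := hr.differentiableAt_momentum hpos (h.rho_eq t)
    have := hm.hasFDerivAt.comp_hasDerivAt t ht
    rwa [map_add, map_smul, fderiv_momentum_opA hpos (h.ne_zero t) hm, ← hB] at this
  -- Where `(B̃, B) = 0` at a regular time, `B̃` itself vanishes by `fderiv_momentum_eq_zero`, so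
  -- the momentum moves freely there and such times form a null set. At the others, differentiating
  -- `(p, B) = 0` determines the control.
  have hnull := ae_notMem_of_free hpos hω (p := fun t => momentum ω (φ t))
    (S := {t | IsRegular ω (momentum ω (φ t)) ∧ ⟪tildeB ω (momentum ω (φ t)), vecB N⟫_ℝ = 0})
    (fun t _ => h.inner_eq t) (fun t _ => momentum_ne_zero hpos (h.ne_zero t)) (by
      filter_upwards [hd] with t ht hS
      have h0 : tildeB ω (momentum ω (φ t)) = 0 := by
        rw [hB]
        refine fderiv_momentum_eq_zero hpos (h.rho_eq t)
          (hS.1.differentiableAt_momentum hpos (h.rho_eq t)) (h.inner_eq t) ?_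
        rw [← hB]; exact hS.2
      rwa [h0, smul_zero, add_zero] at ht)
  filter_upwards [h.ae_isRegular hpos hω, hnull, hd] with t hr hn ht
  refine ⟨?_, ht⟩
  have hne : ⟪tildeB ω (momentum ω (φ t)), vecB N⟫_ℝ ≠ 0 := fun h0 => hn ⟨hr, h0⟩
  have h1 := ht.inner ℝ (hasDerivAt_const t (vecB N))
  have h2 : (fun s => ⟪momentum ω (φ s), vecB N⟫_ℝ) = fun _ => 0 := funext h.inner_eq
  rw [h2] at h1
  have h3 := h1.unique (hasDerivAt_const t 0)
  rw [inner_zero_right, zero_add, inner_add_left, inner_neg_left, inner_smul_left,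
    ContinuousLinearMap.adjoint_inner_left, conj_trivial] at h3
  rw [singularControl, div_eq_iff hne]
  linarith

lemma exists_norm_le_mul_rho (hpos : ∀ i, 0 < ω i) :
    ∃ C, 0 < C ∧ ∀ x : Phase N, ‖x‖ ≤ C * rho ω x := by
  obtain ⟨C, hC0, hC⟩ := exists_norm_torusVec_le ω
  refine ⟨C, hC0, fun x => ?_⟩
  by_cases hx : x = 0
  · simp [hx, rho_zero]
  have h1 := inner_le_rho_mul hpos x x
  have h2 := mul_le_mul_of_nonneg_left (suppH_le ω hC x) (rho_nonneg ω x)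
  rw [real_inner_self_eq_norm_sq] at h1
  have h3 := norm_pos_iff.2 hx
  nlinarith

lemma IsSingularCurve.isSingularTrajectory (hpos : ∀ i, 0 < ω i) (hω : NonResonant ω)
    (h : IsSingularCurve ω M φ v) : IsSingularTrajectory ω fun t => momentum ω (φ t) := by
  have hg : ∀ t, gradient (suppH ω) (momentum ω (φ t)) = φ t := fun t => by
    rw [gradient_suppH hpos (momentum_ne_zero hpos (h.ne_zero t)),
      gradH_momentum hpos (h.rho_eq t)]
  have hae := h.ae_hasDerivAt_momentum hpos hω
  refine ⟨fun t => (momentum_spec hpos (h.ne_zero t)).1, h.inner_eq, ?_, ?_⟩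
  · obtain ⟨C, -, hC⟩ := exists_norm_le_mul_rho hpos
    obtain ⟨L, hL⟩ := exists_lipschitz_momentum hpos
    have hbd : ∀ᵐ t, t ∈ Set.univ → ‖opA ω (φ t) + v t • vecB N‖ ≤ ‖opA ω‖ * C + M * ‖vecB N‖ := by
      filter_upwards [h.bound] with t ht _
      refine (norm_add_le _ _).trans (add_le_add ?_ ?_)
      · refine ((opA ω).le_opNorm _).trans ?_
        gcongr
        simpa [h.rho_eq] using hC (φ t)
      · rw [norm_smul, Real.norm_eq_abs]
        gcongr
    have hlip : LipschitzWith (‖opA ω‖ * C + M * ‖vecB N‖).toNNReal φ := by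
      refine LipschitzWith.of_dist_le_mul fun s t => ?_
      rw [dist_eq_norm, Real.dist_eq]
      refine (norm_sub_le_of_solvesOn h.solves Set.ordConnected_univ hbd trivial trivial).trans ?_
      gcongr
      exact Real.le_coe_toNNReal _
    have hlip2 : LipschitzOnWith (L * (‖opA ω‖ * C + M * ‖vecB N‖).toNNReal)
        (fun t => momentum ω (φ t)) Set.univ :=
      hL.comp (hlip.lipschitzOnWith) fun t _ => h.rho_eq t
    refine solvesOn_of_lipschitz Set.ordConnected_univ hlip2 (hae.mono fun t ht _ => ?_)
    rw [ht.1]; exact ht.2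
  · simp only [hg]
    intro s hs t ht
    obtain ⟨h1, h2⟩ := h.solves s hs t ht
    have heq : ∀ᵐ τ, opA ω (φ τ) + v τ • vecB N =
        opA ω (φ τ) + singularControl ω (momentum ω (φ τ)) • vecB N :=
      hae.mono fun τ hτ => by rw [hτ.1]
    refine ⟨h1.congr_ae (ae_restrict_of_ae heq), h2.trans ?_⟩
    exact intervalIntegral.integral_congr_ae (heq.mono fun τ hτ _ => hτ)

end

/-! ### Compactness of controlled motions -/

/-- A locally eventually bounded and equi-Lipschitz sequence of curves has a pointwise convergent
subsequence. -/
lemma exists_subseq_tendsto {E : Type*} [NormedAddCommGroup E] [ProperSpace E] {y : ℕ → ℝ → E}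
    {R K : ℝ} (hb : ∀ t, ∀ᶠ n in atTop, ‖y n t‖ ≤ R)
    (hl : ∀ s t, ∀ᶠ n in atTop, ‖y n t - y n s‖ ≤ K * |t - s|) :
    ∃ σ : ℕ → ℕ, StrictMono σ ∧ ∃ φ : ℝ → E, ∀ t,
      Tendsto (fun k => y (σ k) t) atTop (𝓝 (φ t)) := by
  have hR : 0 ≤ R := by
    obtain ⟨n, hn⟩ := (hb 0).exists
    exact (norm_nonneg _).trans hn
  have hK : 0 ≤ K := by
    obtain ⟨n, hn⟩ := (hl 0 1).exists
    simpa using (norm_nonneg _).trans hn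
  -- Values outside the ball are replaced by zero so that all sequences lie in one compact product
  -- over rational times. At a fixed time this changes only finitely many terms.
  let y' : ℕ → ℚ → E := fun n q => if ‖y n q‖ ≤ R then y n q else 0
  have hc : IsCompact (Set.pi Set.univ fun _ : ℚ => Metric.closedBall (0 : E) R) :=
    isCompact_univ_pi fun _ => isCompact_closedBall _ _
  obtain ⟨ψ, -, σ, hσ, hlim⟩ := hc.tendsto_subseq (x := y') fun n q _ => by
    simp only [y']
    split_ifs with h
    · simpa using h
    · simpa using hR
  have hq : ∀ q : ℚ, Tendsto (fun k => y (σ k) q) atTop (𝓝 (ψ q)) := fun q => by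
    refine (tendsto_pi_nhds.1 hlim q).congr' ?_
    filter_upwards [hσ.tendsto_atTop.eventually (hb q)] with k hk
    simp [y', hk]
  have hcau : ∀ t, CauchySeq fun k => y (σ k) t := fun t => by
    rw [Metric.cauchySeq_iff']
    intro ε hε
    obtain ⟨q, hq1, hq2⟩ := exists_rat_btwn (show t < t + ε / (4 * (K + 1)) by
      linarith [show 0 < ε / (4 * (K + 1)) by positivity])
    have hd : K * |(q : ℝ) - t| ≤ ε / 4 := by
      rw [abs_of_pos (by linarith)]
      calc K * ((q : ℝ) - t) ≤ (K + 1) * (ε / (4 * (K + 1))) := by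
            gcongr
            · linarith
            · linarith
        _ = ε / 4 := by field_simp
    have h1 := hσ.tendsto_atTop.eventually (hl t q)
    obtain ⟨n₀, hn₀⟩ := Metric.cauchySeq_iff.1 (hq q).cauchySeq (ε / 4) (by positivity)
    obtain ⟨n₁, hn₁⟩ := eventually_atTop.1 h1
    refine ⟨max n₀ n₁, fun n hn => ?_⟩
    have a1 := hn₁ n ((le_max_right _ _).trans hn)
    have a2 := hn₁ (max n₀ n₁) (le_max_right _ _)
    have a3 := hn₀ n ((le_max_left _ _).trans hn) (max n₀ n₁) (le_max_left _ _)
    rw [dist_eq_norm] at a3 ⊢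
    have e : y (σ n) t - y (σ (max n₀ n₁)) t = (y (σ n) q - y (σ (max n₀ n₁)) q) -
        (y (σ n) q - y (σ n) t) + (y (σ (max n₀ n₁)) q - y (σ (max n₀ n₁)) t) := by abel
    rw [e]
    have b1 := norm_add_le ((y (σ n) q - y (σ (max n₀ n₁)) q) - (y (σ n) q - y (σ n) t))
      (y (σ (max n₀ n₁)) q - y (σ (max n₀ n₁)) t)
    have b2 := norm_sub_le (y (σ n) q - y (σ (max n₀ n₁)) q) (y (σ n) q - y (σ n) t)
    linarith
  choose φ hφ using fun t => cauchySeq_tendsto_of_complete (hcau t)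
  exact ⟨σ, hσ, φ, hφ⟩

lemma vecB_ne_zero (hN : 0 < N) : vecB N ≠ 0 := fun h => by
  have := congrArg (fun x : Phase N => x (1, ⟨0, hN⟩)) h
  simp [vecB_one] at this

lemma norm_velocity_le (ω : Fin N → ℝ) {x : Phase N} {u R M : ℝ} (hx : ‖x‖ ≤ R) (hu : |u| ≤ M) :
    ‖opA ω x + u • vecB N‖ ≤ ‖opA ω‖ * R + M * ‖vecB N‖ := by
  refine (norm_add_le _ _).trans (add_le_add ?_ ?_)
  · exact ((opA ω).le_opNorm _).trans (by gcongr)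
  · rw [norm_smul, Real.norm_eq_abs]
    gcongr

lemma continuousOn_of_solvesOn {a b C : ℝ} {y w : ℝ → Phase N} (h : SolvesOn (Set.Icc a b) y w)
    (hC : ∀ᵐ t, t ∈ Set.Icc a b → ‖w t‖ ≤ C) : ContinuousOn y (Set.Icc a b) := by
  refine LipschitzOnWith.continuousOn (K := C.toNNReal) (LipschitzOnWith.of_dist_le_mul
    fun s hs t ht => ?_)
  rw [dist_eq_norm, Real.dist_eq]
  refine (norm_sub_le_of_solvesOn h Set.ordConnected_Icc hC ht hs).trans ?_
  gcongr
  exact Real.le_coe_toNNReal _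

lemma eventually_mem_Icc (t : ℝ) : ∀ᶠ n : ℕ in atTop, t ∈ Set.Icc (-(n : ℝ)) n := by
  filter_upwards [tendsto_natCast_atTop_atTop.eventually_ge_atTop |t|] with n hn
  exact abs_le.1 hn

/-- Compactness of the set of controlled motions. -/
lemma exists_limit_motion (hN : 0 < N) (ω : Fin N → ℝ) {y : ℕ → ℝ → Phase N} {w : ℕ → ℝ → ℝ}
    {R M₀ : ℝ} {M : ℕ → ℝ} (hM : Tendsto M atTop (𝓝 M₀))
    (hs : ∀ n : ℕ, SolvesOn (Set.Icc (-(n : ℝ)) n) (y n) fun t => opA ω (y n t) + w n t • vecB N)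
    (hb : ∀ n : ℕ, ∀ t ∈ Set.Icc (-(n : ℝ)) n, ‖y n t‖ ≤ R)
    (hw : ∀ n : ℕ, ∀ᵐ t, t ∈ Set.Icc (-(n : ℝ)) n → |w n t| ≤ M n) :
    ∃ σ : ℕ → ℕ, StrictMono σ ∧ ∃ (φ : ℝ → Phase N) (v : ℝ → ℝ),
      (∀ t, Tendsto (fun k => y (σ k) t) atTop (𝓝 (φ t))) ∧ Continuous φ ∧
      SolvesOn Set.univ φ (fun t => opA ω (φ t) + v t • vecB N) ∧ ∀ t, |v t| ≤ M₀ := by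
  obtain ⟨M', hM'⟩ := hM.bddAbove_range
  have hM' : ∀ n, M n ≤ M' := fun n => hM' ⟨n, rfl⟩
  set K := ‖opA ω‖ * R + M' * ‖vecB N‖ with hKdef
  have hvel : ∀ n : ℕ, ∀ᵐ t, t ∈ Set.Icc (-(n : ℝ)) n → ‖opA ω (y n t) + w n t • vecB N‖ ≤ K :=
    fun n => (hw n).mono fun t ht hI =>
      norm_velocity_le ω (hb n t hI) ((ht hI).trans (hM' n))
  have hev : ∀ s t : ℝ, ∀ᶠ n : ℕ in atTop, Set.uIcc s t ⊆ Set.Icc (-(n : ℝ)) n := fun s t => by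
    filter_upwards [eventually_mem_Icc s, eventually_mem_Icc t] with n h1 h2
    exact Set.ordConnected_Icc.uIcc_subset h1 h2
  have hlip : ∀ s t, ∀ᶠ n in atTop, ‖y n t - y n s‖ ≤ K * |t - s| := fun s t => by
    filter_upwards [hev s t] with n hn
    exact norm_sub_le_of_solvesOn (hs n) Set.ordConnected_Icc (hvel n) (hn Set.left_mem_uIcc)
      (hn Set.right_mem_uIcc)
  obtain ⟨σ, hσ, φ, hφ⟩ := exists_subseq_tendsto (R := R) (fun t => by
    filter_upwards [eventually_mem_Icc t] with n hn using hb n t hn) hlip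
  have hσt := hσ.tendsto_atTop
  have hφlip : ∀ s t, ‖φ t - φ s‖ ≤ K * |t - s| := fun s t =>
    le_of_tendsto ((hφ t).sub (hφ s)).norm (hσt.eventually (hlip s t))
  have hK : 0 ≤ K := by simpa using (norm_nonneg _).trans (hφlip 0 1)
  have hφc : Continuous φ := by
    refine (LipschitzWith.of_dist_le_mul (K := K.toNNReal) fun t s => ?_).continuous
    rw [dist_eq_norm, Real.dist_eq, Real.coe_toNNReal _ hK]
    exact hφlip s t
  have hB := vecB_ne_zero hN
  have hBn : 0 < ‖vecB N‖ ^ 2 := by have := norm_pos_iff.2 hB; positivity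
  have hAint : ∀ s t, IntervalIntegrable (fun τ => opA ω (φ τ)) volume s t := fun s t =>
    ((opA ω).continuous.comp hφc).intervalIntegrable _ _
  -- the limit of the controlled part of the displacement
  let D : ℝ → ℝ → Phase N := fun s t => φ t - φ s - ∫ τ in s..t, opA ω (φ τ)
  have hD : ∀ s t, Tendsto (fun k => (∫ τ in s..t, w (σ k) τ) • vecB N) atTop (𝓝 (D s t)) := by
    intro s t
    have hintegr : Tendsto (fun k => ∫ τ in s..t, opA ω (y (σ k) τ)) atTop
        (𝓝 (∫ τ in s..t, opA ω (φ τ))) := by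
      refine intervalIntegral.tendsto_integral_filter_of_dominated_convergence
        (fun _ => ‖opA ω‖ * R) ?_ ?_ intervalIntegrable_const ?_
      · filter_upwards [hσt.eventually (hev s t)] with k hk
        have hc := (continuousOn_of_solvesOn (hs (σ k)) (hvel (σ k))).mono hk
        exact (((opA ω).continuous.comp_continuousOn hc).mono
          Set.uIoc_subset_uIcc).aestronglyMeasurable measurableSet_uIoc
      · filter_upwards [hσt.eventually (hev s t)] with k hk
        refine .of_forall fun τ hτ => ((opA ω).le_opNorm _).trans ?_
        gcongr
        exact hb _ _ (hk (Set.uIoc_subset_uIcc hτ))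
      · exact .of_forall fun τ _ => ((opA ω).continuous.tendsto _).comp (hφ τ)
    refine (((hφ t).sub (hφ s)).sub hintegr).congr' ?_
    filter_upwards [hσt.eventually (hev s t)] with k hk
    obtain ⟨h1, h2⟩ := hs (σ k) s (hk Set.left_mem_uIcc) t (hk Set.right_mem_uIcc)
    have hc := (continuousOn_of_solvesOn (hs (σ k)) (hvel (σ k))).mono hk
    have h3 : IntervalIntegrable (fun τ => opA ω (y (σ k) τ)) volume s t :=
      ((opA ω).continuous.comp_continuousOn hc).intervalIntegrable
    have h4 : IntervalIntegrable (fun τ => w (σ k) τ • vecB N) volume s t := by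
      simpa using h1.sub h3
    rw [h2, intervalIntegral.integral_add h3 h4, add_sub_cancel_left,
      intervalIntegral.integral_smul_const]
  have hcoef : ∀ s t, ∀ᶠ k in atTop, |∫ τ in s..t, w (σ k) τ| ≤ M (σ k) * |t - s| := fun s t => by
    filter_upwards [hσt.eventually (hev s t)] with k hk
    rw [← Real.norm_eq_abs]
    refine intervalIntegral.norm_integral_le_of_norm_le_const_ae ((hw (σ k)).mono fun τ hτ hm => ?_)
    exact hτ (hk (Set.uIoc_subset_uIcc hm))
  -- The controls converge only weakly. Their integrals converge, being the coefficient of `B` in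
  -- the limit displacement `D`, and the limit control is recovered as the derivative of the
  -- Lipschitz function `c 0`.
  let c : ℝ → ℝ → ℝ := fun s t => ⟪D s t, vecB N⟫_ℝ / ‖vecB N‖ ^ 2
  have hc : ∀ s t, Tendsto (fun k => ∫ τ in s..t, w (σ k) τ) atTop (𝓝 (c s t)) := fun s t => by
    refine (((hD s t).inner tendsto_const_nhds).div_const (‖vecB N‖ ^ 2)).congr fun k => ?_
    rw [inner_smul_left, conj_trivial, real_inner_self_eq_norm_sq, mul_div_cancel_right₀ _ hBn.ne']
  have hDc : ∀ s t, D s t = c s t • vecB N := fun s t =>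
    tendsto_nhds_unique (hD s t) ((hc s t).smul_const _)
  have hcM : ∀ s t, |c s t| ≤ M₀ * |t - s| := fun s t =>
    le_of_tendsto_of_tendsto (hc s t).abs ((hM.comp hσt).mul_const _) (hcoef s t)
  have hM0 : 0 ≤ M₀ := by simpa using (abs_nonneg _).trans (hcM 0 1)
  have hcadd : ∀ s t, c s t = c 0 t - c 0 s := fun s t => by
    have : D s t = D 0 t - D 0 s := by
      have := intervalIntegral.integral_add_adjacent_intervals (hAint 0 s) (hAint s t)
      simp only [D]
      rw [← this]
      abel
    simp only [c]
    rw [this, inner_sub_left, sub_div]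
  have hWlip : LipschitzWith M₀.toNNReal (c 0) := LipschitzWith.of_dist_le_mul fun t s => by
    rw [Real.dist_eq, Real.dist_eq, ← hcadd, Real.coe_toNNReal _ hM0]
    exact hcM s t
  refine ⟨σ, hσ, φ, deriv (c 0), hφ, hφc, ?_, fun t => ?_⟩
  · intro s _ t _
    have hac := hWlip.lipschitzOnWith.absolutelyContinuousOnInterval (a := s) (b := t)
    have hi : IntervalIntegrable (fun τ => deriv (c 0) τ • vecB N) volume s t :=
      ⟨hac.intervalIntegrable_deriv.1.smul_const _, hac.intervalIntegrable_deriv.2.smul_const _⟩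
    refine ⟨(hAint s t).add hi, ?_⟩
    rw [intervalIntegral.integral_add (hAint s t) hi, intervalIntegral.integral_smul_const,
      hac.integral_deriv_eq_sub, ← hcadd, ← hDc]
    simp only [D]
    abel
  · have := norm_deriv_le_of_lipschitz (x₀ := t) hWlip
    rwa [Real.coe_toNNReal _ hM0] at this

/-! ### The number `μ` and the stationary motion -/

variable {ω : Fin N → ℝ}

lemma IsSingularTrajectory.isSingularCurve (hpos : ∀ i, 0 < ω i) {p : ℝ → Phase N}
    (h : IsSingularTrajectory ω p) {K : ℝ} (hK : ∀ᵐ t, |singularControl ω (p t)| ≤ K) :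
    IsSingularCurve ω K (fun t => gradH ω (p t)) fun t => singularControl ω (p t) := by
  obtain ⟨h1, h2, -, h4⟩ := h
  have h0 : ∀ t, p t ≠ 0 := fun t => ne_zero_of_suppH_eq_one (h1 t)
  refine ⟨fun t => rho_gradH hpos (h0 t), fun t => ?_, ?_, hK⟩
  · rw [momentum_gradH hpos (h1 t)]; exact h2 t
  · simpa only [gradient_suppH hpos (h0 _)] using h4

lemma isLeast_essential_bound {f : ℝ → ℝ} {M : ℝ} (hM : ∀ᵐ t, |f t| ≤ M) :
    ∃ K ≤ M, IsLeast {M : ℝ | ∀ᵐ t, |f t| ≤ M} K := by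
  have hbd : BddBelow {M : ℝ | ∀ᵐ t, |f t| ≤ M} := ⟨0, fun L hL => by
    obtain ⟨t, ht⟩ := Eventually.exists (f := ae volume) hL
    exact (abs_nonneg _).trans ht⟩
  refine ⟨sInf {M : ℝ | ∀ᵐ t, |f t| ≤ M}, csInf_le hbd hM, ?_, fun L hL => csInf_le hbd hL⟩
  have h1 : ∀ n : ℕ, ∀ᵐ t, |f t| ≤ sInf {M : ℝ | ∀ᵐ t, |f t| ≤ M} + 1 / ((n : ℝ) + 1) := fun n => by
    obtain ⟨L, hL, hlt⟩ := exists_lt_of_csInf_lt (s := {M : ℝ | ∀ᵐ t, |f t| ≤ M}) ⟨M, hM⟩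
      (lt_add_of_pos_right _ (by positivity : 0 < 1 / ((n : ℝ) + 1)))
    exact Eventually.mono (f := ae volume) hL fun t ht => ht.trans hlt.le
  refine Eventually.mono (f := ae volume) (ae_all_iff.2 h1) fun t ht => ?_
  have hlim : Tendsto (fun n : ℕ => sInf {M : ℝ | ∀ᵐ t, |f t| ≤ M} + 1 / ((n : ℝ) + 1)) atTop
      (𝓝 (sInf {M : ℝ | ∀ᵐ t, |f t| ≤ M})) := by
    simpa using tendsto_one_div_add_atTop_nhds_zero_nat.const_add (sInf {M : ℝ | ∀ᵐ t, |f t| ≤ M})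
  exact ge_of_tendsto' hlim ht

/-- The bridge from curves to `μ`: a bound for the driving control of any singular curve is an upper
bound for `μ`. Unlike trajectories of the dual system, singular curves are stable under limits. -/
lemma IsSingularCurve.exists_mem_singularMaxima (hpos : ∀ i, 0 < ω i) (hω : NonResonant ω)
    {M : ℝ} {φ : ℝ → Phase N} {v : ℝ → ℝ} (h : IsSingularCurve ω M φ v) :
    ∃ K ≤ M, K ∈ singularMaxima ω := by
  have hM : ∀ᵐ t, |singularControl ω (momentum ω (φ t))| ≤ M := by
    filter_upwards [h.ae_hasDerivAt_momentum hpos hω, h.bound] with t h1 h2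
    rwa [h1.1]
  obtain ⟨K, hKM, hK⟩ := isLeast_essential_bound hM
  exact ⟨K, hKM, _, h.isSingularTrajectory hpos hω, hK⟩

lemma bddBelow_singularMaxima : BddBelow (singularMaxima ω) := by
  refine ⟨0, ?_⟩
  rintro K ⟨p, -, hK⟩
  obtain ⟨t, ht⟩ := Eventually.exists (f := ae volume) hK.1
  exact (abs_nonneg _).trans ht

/-- The equilibrium under a constant control is a singular curve. -/
lemma singularMaxima_nonempty (hN : 0 < N) (hpos : ∀ i, 0 < ω i) (hω : NonResonant ω) :
    (singularMaxima ω).Nonempty := by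
  set q : Phase N := phaseMk (fun i => ((ω i) ^ 2)⁻¹) 0
  have hAq : opA ω q = -vecB N := by
    refine phase_ext (fun i => ?_) (fun i => ?_)
    · simp [q, opA_apply_zero, vecB_zero]
    · have := (hpos i).ne'
      simp [q, opA_apply_one, vecB_one, this]
  have hq : q ≠ 0 := fun h => by
    rw [h, map_zero, zero_eq_neg] at hAq
    exact vecB_ne_zero hN hAq
  have hr := rho_pos hpos hq
  have hrho := rho_normalize hpos hq
  have hne : (rho ω q)⁻¹ • q ≠ 0 := smul_ne_zero (inv_ne_zero hr.ne') hq
  have hsc : IsSingularCurve ω |(rho ω q)⁻¹| (fun _ => (rho ω q)⁻¹ • q) fun _ => (rho ω q)⁻¹ := by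
    refine ⟨fun _ => hrho, fun _ => ?_, fun s _ t _ => ?_, .of_forall fun _ => le_rfl⟩
    -- The equilibrium satisfies `A q = -B`, and `A q` is orthogonal to the momentum, so the point
    -- lies on the switching surface.
    · have := inner_momentum_opA hpos hne
      rw [map_smul, hAq, inner_smul_right, inner_neg_right] at this
      simpa [hr.ne'] using this
    · simp [map_smul, hAq]
  obtain ⟨K, -, hK⟩ := hsc.exists_mem_singularMaxima hpos hω
  exact ⟨K, hK⟩

lemma exists_isSingularCurve_mu (hN : 0 < N) (hpos : ∀ i, 0 < ω i) (hω : NonResonant ω) :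
    ∃ φ v, IsSingularCurve ω (mu ω) φ v := by
  obtain ⟨K, -, hlim, hmem⟩ := exists_seq_tendsto_sInf (singularMaxima_nonempty hN hpos hω)
    bddBelow_singularMaxima
  choose p hp hmax using hmem
  have hsc := fun n => (hp n).isSingularCurve hpos (hmax n).1
  obtain ⟨C, -, hC⟩ := exists_norm_le_mul_rho hpos
  obtain ⟨σ, -, φ, v, hφ, -, hs, hv⟩ := exists_limit_motion hN ω (R := C) hlim
    (fun n => (hsc n).solves.mono (Set.subset_univ _))
    (fun n t _ => by simpa [(hsc n).rho_eq t] using hC (gradH ω (p n t)))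
    (fun n => (hsc n).bound.mono fun t ht _ => ht)
  have hrho : ∀ t, rho ω (φ t) = 1 := fun t => by
    refine tendsto_nhds_unique (((continuous_rho hpos).tendsto _).comp (hφ t)) ?_
    simp only [Function.comp_def, (hsc _).rho_eq t]
    exact tendsto_const_nhds
  refine ⟨φ, v, hrho, fun t => ?_, hs, .of_forall hv⟩
  have h0 : φ t ≠ 0 := ne_zero_of_rho_pos (by rw [hrho]; exact one_pos)
  refine tendsto_nhds_unique
    (((continuousAt_momentum hpos h0).tendsto.comp (hφ t)).inner tendsto_const_nhds) ?_
  simp only [Function.comp_def, (hsc _).inner_eq t]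
  exact tendsto_const_nhds

lemma isLeast_mu (hN : 0 < N) (hpos : ∀ i, 0 < ω i) (hω : NonResonant ω) :
    IsLeast (singularMaxima ω) (mu ω) := by
  obtain ⟨φ, v, h⟩ := exists_isSingularCurve_mu hN hpos hω
  obtain ⟨K, hK, hmem⟩ := h.exists_mem_singularMaxima hpos hω
  have : K = mu ω := le_antisymm hK (csInf_le bddBelow_singularMaxima hmem)
  exact ⟨this ▸ hmem, fun L hL => csInf_le bddBelow_singularMaxima hL⟩

/-- If `μ ≤ 0`, a minimizing singular curve would have zero control at almost all times. -/
lemma mu_pos (hN : 0 < N) (hpos : ∀ i, 0 < ω i) (hω : NonResonant ω) : 0 < mu ω := by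
  obtain ⟨φ, v, h⟩ := exists_isSingularCurve_mu hN hpos hω
  by_contra! hmu
  have := h.ae_notMem hpos hω (S := Set.univ) (h.bound.mono fun t ht _ =>
    abs_nonpos_iff.1 (ht.trans hmu))
  obtain ⟨t, ht⟩ := this.exists
  exact ht trivial

lemma SolvesOn.const_smul {I : Set ℝ} {y : ℝ → Phase N} {u : ℝ → ℝ}
    (h : SolvesOn I y fun t => opA ω (y t) + u t • vecB N) (c : ℝ) :
    SolvesOn I (fun t => c • y t) fun t => opA ω (c • y t) + (c * u t) • vecB N := by
  intro s hs t ht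
  obtain ⟨h1, h2⟩ := h s hs t ht
  have he : (fun t => opA ω (c • y t) + (c * u t) • vecB N) =
      fun t => c • (opA ω (y t) + u t • vecB N) := by
    ext1 t; rw [map_smul, smul_add, mul_smul]
  rw [he]
  refine ⟨⟨h1.1.smul c, h1.2.smul c⟩, ?_⟩
  rw [intervalIntegral.integral_smul, ← h2, smul_sub]

/-- Scaling by `μ⁻¹` keeps the momentum and multiplies the control by `μ⁻¹`, so it becomes
admissible; on the switching surface the feedback allows any value in `[-1, 1]`. -/
lemma exists_stationary_motion (hN : 0 < N) (hpos : ∀ i, 0 < ω i) (hω : NonResonant ω) :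
    ∃ x : ℝ → Phase N, IsMotion ω Set.univ x ∧ ∀ t, rho ω (x t) = (mu ω)⁻¹ := by
  obtain ⟨φ, v, h⟩ := exists_isSingularCurve_mu hN hpos hω
  have hmu := mu_pos hN hpos hω
  have hmu' : 0 < (mu ω)⁻¹ := inv_pos.2 hmu
  refine ⟨fun t => (mu ω)⁻¹ • φ t, ⟨fun t => (mu ω)⁻¹ * v t, h.solves.const_smul _, ?_⟩, fun t => ?_⟩
  · rw [Measure.restrict_univ]
    filter_upwards [h.bound] with t ht
    refine ⟨_, isMomentum_momentum hpos (smul_ne_zero hmu'.ne' (h.ne_zero t)), ?_⟩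
    rw [momentum_smul hpos (h.ne_zero t) hmu', real_inner_comm, h.inner_eq, signSet, if_pos rfl]
    have : |(mu ω)⁻¹ * v t| ≤ 1 := by
      rw [abs_mul, abs_of_pos hmu']
      exact (mul_le_mul_of_nonneg_left ht hmu'.le).trans (inv_mul_cancel₀ hmu.ne').le
    exact ⟨by linarith [(abs_le.1 this).2], by linarith [(abs_le.1 this).1]⟩
  · rw [rho_smul ω hmu'.le, h.rho_eq, mul_one]

/-! ### Decrease of the radius along motions -/

lemma of_neg_mem_signSet {u s : ℝ} (h : -u ∈ signSet s) : |u| ≤ 1 ∧ u * s = -|s| := by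
  rw [signSet] at h
  split_ifs at h with hs
  · subst hs
    exact ⟨abs_le.2 ⟨by linarith [h.2], by linarith [h.1]⟩, by simp⟩
  · have hu : u = -Real.sign s := by rw [← h, neg_neg]
    rcases lt_or_gt_of_ne hs with hs | hs
    · rw [hu, Real.sign_of_neg hs, abs_of_neg hs]; norm_num
    · rw [hu, Real.sign_of_pos hs, abs_of_pos hs]; norm_num

lemma IsMotion.control (hpos : ∀ i, 0 < ω i) {a b : ℝ} {x : ℝ → Phase N}
    (h : IsMotion ω (Set.Icc a b) x) : ∃ u : ℝ → ℝ,
      SolvesOn (Set.Icc a b) x (fun t => opA ω (x t) + u t • vecB N) ∧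
      (∀ᵐ t, t ∈ Set.Icc a b → |u t| ≤ 1) ∧
      ∀ᵐ t, t ∈ Set.Icc a b → u t * ⟪momentum ω (x t), vecB N⟫_ℝ =
        -|⟪momentum ω (x t), vecB N⟫_ℝ| := by
  obtain ⟨u, hs, hu⟩ := h
  rw [ae_restrict_iff' measurableSet_Icc] at hu
  have key : ∀ᵐ t, t ∈ Set.Icc a b → |u t| ≤ 1 ∧ u t * ⟪momentum ω (x t), vecB N⟫_ℝ =
      -|⟪momentum ω (x t), vecB N⟫_ℝ| := by
    filter_upwards [hu] with t ht hI
    obtain ⟨p, hp, hpu⟩ := ht hI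
    rw [(hp.eq hpos).2, real_inner_comm] at hpu
    exact of_neg_mem_signSet hpu
  exact ⟨u, hs, key.mono fun t ht hI => (ht hI).1, key.mono fun t ht hI => (ht hI).2⟩

lemma SolvesOn.continuousOn {a b : ℝ} {y w : ℝ → Phase N} (h : SolvesOn (Set.Icc a b) y w) :
    ContinuousOn y (Set.Icc a b) := by
  by_cases hab : a ≤ b
  · have ha : a ∈ Set.Icc a b := Set.left_mem_Icc.2 hab
    have hi := (h a ha b (Set.right_mem_Icc.2 hab)).1
    have hc := intervalIntegral.continuousOn_primitive_interval' hi Set.left_mem_uIcc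
    rw [Set.uIcc_of_le hab] at hc
    refine ((continuousOn_const (c := y a)).add hc).congr fun t ht => ?_
    change y t = y a + ∫ τ in a..t, w τ
    rw [← (h a ha t ht).2]
    abel
  · rw [Set.Icc_eq_empty hab]; exact continuousOn_empty _

/-- The decrease of `rho` along a motion. -/
lemma IsMotion.rho_sub_rho (hpos : ∀ i, 0 < ω i) {a b : ℝ} {x : ℝ → Phase N}
    (h : IsMotion ω (Set.Icc a b) x) (h0 : ∀ t ∈ Set.Icc a b, x t ≠ 0) {s t : ℝ}
    (hs : s ∈ Set.Icc a b) (ht : t ∈ Set.Icc a b) : rho ω (x s) - rho ω (x t) =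
      ∫ τ in s..t, |⟪momentum ω (x τ), vecB N⟫_ℝ| := by
  obtain ⟨u, hsol, hu1, hu2⟩ := h.control hpos
  obtain ⟨R, hR⟩ := isCompact_Icc.exists_bound_of_continuousOn hsol.continuousOn
  obtain ⟨L, hL⟩ := exists_lipschitz_rho hpos
  have hvel : ∀ᵐ t, t ∈ Set.Icc a b → ‖opA ω (x t) + u t • vecB N‖ ≤ ‖opA ω‖ * R + 1 * ‖vecB N‖ :=
    hu1.mono fun t ht hI => norm_velocity_le ω (hR t hI) (ht hI)
  have hlip : LipschitzOnWith (‖opA ω‖ * R + 1 * ‖vecB N‖).toNNReal x (Set.Icc a b) :=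
    LipschitzOnWith.of_dist_le_mul fun s hs t ht => by
      rw [dist_eq_norm, Real.dist_eq]
      refine (norm_sub_le_of_solvesOn hsol Set.ordConnected_Icc hvel ht hs).trans ?_
      gcongr
      exact Real.le_coe_toNNReal _
  have hsub : Set.uIcc s t ⊆ Set.Icc a b := Set.ordConnected_Icc.uIcc_subset hs ht
  have hac := ((hL.comp_lipschitzOnWith hlip).mono hsub).absolutelyContinuousOnInterval
  have hftc := hac.integral_deriv_eq_sub
  have hder : ∫ τ in s..t, deriv (rho ω ∘ x) τ =
      ∫ τ in s..t, -|⟪momentum ω (x τ), vecB N⟫_ℝ| := by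
    refine intervalIntegral.integral_congr_ae ?_
    filter_upwards [hsol.ae_hasDerivAt_Icc, hu2, (Set.countable_singleton a).ae_notMem volume,
      (Set.countable_singleton b).ae_notMem volume] with τ h1 h2 h3 h4 h5
    have hI := hsub (Set.uIoc_subset_uIcc h5)
    have hIoo : τ ∈ Set.Ioo a b := ⟨lt_of_le_of_ne hI.1 (Ne.symm h3), lt_of_le_of_ne hI.2 h4⟩
    -- The free part of the velocity is tangent to the level sets of `ρ`, and the feedback makes the
    -- control part equal to `-|(B, p)|`.
    have h6 := (hasGradientAt_rho hpos (h0 τ hI)).hasFDerivAt.comp_hasDerivAt τ (h1 hIoo)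
    rw [h6.deriv, InnerProductSpace.toDual_apply_apply, inner_add_right, inner_smul_right,
      inner_momentum_opA hpos (h0 τ hI), zero_add, h2 hI]
  rw [hder, intervalIntegral.integral_neg] at hftc
  simp only [Function.comp_apply] at hftc
  linarith

lemma IsMotion.rho_antitone (hpos : ∀ i, 0 < ω i) {a b : ℝ} {x : ℝ → Phase N}
    (h : IsMotion ω (Set.Icc a b) x) (h0 : ∀ t ∈ Set.Icc a b, x t ≠ 0) {s t : ℝ}
    (hs : s ∈ Set.Icc a b) (ht : t ∈ Set.Icc a b) (hst : s ≤ t) : rho ω (x t) ≤ rho ω (x s) := by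
  have h1 := h.rho_sub_rho hpos h0 hs ht
  have h2 : 0 ≤ ∫ τ in s..t, |⟪momentum ω (x τ), vecB N⟫_ℝ| :=
    intervalIntegral.integral_nonneg hst fun _ _ => abs_nonneg _
  linarith

lemma IsMotion.mono {a b c d : ℝ} {x : ℝ → Phase N} (h : IsMotion ω (Set.Icc a b) x)
    (hsub : Set.Icc c d ⊆ Set.Icc a b) : IsMotion ω (Set.Icc c d) x := by
  obtain ⟨u, h1, h2⟩ := h
  exact ⟨u, h1.mono hsub, ae_restrict_of_ae_restrict_of_subset hsub h2⟩

lemma IsMotion.comp_add {a b d : ℝ} {x : ℝ → Phase N}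
    (h : IsMotion ω (Set.Icc (a + d) (b + d)) x) :
    IsMotion ω (Set.Icc a b) fun t => x (t + d) := by
  obtain ⟨u, h1, h2⟩ := h
  have hmem : ∀ t ∈ Set.Icc a b, t + d ∈ Set.Icc (a + d) (b + d) := fun t ht =>
    ⟨by linarith [ht.1], by linarith [ht.2]⟩
  refine ⟨fun t => u (t + d), fun s hs t ht => ?_, ?_⟩
  · obtain ⟨h3, h4⟩ := h1 _ (hmem s hs) _ (hmem t ht)
    refine ⟨?_, ?_⟩
    · simpa using h3.comp_add_right d
    · rw [h4]
      exact (intervalIntegral.integral_comp_add_right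
        (fun τ => opA ω (x τ) + u τ • vecB N) d).symm
  · rw [ae_restrict_iff' measurableSet_Icc] at h2 ⊢
    have := (measurePreserving_add_right volume d).quasiMeasurePreserving.ae h2
    filter_upwards [this] with t ht hI
    exact ht (hmem t hI)

lemma exists_norm_momentum_le (hpos : ∀ i, 0 < ω i) :
    ∃ C, ∀ x : Phase N, x ≠ 0 → ‖momentum ω x‖ ≤ C := by
  obtain ⟨m, hm, h⟩ := exists_mul_norm_le_suppH hpos
  refine ⟨m⁻¹, fun x hx => ?_⟩
  have := h (momentum ω x)
  rw [(momentum_spec hpos hx).1] at this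
  rwa [inv_eq_one_div, le_div_iff₀' hm]

/-- Motions on growing intervals along which `rho` is bounded below by `r` and almost constant
yield, after rescaling, a singular curve with control bounded by `r⁻¹`. -/
lemma exists_isSingularCurve_of_motions (hN : 0 < N) (hpos : ∀ i, 0 < ω i) {r : ℝ} (hr : 0 < r)
    (h : ∀ n : ℕ, 0 < n → ∃ x : ℝ → Phase N, IsMotion ω (Set.Icc (-(n : ℝ)) n) x ∧
      (∀ t ∈ Set.Icc (-(n : ℝ)) n, r ≤ rho ω (x t)) ∧
      rho ω (x (-(n : ℝ))) - rho ω (x n) < 1 / n) :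
    ∃ φ v, IsSingularCurve ω r⁻¹ φ v := by
  -- The index is shifted to `n + 1` so that it is positive; the limit is taken on the smaller
  -- intervals `[-n, n]`.
  choose x hmot hlow hdrop using fun n : ℕ => h (n + 1) n.succ_pos
  push_cast at hmot hlow hdrop
  have hIcc : ∀ n : ℕ, Set.Icc (-(n : ℝ)) n ⊆ Set.Icc (-((n : ℝ) + 1)) (n + 1) := fun n =>
    Set.Icc_subset_Icc (by linarith) (by linarith)
  have hne : ∀ n : ℕ, ∀ t ∈ Set.Icc (-((n : ℝ) + 1)) (n + 1), x n t ≠ 0 := fun n t ht =>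
    ne_zero_of_rho_pos (hr.trans_le (hlow n t ht))
  have h00 : ∀ n : ℕ, (0 : ℝ) ∈ Set.Icc (-((n : ℝ) + 1)) (n + 1) := fun n =>
    ⟨by linarith [n.cast_nonneg (α := ℝ)], by linarith [n.cast_nonneg (α := ℝ)]⟩
  have hl : ∀ n : ℕ, -((n : ℝ) + 1) ∈ Set.Icc (-((n : ℝ) + 1)) (n + 1) := fun n =>
    Set.left_mem_Icc.2 (by linarith [n.cast_nonneg (α := ℝ)])
  have hrr : ∀ n : ℕ, (n : ℝ) + 1 ∈ Set.Icc (-((n : ℝ) + 1)) (n + 1) := fun n =>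
    Set.right_mem_Icc.2 (by linarith [n.cast_nonneg (α := ℝ)])
  have hclose : ∀ n : ℕ, ∀ s ∈ Set.Icc (-((n : ℝ) + 1)) (n + 1),
      ∀ t ∈ Set.Icc (-((n : ℝ) + 1)) (n + 1), rho ω (x n s) - rho ω (x n t) ≤ 1 / ((n : ℝ) + 1) := by
    intro n s hs t ht
    have h1 := (hmot n).rho_antitone hpos (hne n) (hl n) hs hs.1
    have h2 := (hmot n).rho_antitone hpos (hne n) ht (hrr n) ht.2
    linarith [hdrop n]
  choose u hsol hu1 hu2 using fun n => (hmot n).control hpos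
  -- Dividing by the radius at time zero brings the curves close to `∂Ω`, as the radius varies by at
  -- most `1 / (n + 1)`. The scaled controls are bounded by `r⁻¹`.
  set c : ℕ → ℝ := fun n => (rho ω (x n 0))⁻¹
  have hc0 : ∀ n, 0 < c n := fun n => inv_pos.2 (hr.trans_le (hlow n 0 (h00 n)))
  have hcr : ∀ n, c n ≤ r⁻¹ := fun n => inv_anti₀ hr (hlow n 0 (h00 n))
  have hrho : ∀ n : ℕ, ∀ t ∈ Set.Icc (-((n : ℝ) + 1)) (n + 1),
      |rho ω (c n • x n t) - 1| ≤ r⁻¹ * (1 / ((n : ℝ) + 1)) := by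
    intro n t ht
    have e : rho ω (c n • x n t) - 1 = c n * (rho ω (x n t) - rho ω (x n 0)) := by
      have : rho ω (x n 0) ≠ 0 := (hr.trans_le (hlow n 0 (h00 n))).ne'
      rw [rho_smul ω (hc0 n).le, mul_sub, inv_mul_cancel₀ this]
    rw [e, abs_mul, abs_of_pos (hc0 n)]
    refine mul_le_mul (hcr n) (abs_le.2 ⟨?_, hclose n t ht 0 (h00 n)⟩) (abs_nonneg _)
      (inv_pos.2 hr).le
    linarith [hclose n 0 (h00 n) t ht]
  obtain ⟨C, hC0, hC⟩ := exists_norm_le_mul_rho hpos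
  obtain ⟨σ, hσ, φ, v, hφ, hφc, hs, hv⟩ := exists_limit_motion hN ω (R := C * (1 + r⁻¹))
    (M := fun _ => r⁻¹) tendsto_const_nhds
    (fun n => ((hsol n).mono (hIcc n)).const_smul (c n))
    (fun n t ht => by
      refine (hC _).trans ?_
      gcongr
      have h1 := (abs_le.1 (hrho n t (hIcc n ht))).2
      have h2 : 1 / ((n : ℝ) + 1) ≤ 1 := by
        rw [div_le_one (by positivity)]; linarith [n.cast_nonneg (α := ℝ)]
      have h3 := mul_le_mul_of_nonneg_left h2 (inv_pos.2 hr).le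
      linarith)
    (fun n => (hu1 n).mono fun t ht hI => by
      rw [abs_mul, abs_of_pos (hc0 n)]
      calc c n * |u n t| ≤ r⁻¹ * 1 :=
            mul_le_mul (hcr n) (ht (hIcc n hI)) (abs_nonneg _) (inv_pos.2 hr).le
        _ = r⁻¹ := mul_one _)
  have hσt := hσ.tendsto_atTop
  have hzero : Tendsto (fun k => 1 / ((σ k : ℝ) + 1)) atTop (𝓝 0) :=
    tendsto_one_div_add_atTop_nhds_zero_nat.comp hσt
  have hφrho : ∀ t, rho ω (φ t) = 1 := fun t => by
    have h1 : Tendsto (fun k => |rho ω (c (σ k) • x (σ k) t) - 1|) atTop (𝓝 |rho ω (φ t) - 1|) :=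
      ((((continuous_rho hpos).tendsto _).comp (hφ t)).sub_const 1).abs
    have h2 := le_of_tendsto_of_tendsto h1 (hzero.const_mul r⁻¹) (by
      filter_upwards [hσt.eventually (eventually_mem_Icc t)] with k hk
      exact hrho _ t (hIcc _ hk))
    rw [mul_zero] at h2
    linarith [abs_nonpos_iff.1 h2]
  have hφ0 : ∀ t, φ t ≠ 0 := fun t => ne_zero_of_rho_pos (by rw [hφrho]; exact one_pos)
  have hcont : Continuous fun t => |⟪momentum ω (φ t), vecB N⟫_ℝ| := by
    refine Continuous.abs (Continuous.inner ?_ continuous_const)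
    exact continuous_iff_continuousAt.2 fun t =>
      ContinuousAt.comp (f := φ) (continuousAt_momentum hpos (hφ0 t)) hφc.continuousAt
  refine ⟨φ, v, hφrho, fun t₀ => ?_, hs, .of_forall hv⟩
  obtain ⟨P, hP⟩ := exists_norm_momentum_le hpos
  have hev : ∀ᶠ k in atTop, Set.Icc t₀ (t₀ + 1) ⊆ Set.Icc (-((σ k : ℝ) + 1)) (σ k + 1) := by
    filter_upwards [hσt.eventually (eventually_mem_Icc t₀),
      hσt.eventually (eventually_mem_Icc (t₀ + 1))] with k h1 h2
    exact (Set.Icc_subset_Icc h1.1 h2.2).trans (hIcc _)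
  have hu : Set.uIoc t₀ (t₀ + 1) ⊆ Set.Icc t₀ (t₀ + 1) := by
    rw [Set.uIoc_of_le (by linarith)]; exact Set.Ioc_subset_Icc_self
  have hintegr : Tendsto (fun k => ∫ τ in t₀..(t₀ + 1), |⟪momentum ω (x (σ k) τ), vecB N⟫_ℝ|) atTop
      (𝓝 (∫ τ in t₀..(t₀ + 1), |⟪momentum ω (φ τ), vecB N⟫_ℝ|)) := by
    refine intervalIntegral.tendsto_integral_filter_of_dominated_convergence
      (fun _ => P * ‖vecB N‖) ?_ ?_ intervalIntegrable_const ?_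
    · filter_upwards [hev] with k hk
      have h1 : ContinuousOn (x (σ k)) (Set.uIoc t₀ (t₀ + 1)) :=
        (hsol (σ k)).continuousOn.mono (hu.trans hk)
      refine ContinuousOn.aestronglyMeasurable ?_ measurableSet_uIoc
      refine ContinuousOn.abs (ContinuousOn.inner (𝕜 := ℝ) (fun τ hτ => ?_) continuousOn_const)
      exact (continuousAt_momentum hpos (hne _ τ (hk (hu hτ)))).comp_continuousWithinAt (h1 τ hτ)
    · filter_upwards [hev] with k hk
      refine .of_forall fun τ hτ => ?_
      rw [Real.norm_eq_abs, abs_abs]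
      refine (abs_real_inner_le_norm _ _).trans ?_
      gcongr
      exact hP _ (hne _ τ (hk (hu hτ)))
    · refine .of_forall fun τ hτ => ?_
      refine Tendsto.abs (Tendsto.inner (𝕜 := ℝ) ?_ tendsto_const_nhds)
      refine ((continuousAt_momentum hpos (hφ0 τ)).tendsto.comp (hφ τ)).congr' ?_
      filter_upwards [hev] with k hk
      exact momentum_smul hpos (hne _ τ (hk (hu hτ))) (hc0 _)
  -- The integral of `|(B, p)|` is the drop of `ρ`, which tends to zero. The limit integrand is
  -- continuous, so it vanishes at `t₀`.
  have hle : ∫ τ in t₀..(t₀ + 1), |⟪momentum ω (φ τ), vecB N⟫_ℝ| ≤ 0 := by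
    refine le_of_tendsto_of_tendsto hintegr hzero ?_
    filter_upwards [hev] with k hk
    have a1 := hk (Set.left_mem_Icc.2 (by linarith : t₀ ≤ t₀ + 1))
    have a2 := hk (Set.right_mem_Icc.2 (by linarith : t₀ ≤ t₀ + 1))
    rw [← (hmot _).rho_sub_rho hpos (hne _) a1 a2]
    exact hclose _ _ a1 _ a2
  by_contra hcon
  have := intervalIntegral.integral_pos (by linarith : t₀ < t₀ + 1) hcont.continuousOn
    (fun _ _ => abs_nonneg _) ⟨t₀, Set.left_mem_Icc.2 (by linarith), abs_pos.2 hcon⟩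
  linarith

/-- Above the level `(mu ω)⁻¹` the function `rho` drops by a definite amount on every interval of a
fixed length. -/
lemma exists_uniform_drop (hN : 0 < N) (hpos : ∀ i, 0 < ω i) (hω : NonResonant ω) {ε : ℝ}
    (hε : 0 < ε) : ∃ T > 0, ∃ δ > 0, ∀ (a : ℝ) (x : ℝ → Phase N),
      IsMotion ω (Set.Icc a (a + T)) x → (∀ t ∈ Set.Icc a (a + T), (mu ω)⁻¹ + ε ≤ rho ω (x t)) →
      δ ≤ rho ω (x a) - rho ω (x (a + T)) := by
  have hmu := mu_pos hN hpos hω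
  have hr : 0 < (mu ω)⁻¹ + ε := by positivity
  by_contra! hcon
  -- Failure with length `2n` and drop `1 / n`, recentred to `[-n, n]`, supplies the sequence of
  -- motions.
  obtain ⟨φ, v, h⟩ := exists_isSingularCurve_of_motions hN hpos hr fun n hn => by
    have hn' : (0 : ℝ) < n := Nat.cast_pos.2 hn
    obtain ⟨a, x, hx, hlow, hlt⟩ := hcon (2 * n) (by positivity) (1 / n) (by positivity)
    have e1 : -(n : ℝ) + (a + n) = a := by ring
    have e2 : (n : ℝ) + (a + n) = a + 2 * n := by ring
    refine ⟨fun t => x (t + (a + n)), IsMotion.comp_add (by rwa [e1, e2]), fun t ht => ?_, ?_⟩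
    · exact hlow _ ⟨by linarith [ht.1], by linarith [ht.2]⟩
    · simpa only [e1, e2] using hlt
  obtain ⟨K, hK, hmem⟩ := h.exists_mem_singularMaxima hpos hω
  have h1 : mu ω ≤ ((mu ω)⁻¹ + ε)⁻¹ := ((isLeast_mu hN hpos hω).2 hmem).trans hK
  have h2 : (mu ω)⁻¹ + ε ≤ (mu ω)⁻¹ := (le_inv_comm₀ hmu hr).1 h1
  linarith

lemma exists_linear_decay (hN : 0 < N) (hpos : ∀ i, 0 < ω i) (hω : NonResonant ω) {ε : ℝ}
    (hε : 0 < ε) : ∃ c : ℝ, 0 < c ∧ ∃ T₀ : ℝ, 0 < T₀ ∧ ∀ (a b : ℝ) (x : ℝ → Phase N), T₀ ≤ b - a →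
      IsMotion ω (Set.Icc a b) x → (∀ t ∈ Set.Icc a b, (mu ω)⁻¹ + ε ≤ rho ω (x t)) →
      c * (b - a) ≤ rho ω (x a) - rho ω (x b) := by
  obtain ⟨T, hT, δ, hδ, hdrop⟩ := exists_uniform_drop hN hpos hω hε
  -- An interval of length at least `T` contains `k ≥ 1` full blocks of length `T`, and its length
  -- is below `(k + 1) T ≤ 2 k T`; the factor 2 pays for the incomplete block.
  refine ⟨δ / (2 * T), by positivity, T, hT, fun a b x hab hx hlow => ?_⟩
  have hmu := mu_pos hN hpos hω
  have hr : 0 < (mu ω)⁻¹ + ε := by positivity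
  have hne : ∀ t ∈ Set.Icc a b, x t ≠ 0 := fun t ht => ne_zero_of_rho_pos (hr.trans_le (hlow t ht))
  have hq : 0 ≤ (b - a) / T := div_nonneg (by linarith) hT.le
  set k := ⌊(b - a) / T⌋₊
  have hk1 : (k : ℝ) * T ≤ b - a := (le_div_iff₀ hT).1 (Nat.floor_le hq)
  have hk2 : b - a < ((k : ℝ) + 1) * T := (div_lt_iff₀ hT).1 (Nat.lt_floor_add_one _)
  have hk3 : (1 : ℝ) ≤ k := by
    exact_mod_cast (Nat.one_le_floor_iff _).2 ((one_le_div hT).2 hab)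
  have hind : ∀ j : ℕ, j ≤ k → (j : ℝ) * δ ≤ rho ω (x a) - rho ω (x (a + j * T)) := by
    intro j
    induction j with
    | zero => intro _; simp
    | succ j ih =>
      intro hj
      have h1 := ih (by omega)
      have hj' : ((j : ℝ) + 1) * T ≤ k * T := by
        have : (j : ℝ) + 1 ≤ k := by exact_mod_cast hj
        gcongr
      have hsub : Set.Icc (a + j * T) (a + j * T + T) ⊆ Set.Icc a b :=
        Set.Icc_subset_Icc (by have : 0 ≤ (j : ℝ) * T := by positivity
                               linarith) (by linarith)
      have h2 := hdrop _ x (hx.mono hsub) fun t ht => hlow t (hsub ht)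
      have e : a + ((j + 1 : ℕ) : ℝ) * T = a + j * T + T := by push_cast; ring
      rw [e]
      push_cast
      linarith
  have h1 := hind k le_rfl
  have hkT : 0 ≤ (k : ℝ) * T := by positivity
  have h2 := hx.rho_antitone hpos hne (s := a + k * T) (t := b) ⟨by linarith, by linarith⟩
    ⟨by linarith, le_rfl⟩ (by linarith)
  have h3 : δ / (2 * T) * (b - a) ≤ k * δ := by
    calc δ / (2 * T) * (b - a) ≤ δ / (2 * T) * ((k + k) * T) := by
          gcongr
          exact hk2.le.trans (by gcongr)
      _ = k * δ := by field_simp; ring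
  linarith

end Oscillators

end

theorem theorem4 {N : ℕ} (hN : 0 < N) (ω : Fin N → ℝ) (hpos : ∀ i, 0 < ω i)
    (hω : Oscillators.NonResonant ω) :
    -- `μ` is a genuine minimum and is strictly positive
    IsLeast (Oscillators.singularMaxima ω) (Oscillators.mu ω) ∧
    0 < Oscillators.mu ω ∧
    ∀ ε : ℝ, 0 < ε →
      (∃ c : ℝ, 0 < c ∧ ∃ T₀ : ℝ, 0 < T₀ ∧
        ∀ (a b : ℝ) (x : ℝ → Oscillators.Phase N), T₀ ≤ b - a →
          Oscillators.IsMotion ω (Set.Icc a b) x →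
          (∀ t ∈ Set.Icc a b, (Oscillators.mu ω)⁻¹ + ε ≤ Oscillators.rho ω (x t)) →
          c * (b - a) ≤ Oscillators.rho ω (x a) - Oscillators.rho ω (x b)) ∧
      (∃ (x : ℝ → Oscillators.Phase N) (r : ℝ),
        Oscillators.IsMotion ω Set.univ x ∧
        (∀ t, Oscillators.rho ω (x t) = r) ∧
        (Oscillators.mu ω)⁻¹ - ε ≤ r ∧ r ≤ (Oscillators.mu ω)⁻¹) := by
  have hmu := Oscillators.mu_pos hN hpos hω
  refine ⟨Oscillators.isLeast_mu hN hpos hω, hmu, fun ε hε =>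
    ⟨Oscillators.exists_linear_decay hN hpos hω hε, ?_⟩⟩
  obtain ⟨x, hx, hr⟩ := Oscillators.exists_stationary_motion hN hpos hω
  exact ⟨x, _, hx, hr, by linarith, le_rfl⟩
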